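/- For a finite multiset $Z$ of positive reals let $\Sigma(Z)$ be the sum of its elements. For $X,Y$ put $R(X,Y)=\max\{\Sigma(X)/\Sigma(Y),\,\Sigma(Y)/\Sigma(X)\}$ with the convention $z/0=\infty$ for all $z\ge 0$, and let $\mathrm{OPT}(I)=\min\{R(X,Y) : X,Y\subseteq I \text{ disjoint}\}$ (subsets and disjointness being understood with multiplicities). **Theorem.** There are a constant $C$ and a single Real RAM program (a uniform algorithm on a machine that stores real numbers and performs exact $+,-,\cdot,/$, floor, comparisons and indirect memory accesses in unit time) such that the following holds. For every $n\ge 2$, every $\varepsilon\in(0,1)$ and all positive reals $I[1]\le\dots\le I[n]$, the program, given $n$, $\varepsilon$ and the items in this sorted order, halts after at most $C\cdot n/\varepsilon^{0.9386}$ steps and outputs disjoint $X,Y\subseteq I$ with $R(X,Y)\le(1+\varepsilon)\,\mathrm{OPT}(I)$. In other words, Subset Sum Ratio has a $(1+\varepsilon)$-approximation algorithm running in time $O(n/\varepsilon^{0.9386})$ on the Real RAM, if the items are given in sorted order. -/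

import Mathlib

/-! ### The Real RAM

A machine with real-valued registers (`var`) and real-valued arrays (`arr`), indirect addressing,
exact arithmetic `+ - * /`, the floor function and exact comparisons, each at unit cost.
Programs are finite structured programs with rational constants, so that a program mentions only
finitely many registers and arrays and does not depend on the input. -/

namespace RealRAM

/-- A memory state: the register contents and the array contents. -/
structure State where
  var : ℕ → ℝ
  arr : ℕ → ℕ → ℝ

/-- Arithmetic expressions. `read a e` is the content of array `a` at the position given by `e`. -/
inductive Expr where
  | const (q : ℚ)
  | var (x : ℕ)
  | read (a : ℕ) (e : Expr)
  | add (e f : Expr)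
  | sub (e f : Expr)
  | mul (e f : Expr)
  | div (e f : Expr)
  | floor (e : Expr)

/-- The address denoted by a real number. On natural numbers this is the identity; in general it is
`⌊max x 0⌋`, which the machine can compute itself. -/
noncomputable def address (x : ℝ) : ℕ := ⌊x⌋₊

namespace Expr

/-- The value of an expression. (Division by zero yields `0`; a program can test for it.) -/
noncomputable def eval (s : State) : Expr → ℝ
  | const q => (q : ℝ)
  | var x => s.var x
  | read a e => s.arr a (address (e.eval s))
  | add e f => e.eval s + f.eval s
  | sub e f => e.eval s - f.eval s
  | mul e f => e.eval s * f.eval s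
  | div e f => e.eval s / f.eval s
  | floor e => (⌊e.eval s⌋ : ℝ)

/-- Evaluating an expression costs one step per symbol. -/
def cost : Expr → ℕ
  | const _ => 1
  | var _ => 1
  | read _ e => e.cost + 1
  | add e f => e.cost + f.cost + 1
  | sub e f => e.cost + f.cost + 1
  | mul e f => e.cost + f.cost + 1
  | div e f => e.cost + f.cost + 1
  | floor e => e.cost + 1

end Expr

/-- Tests. -/
inductive Test where
  | le (e f : Expr)
  | lt (e f : Expr)
  | and (b c : Test)
  | not (b : Test)

namespace Test

/-- The test succeeds in the state `s`. -/
def Holds (s : State) : Test → Prop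
  | le e f => e.eval s ≤ f.eval s
  | lt e f => e.eval s < f.eval s
  | and b c => b.Holds s ∧ c.Holds s
  | not b => ¬ b.Holds s

/-- Evaluating a test costs one step per symbol. -/
def cost : Test → ℕ
  | le e f => e.cost + f.cost + 1
  | lt e f => e.cost + f.cost + 1
  | and b c => b.cost + c.cost + 1
  | not b => b.cost + 1

end Test

/-- Programs. `assign x e` writes the value of `e` to register `x`; `write a e f` writes the value
of `f` to array `a` at the position given by `e`. -/
inductive Program where
  | skip
  | assign (x : ℕ) (e : Expr)
  | write (a : ℕ) (e f : Expr)
  | seq (p q : Program)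
  | ite (b : Test) (p q : Program)
  | loop (b : Test) (p : Program)

/-- Overwrite register `x`. -/
def State.setVar (s : State) (x : ℕ) (v : ℝ) : State :=
  { s with var := Function.update s.var x v }

/-- Overwrite position `i` of array `a`. -/
def State.setArr (s : State) (a i : ℕ) (v : ℝ) : State :=
  { s with arr := Function.update s.arr a (Function.update (s.arr a) i v) }

/-- `Exec p s t s'`: started in the state `s`, the program `p` halts after exactly `t` steps, in the
state `s'`. -/
inductive Exec : Program → State → ℕ → State → Prop where
  | skip (s : State) : Exec Program.skip s 1 s
  | assign (s : State) (x : ℕ) (e : Expr) :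
      Exec (Program.assign x e) s (e.cost + 1) (s.setVar x (e.eval s))
  | write (s : State) (a : ℕ) (e f : Expr) :
      Exec (Program.write a e f) s (e.cost + f.cost + 1)
        (s.setArr a (address (e.eval s)) (f.eval s))
  | seq {p q : Program} {s s' s'' : State} {t t' : ℕ} :
      Exec p s t s' → Exec q s' t' s'' → Exec (Program.seq p q) s (t + t') s''
  | ite_true {b : Test} {p q : Program} {s s' : State} {t : ℕ} :
      b.Holds s → Exec p s t s' → Exec (Program.ite b p q) s (b.cost + 1 + t) s'
  | ite_false {b : Test} {p q : Program} {s s' : State} {t : ℕ} :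
      ¬ b.Holds s → Exec q s t s' → Exec (Program.ite b p q) s (b.cost + 1 + t) s'
  | loop_false {b : Test} {p : Program} {s : State} :
      ¬ b.Holds s → Exec (Program.loop b p) s (b.cost + 1) s
  | loop_true {b : Test} {p : Program} {s s' s'' : State} {t t' : ℕ} :
      b.Holds s → Exec p s t s' → Exec (Program.loop b p) s' t' s'' →
      Exec (Program.loop b p) s (b.cost + 1 + t + t') s''

/-- The machine is deterministic: a program has at most one halting run from a given state, so its
number of steps and its final state are well defined. -/
theorem Exec.deterministic {p : Program} {s s₁ s₂ : State} {t₁ t₂ : ℕ}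
    (h₁ : Exec p s t₁ s₁) (h₂ : Exec p s t₂ s₂) : t₁ = t₂ ∧ s₁ = s₂ := by
  induction h₁ generalizing t₂ s₂ with
  | skip s => cases h₂; exact ⟨rfl, rfl⟩
  | assign s x e => cases h₂; exact ⟨rfl, rfl⟩
  | write s a e f => cases h₂; exact ⟨rfl, rfl⟩
  | seq _ _ ih ih' =>
    cases h₂ with
    | seq k k' =>
      obtain ⟨rfl, rfl⟩ := ih k
      obtain ⟨rfl, rfl⟩ := ih' k'
      exact ⟨rfl, rfl⟩
  | ite_true hb _ ih =>
    cases h₂ with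
    | ite_true _ k => obtain ⟨rfl, rfl⟩ := ih k; exact ⟨rfl, rfl⟩
    | ite_false hb' _ => exact absurd hb hb'
  | ite_false hb _ ih =>
    cases h₂ with
    | ite_true hb' _ => exact absurd hb' hb
    | ite_false _ k => obtain ⟨rfl, rfl⟩ := ih k; exact ⟨rfl, rfl⟩
  | loop_false hb =>
    cases h₂ with
    | loop_false _ => exact ⟨rfl, rfl⟩
    | loop_true hb' _ _ => exact absurd hb' hb
  | loop_true hb _ _ ih ih' =>
    cases h₂ with
    | loop_false hb' => exact absurd hb hb'
    | loop_true _ k k' =>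
      obtain ⟨rfl, rfl⟩ := ih k
      obtain ⟨rfl, rfl⟩ := ih' k'
      exact ⟨rfl, rfl⟩

end RealRAM

/-! ### Subset Sum Ratio

An instance is a finite sequence of items; subsets are sets of indices, so that repeated items are
counted with their multiplicity. -/

namespace SubsetSumRatio

/-- Division of nonnegative reals with the convention `x / 0 = ∞`, also for `x = 0`. -/
noncomputable def quot (x y : ℝ) : ENNReal :=
  if y = 0 then ⊤ else ENNReal.ofReal (x / y)

/-- The ratio `R(X, Y) = max {Σ(X)/Σ(Y), Σ(Y)/Σ(X)}`. -/
noncomputable def ratio {n : ℕ} (I : Fin n → ℝ) (X Y : Finset (Fin n)) : ENNReal :=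
  max (quot (∑ i ∈ X, I i) (∑ i ∈ Y, I i)) (quot (∑ i ∈ Y, I i) (∑ i ∈ X, I i))

/-- The optimal ratio: the minimum of `R(X, Y)` over all disjoint `X, Y`. -/
noncomputable def opt {n : ℕ} (I : Fin n → ℝ) : ENNReal :=
  ⨅ (X : Finset (Fin n)) (Y : Finset (Fin n)) (_ : Disjoint X Y), ratio I X Y

/-- The initial state: register `0` holds `n`, register `1` holds `ε`, array `0` holds the items at
positions `0, …, n - 1`, and everything else is `0`. -/
noncomputable def input {n : ℕ} (I : Fin n → ℝ) (ε : ℝ) : RealRAM.State where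
  var x := if x = 0 then (n : ℝ) else if x = 1 then ε else 0
  arr a i := if h : a = 0 ∧ i < n then I ⟨i, h.2⟩ else 0

/-- The state `s` outputs the pair `(X, Y)`: array `1` holds at positions `0, …, n - 1` the value
`1` for the items of `X`, the value `-1` for the items of `Y`, and `0` for all other items. -/
def Outputs {n : ℕ} (s : RealRAM.State) (X Y : Finset (Fin n)) : Prop :=
  ∀ i : Fin n, s.arr 1 i = if i ∈ X then 1 else if i ∈ Y then -1 else 0

end SubsetSumRatio

/-! Let `N` be about `1/ε`. Fix the largest item `I k` that may be used and a threshold `1 + lam`.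
Every item goes to the first set, to the second set or to neither, and such a pattern matters only
through its difference and its total. Patterns whose differences fall into the same narrow bucket
can be merged, keeping the larger total. The search is a meet in the middle. One list holds the
patterns of the `m` largest items and has at most `3^m` entries. A second list holds the patterns of
the next items, up to `J` items in all, and is cut off as soon as it has more than `B` entries. A
two-pointer sweep then looks for a pair of entries of combined ratio below `1 + lam`. Up to
logarithmic factors this costs `3^m + B` for each `k`.

The point is that the cut-off loses nothing if the searches fail for every `k`. There are two cases.

Dense case, `G * I k ≤ I (k - m)`. If two subset sums were almost equal although the subsets differ
in an item of size at least `G * I k`, then the difference of the subsets would be a balanced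
pattern of large total and would have been accepted (`excluded_collision`). After a failure the
subset sums are therefore separated. Each of the `2^m` sets of large items can be combined with each
cell met by a sum of the remaining items, and the results almost inject into about `N/G` cells. So
the remaining items meet about `N/(G 2^m)` cells, and the second list is at most about the square of
that (`exhaustive_of_dense`). Pigeonhole on the subsets of `M` items then gives `I (k - M) < G * I
k` (`decay`).

Sparse case. By the decay, all items from the `m`-th on sum to at most about `G * I k`, so only
about `N G` buckets occur (`exhaustive`).

The decay also makes the items beyond the `J`-th negligible (`tail_le`). Hence failure for all `k`
shows that no ratio is much smaller than `1 + lam` (`not_good_of_unsuccessful`), while an accepted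
pair is a genuine solution (`witness_of_accepts`).

Up to polynomial factors in `r`, with `N = 2^(h r)`, the length bound must satisfy `B ≥ N G` and `B
≥ (N/G)^2 / 4^m`. Balancing these with `B = 3^m` gives the exponent `4 / (3 + 2 log_3 2)`, which is
just below `0.9386`.

A binary search over `lam` between `1/(2N)` and `2` finishes (`bisect_spec`). If it finds no
witness, then no ratio is at most `2`, every item exceeds the sum of all smaller ones
(`sum_range_lt`), and the best choice is one item against all smaller ones (`optimal_of_greedy`). -/

/-! ### Verification of programs -/

namespace RealRAM

/-- The registers written by a program. -/
def Program.wv : Program → List ℕ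
  | skip => []
  | assign x _ => [x]
  | write _ _ _ => []
  | seq p q => p.wv ++ q.wv
  | ite _ p q => p.wv ++ q.wv
  | loop _ p => p.wv

/-- The arrays written by a program. -/
def Program.wa : Program → List ℕ
  | skip => []
  | assign _ _ => []
  | write a _ _ => [a]
  | seq p q => p.wa ++ q.wa
  | ite _ p q => p.wa ++ q.wa
  | loop _ p => p.wa

theorem Exec.var_eq {p : Program} {s s' : State} {t : ℕ} (h : Exec p s t s') {x : ℕ}
    (hx : x ∉ p.wv) : s'.var x = s.var x := by
  induction h with
  | skip | write | loop_false => rfl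
  | assign s y e =>
    have : x ≠ y := by simpa [Program.wv] using hx
    simp [State.setVar, this]
  | seq _ _ ih ih' =>
    simp only [Program.wv, List.mem_append, not_or] at hx
    rw [ih' hx.2, ih hx.1]
  | ite_true _ _ ih =>
    simp only [Program.wv, List.mem_append, not_or] at hx
    exact ih hx.1
  | ite_false _ _ ih =>
    simp only [Program.wv, List.mem_append, not_or] at hx
    exact ih hx.2
  | loop_true _ _ _ ih ih' => rw [ih' hx, ih hx]

theorem Exec.arr_eq {p : Program} {s s' : State} {t : ℕ} (h : Exec p s t s') {a : ℕ}
    (ha : a ∉ p.wa) : s'.arr a = s.arr a := by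
  induction h with
  | skip | assign | loop_false => rfl
  | write s b e f =>
    have : a ≠ b := by simpa [Program.wa] using ha
    simp [State.setArr, this]
  | seq _ _ ih ih' =>
    simp only [Program.wa, List.mem_append, not_or] at ha
    rw [ih' ha.2, ih ha.1]
  | ite_true _ _ ih =>
    simp only [Program.wa, List.mem_append, not_or] at ha
    exact ih ha.1
  | ite_false _ _ ih =>
    simp only [Program.wa, List.mem_append, not_or] at ha
    exact ih ha.2
  | loop_true _ _ _ ih ih' => rw [ih' ha, ih ha]

/-- `s'` agrees with `s` outside of what `p` writes. -/
def Frame (p : Program) (s s' : State) : Prop :=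
  (∀ x, x ∉ p.wv → s'.var x = s.var x) ∧ ∀ a, a ∉ p.wa → s'.arr a = s.arr a

theorem Frame.refl (p : Program) (s : State) : Frame p s s := ⟨fun _ _ => rfl, fun _ _ => rfl⟩

theorem Frame.trans {p : Program} {s s' s'' : State} (h : Frame p s s') (h' : Frame p s' s'') :
    Frame p s s'' :=
  ⟨fun x hx => (h'.1 x hx).trans (h.1 x hx), fun a ha => (h'.2 a ha).trans (h.2 a ha)⟩

theorem Exec.frame {p : Program} {s s' : State} {t : ℕ} (h : Exec p s t s') : Frame p s s' :=
  ⟨fun _ hx => h.var_eq hx, fun _ ha => h.arr_eq ha⟩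

/-- From the state `s` the program `p` halts within `T` steps in a state satisfying `Q`. -/
def Runs (p : Program) (s : State) (T : ℝ) (Q : State → Prop) : Prop :=
  ∃ (t : ℕ) (s' : State), Exec p s t s' ∧ (t : ℝ) ≤ T ∧ Q s'

/-- What a program leaves alone is read off its syntax. The specifications below therefore mention
only what changes, and all other registers and arrays are carried along by deciding membership in
`wv` and `wa`. -/
theorem Runs.frame {p : Program} {s : State} {T : ℝ} {Q : State → Prop} (h : Runs p s T Q) :
    Runs p s T fun s' => Q s' ∧ Frame p s s' := by
  obtain ⟨t, s', he, ht, hq⟩ := h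
  exact ⟨t, s', he, ht, hq, he.frame⟩

theorem Runs.mono {p : Program} {s : State} {T T' : ℝ} {Q Q' : State → Prop} (h : Runs p s T Q)
    (hT : T ≤ T') (hQ : ∀ s', Q s' → Q' s') : Runs p s T' Q' := by
  obtain ⟨t, s', he, ht, hq⟩ := h
  exact ⟨t, s', he, ht.trans hT, hQ _ hq⟩

theorem Runs.seq {p q : Program} {s : State} {T T' T'' : ℝ} {Q R : State → Prop}
    (h : Runs p s T Q) (h' : ∀ s', Q s' → Frame p s s' → Runs q s' T' R) (hT : T + T' ≤ T'') :
    Runs (p.seq q) s T'' R := by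
  obtain ⟨t, s', he, ht, hq, hf⟩ := h.frame
  obtain ⟨t', s'', he', ht', hr⟩ := h' s' hq hf
  refine ⟨t + t', s'', he.seq he', ?_, hr⟩
  push_cast
  linarith

theorem Runs.ite {b : Test} {p q : Program} {s : State} {T T' : ℝ} {Q : State → Prop}
    (h : b.Holds s → Runs p s T Q) (h' : ¬ b.Holds s → Runs q s T Q)
    (hT : b.cost + 1 + T ≤ T') : Runs (.ite b p q) s T' Q := by
  by_cases hb : b.Holds s
  · obtain ⟨t, s', he, ht, hq⟩ := h hb
    refine ⟨_, s', .ite_true hb he, ?_, hq⟩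
    push_cast
    linarith
  · obtain ⟨t, s', he, ht, hq⟩ := h' hb
    refine ⟨_, s', .ite_false hb he, ?_, hq⟩
    push_cast
    linarith

/-- A loop whose invariant carries a bound `v` on the number of remaining iterations. -/
theorem Runs.loop {b : Test} {p : Program} {s : State} {T c : ℝ} (Inv : ℕ → State → Prop) (v : ℕ)
    (hc : 0 ≤ c) (h : Inv v s)
    (step : ∀ v' s', Inv v' s' → Frame p s s' → b.Holds s' →
      Runs p s' c fun s'' => ∃ v'' < v', Inv v'' s'')
    (hT : v * (c + b.cost + 1) + b.cost + 1 ≤ T) :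
    Runs (.loop b p) s T fun s' => (∃ v', Inv v' s') ∧ ¬ b.Holds s' ∧ Frame p s s' := by
  have key : ∀ v' s', Inv v' s' → Frame p s s' →
      Runs (.loop b p) s' (v' * (c + b.cost + 1) + b.cost + 1)
        fun s' => (∃ v', Inv v' s') ∧ ¬ b.Holds s' := by
    intro v'
    induction v' using Nat.strong_induction_on with
    | _ v' ih =>
      intro s' hi hf
      by_cases hb : b.Holds s'
      · obtain ⟨t, s₁, he, ht, ⟨v₁, hv, hi₁⟩, hf₁⟩ := (step v' s' hi hf hb).frame
        obtain ⟨t', s₂, he', ht', hq⟩ := ih v₁ hv s₁ hi₁ (hf.trans hf₁)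
        refine ⟨_, s₂, .loop_true hb he he', ?_, hq⟩
        have hv' : (v₁ : ℝ) + 1 ≤ v' := by exact_mod_cast hv
        have hb : (0 : ℝ) ≤ b.cost := Nat.cast_nonneg _
        push_cast
        nlinarith
      · refine ⟨_, s', .loop_false hb, ?_, ⟨v', hi⟩, hb⟩
        push_cast
        have : (0 : ℝ) ≤ v' * (c + b.cost + 1) := by positivity
        linarith
  exact (key v s h (.refl _ _)).frame.mono hT fun _ h => ⟨h.1.1, h.1.2, h.2⟩

/-- The program contains no loop. -/
def Program.loopFree : Program → Bool
  | skip => true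
  | assign _ _ => true
  | write _ _ _ => true
  | seq p q => p.loopFree && q.loopFree
  | ite _ p q => p.loopFree && q.loopFree
  | loop _ _ => false

/-- An upper bound on the running time of a loop-free program. -/
def Program.bound : Program → ℕ
  | skip => 1
  | assign _ e => e.cost + 1
  | write _ e f => e.cost + f.cost + 1
  | seq p q => p.bound + q.bound
  | ite b p q => b.cost + 1 + (p.bound + q.bound)
  | loop _ _ => 0

open Classical in
/-- The final state of a loop-free program. -/
noncomputable def Program.run : Program → State → State
  | skip, s => s
  | assign x e, s => s.setVar x (e.eval s)
  | write a e f, s => s.setArr a (address (e.eval s)) (f.eval s)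
  | seq p q, s => q.run (p.run s)
  | ite b p q, s => if b.Holds s then p.run s else q.run s
  | loop _ _, s => s

theorem Program.exec_run (p : Program) (hp : p.loopFree = true) (s : State) :
    ∃ t ≤ p.bound, Exec p s t (p.run s) := by
  induction p generalizing s with
  | skip => exact ⟨_, le_rfl, .skip s⟩
  | assign x e => exact ⟨_, le_rfl, .assign s x e⟩
  | write a e f => exact ⟨_, le_rfl, .write s a e f⟩
  | seq p q ih ih' =>
    simp only [loopFree, Bool.and_eq_true] at hp
    obtain ⟨t, ht, he⟩ := ih hp.1 s
    obtain ⟨t', ht', he'⟩ := ih' hp.2 (p.run s)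
    exact ⟨_, add_le_add ht ht', he.seq he'⟩
  | ite b p q ih ih' =>
    simp only [loopFree, Bool.and_eq_true] at hp
    by_cases hb : b.Holds s
    · obtain ⟨t, ht, he⟩ := ih hp.1 s
      refine ⟨_, ?_, by simpa only [run, if_pos hb] using Exec.ite_true hb he⟩
      simp only [bound]; omega
    · obtain ⟨t, ht, he⟩ := ih' hp.2 s
      refine ⟨_, ?_, by simpa only [run, if_neg hb] using Exec.ite_false hb he⟩
      simp only [bound]; omega
  | loop b p => simp [loopFree] at hp

/-- Straight-line code is verified by symbolic evaluation of `run`, and its cost bound is a numeral.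
-/
theorem Runs.of_loopFree {p : Program} {s : State} {T : ℝ} {Q : State → Prop}
    (hp : p.loopFree = true) (hT : (p.bound : ℝ) ≤ T) (h : Q (p.run s)) : Runs p s T Q := by
  obtain ⟨t, ht, he⟩ := p.exec_run hp s
  exact ⟨t, _, he, le_trans (by exact_mod_cast ht) hT, h⟩

/-! ### Symbolic evaluation of expressions and states -/

instance : Add Expr := ⟨.add⟩
instance : Sub Expr := ⟨.sub⟩
instance : Mul Expr := ⟨.mul⟩
instance : Div Expr := ⟨.div⟩

@[simp] theorem Expr.eval_const (s : State) (q : ℚ) : (Expr.const q).eval s = q := rfl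
@[simp] theorem Expr.eval_var (s : State) (x : ℕ) : (Expr.var x).eval s = s.var x := rfl
@[simp] theorem Expr.eval_read (s : State) (a : ℕ) (e : Expr) :
    (Expr.read a e).eval s = s.arr a (address (e.eval s)) := rfl
@[simp] theorem Expr.eval_add (s : State) (e f : Expr) : (e + f).eval s = e.eval s + f.eval s := rfl
@[simp] theorem Expr.eval_sub (s : State) (e f : Expr) : (e - f).eval s = e.eval s - f.eval s := rfl
@[simp] theorem Expr.eval_mul (s : State) (e f : Expr) : (e * f).eval s = e.eval s * f.eval s := rfl
@[simp] theorem Expr.eval_div (s : State) (e f : Expr) : (e / f).eval s = e.eval s / f.eval s := rfl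
@[simp] theorem Expr.eval_floor (s : State) (e : Expr) :
    (Expr.floor e).eval s = (⌊e.eval s⌋ : ℝ) := rfl

@[simp] theorem Test.holds_le (s : State) (e f : Expr) :
    (Test.le e f).Holds s ↔ e.eval s ≤ f.eval s := Iff.rfl
@[simp] theorem Test.holds_lt (s : State) (e f : Expr) :
    (Test.lt e f).Holds s ↔ e.eval s < f.eval s := Iff.rfl
@[simp] theorem Test.holds_and (s : State) (b c : Test) :
    (Test.and b c).Holds s ↔ b.Holds s ∧ c.Holds s := Iff.rfl

@[simp] theorem State.setVar_var (s : State) (x y : ℕ) (v : ℝ) :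
    (s.setVar x v).var y = if y = x then v else s.var y := by
  simp [State.setVar, Function.update_apply]
@[simp] theorem State.setVar_arr (s : State) (x : ℕ) (v : ℝ) : (s.setVar x v).arr = s.arr := rfl
@[simp] theorem State.setArr_var (s : State) (a i : ℕ) (v : ℝ) : (s.setArr a i v).var = s.var := rfl
@[simp] theorem State.setArr_arr (s : State) (a i b j : ℕ) (v : ℝ) :
    (s.setArr a i v).arr b j = if b = a ∧ j = i then v else s.arr b j := by
  by_cases hb : b = a
  · subst hb; simp [State.setArr, Function.update_apply]
  · simp [State.setArr, hb]

@[simp] theorem address_natCast (i : ℕ) : address (i : ℝ) = i := by simp [address]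
@[simp] theorem address_zero : address 0 = 0 := by simp [address]
theorem address_sub (i j : ℕ) : address ((i : ℝ) - j) = i - j := by simp [address, Nat.floor_sub_natCast]
@[simp] theorem address_sub_one (i : ℕ) : address ((i : ℝ) - 1) = i - 1 := by
  simpa using address_sub i 1

end RealRAM

/-! ### Lists of signed sums -/

namespace SubsetSumRatio

/-- A pair of disjoint sets, given by its two sums and a code. -/
@[ext] structure Entry where
  sx : ℝ
  sy : ℝ
  co : ℝ

namespace Entry

/-- The difference of the two sums. -/
def diff (e : Entry) : ℝ := e.sx - e.sy

/-- The total of the two sums. -/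
def tot (e : Entry) : ℝ := e.sx + e.sy

/-- Put an item of size `x` and weight `w` into neither, the first, or the second set. -/
def shift (x w : ℝ) (c : Fin 3) (e : Entry) : Entry :=
  if c = 0 then e else if c = 1 then ⟨e.sx + x, e.sy, e.co + w⟩ else ⟨e.sx, e.sy + x, e.co + 2 * w⟩

/-- The difference, rounded down to a multiple of `δ`. -/
noncomputable def bucket (δ : ℝ) (e : Entry) : ℤ := ⌊e.diff / δ⌋

theorem bucket_mono {δ : ℝ} (hδ : 0 < δ) {e f : Entry} (h : e.diff ≤ f.diff) :
    e.bucket δ ≤ f.bucket δ :=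
  Int.floor_le_floor (by gcongr)

theorem diff_lt_of_bucket_lt {δ : ℝ} (hδ : 0 < δ) {e f : Entry} (h : e.bucket δ < f.bucket δ) :
    e.diff < f.diff := by
  by_contra! h'
  exact absurd (bucket_mono hδ h') (not_le.2 h)

theorem abs_diff_sub_lt {δ : ℝ} (hδ : 0 < δ) {e f : Entry} (h : e.bucket δ = f.bucket δ) :
    |e.diff - f.diff| < δ := by
  have := Int.abs_sub_lt_one_of_floor_eq_floor h
  rw [← sub_div, abs_div, abs_of_pos hδ, div_lt_one hδ] at this
  exact this

theorem shift_diff (x w : ℝ) (c : Fin 3) (e : Entry) :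
    (e.shift x w c).diff = e.diff + if c = 0 then 0 else if c = 1 then x else -x := by
  fin_cases c <;> simp [shift, diff] <;> ring

theorem shift_tot (x w : ℝ) (c : Fin 3) (e : Entry) :
    (e.shift x w c).tot = e.tot + if c = 0 then 0 else x := by
  fin_cases c <;> simp [shift, tot] <;> ring

end Entry

/-- `f` lists `n` entries in strictly increasing buckets. -/
def Increasing (δ : ℝ) (n : ℕ) (f : ℕ → Entry) : Prop :=
  ∀ i j, i < j → j < n → (f i).bucket δ < (f j).bucket δ

/-- A list with increasing buckets is also sorted by exact difference, which is what the merge and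
the sweep compare. -/
theorem Increasing.diff_le {δ : ℝ} (hδ : 0 < δ) {n : ℕ} {f : ℕ → Entry} (h : Increasing δ n f)
    {i j : ℕ} (hij : i ≤ j) (hj : j < n) : (f i).diff ≤ (f j).diff := by
  rcases hij.eq_or_lt with rfl | hij
  · rfl
  · exact (Entry.diff_lt_of_bucket_lt hδ (h i j hij hj)).le

/-- The list `f'` arises from the list `f` by adding an item and keeping one entry per bucket. -/
structure Extends (δ x w : ℝ) (n : ℕ) (f : ℕ → Entry) (n' : ℕ) (f' : ℕ → Entry) : Prop where
  incr : Increasing δ n' f'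
  src : ∀ i < n', ∃ j < n, ∃ c, f' i = (f j).shift x w c
  dom : ∀ j < n, ∀ c, ∃ i < n', (f' i).bucket δ = ((f j).shift x w c).bucket δ ∧
    ((f j).shift x w c).tot ≤ (f' i).tot
  card : n' ≤ 3 * n

/-- The state of the merge: `p c` entries with shift `c` have been consumed. -/
structure Merging (δ x w : ℝ) (n : ℕ) (f : ℕ → Entry) (p : Fin 3 → ℕ) (n' : ℕ) (f' : ℕ → Entry) :
    Prop where
  incr : Increasing δ n' f'
  src : ∀ i < n', ∃ j < n, ∃ c, f' i = (f j).shift x w c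
  dom : ∀ c, ∀ j < p c, ∃ i < n', (f' i).bucket δ = ((f j).shift x w c).bucket δ ∧
    ((f j).shift x w c).tot ≤ (f' i).tot
  card : n' ≤ p 0 + p 1 + p 2
  -- The program only tests whether the new bucket is at most the last one; this field turns that
  -- into equality.
  last : 0 < n' → ∀ c, p c < n → (f' (n' - 1)).bucket δ ≤ ((f (p c)).shift x w c).bucket δ
  le : ∀ c, p c ≤ n

theorem Merging.init (δ x w : ℝ) (n : ℕ) (f f' : ℕ → Entry) :
    Merging δ x w n f (fun _ => 0) 0 f' where
  incr _ _ _ h := absurd h (Nat.not_lt_zero _)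
  src _ h := absurd h (Nat.not_lt_zero _)
  dom _ _ h := absurd h (Nat.not_lt_zero _)
  card := Nat.zero_le _
  last h := absurd h (lt_irrefl _)
  le _ := Nat.zero_le _

theorem Merging.extends {δ x w : ℝ} {n : ℕ} {f : ℕ → Entry} {p : Fin 3 → ℕ} {n' : ℕ}
    {f' : ℕ → Entry} (h : Merging δ x w n f p n' f') (hp : ∀ c, p c = n) :
    Extends δ x w n f n' f' where
  incr := h.incr
  src := h.src
  dom j hj c := h.dom c j (by rw [hp]; exact hj)
  card := by have := h.card; simp only [hp] at this; omega

/-- Consuming the smallest remaining entry. -/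
theorem Merging.step {δ x w : ℝ} (hδ : 0 < δ) {n : ℕ} {f : ℕ → Entry} {p : Fin 3 → ℕ} {n' : ℕ}
    {f' : ℕ → Entry} (h : Merging δ x w n f p n' f') (hf : Increasing δ n f) (c : Fin 3)
    (hc : p c < n)
    (hmin : ∀ c', p c' < n → ((f (p c)).shift x w c).diff ≤ ((f (p c')).shift x w c').diff)
    {n'' : ℕ} {f'' : ℕ → Entry}
    (hnew : n'' = n' + 1 ∧ (∀ i < n', f'' i = f' i) ∧ f'' n' = (f (p c)).shift x w c ∧
        (0 < n' → (f' (n' - 1)).bucket δ < ((f (p c)).shift x w c).bucket δ) ∨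
      n'' = n' ∧ 0 < n' ∧ ((f (p c)).shift x w c).bucket δ ≤ (f' (n' - 1)).bucket δ ∧
        (∀ i < n' - 1, f'' i = f' i) ∧
        (f'' (n' - 1) = (f (p c)).shift x w c ∧ (f' (n' - 1)).tot ≤ ((f (p c)).shift x w c).tot ∨
          f'' (n' - 1) = f' (n' - 1) ∧ ((f (p c)).shift x w c).tot ≤ (f' (n' - 1)).tot)) :
    Merging δ x w n f (Function.update p c (p c + 1)) n'' f'' := by
  set e := (f (p c)).shift x w c with he
  -- The consumed entry lies below every head that remains, including its own successor in the same
  -- shifted copy. This restores `last`.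
  have hnext : ∀ c', Function.update p c (p c + 1) c' < n → e.bucket δ ≤
      ((f (Function.update p c (p c + 1) c')).shift x w c').bucket δ := by
    intro c' hc'
    apply Entry.bucket_mono hδ
    by_cases hcc : c' = c
    · subst hcc
      simp only [Function.update_self] at hc' ⊢
      have := hf.diff_le hδ (Nat.le_succ (p c')) hc'
      rw [he, Entry.shift_diff, Entry.shift_diff]
      gcongr
    · simp only [ne_eq, hcc, not_false_eq_true, Function.update_of_ne] at hc' ⊢
      exact hmin c' hc'
  have hcard : ∑ c', Function.update p c (p c + 1) c' = (∑ c', p c') + 1 := by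
    rw [Finset.sum_update_of_mem (Finset.mem_univ c), Finset.sum_eq_add_sum_sdiff_singleton_of_mem (Finset.mem_univ c) p]
    ring
  simp only [Fin.sum_univ_three] at hcard
  have hle : ∀ c', Function.update p c (p c + 1) c' ≤ n := by
    intro c'
    by_cases hcc : c' = c
    · subst hcc; simpa using hc
    · simpa [hcc] using h.le c'
  have hdom : ∀ {n'' : ℕ} {f'' : ℕ → Entry},
      (∀ i < n', ∃ i' < n'', (f'' i').bucket δ = (f' i).bucket δ ∧ (f' i).tot ≤ (f'' i').tot) →
      (∃ i < n'', (f'' i).bucket δ = e.bucket δ ∧ e.tot ≤ (f'' i).tot) →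
      ∀ c', ∀ j < Function.update p c (p c + 1) c', ∃ i < n'', (f'' i).bucket δ =
        ((f j).shift x w c').bucket δ ∧ ((f j).shift x w c').tot ≤ (f'' i).tot := by
    intro n'' f'' hold hnew c' j hj
    by_cases hje : c' = c ∧ j = p c
    · obtain ⟨rfl, rfl⟩ := hje
      exact hnew
    · have hj' : j < p c' := by
        by_cases hcc : c' = c
        · subst hcc
          simp only [Function.update_self] at hj
          have : j ≠ p c' := fun h => hje ⟨rfl, h⟩
          omega
        · simpa [hcc] using hj
      obtain ⟨i, hi, hb, ht⟩ := h.dom c' j hj'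
      obtain ⟨i', hi', hb', ht'⟩ := hold i hi
      exact ⟨i', hi', hb'.trans hb, ht.trans ht'⟩
  rcases hnew with ⟨rfl, hold, hlast, hlt⟩ | ⟨rfl, hpos, hble, hold, hlast⟩
  · refine ⟨?_, ?_, hdom ?_ ?_, ?_, ?_, hle⟩
    · intro i j hij hj
      rcases (Nat.lt_succ_iff.1 hj).eq_or_lt with rfl | hj'
      · rw [hlast, hold i hij]
        refine lt_of_le_of_lt ?_ (hlt (by omega))
        rcases (show i ≤ j - 1 by omega).eq_or_lt with hi | hi
        · rw [hi]
        · exact (h.incr i (j - 1) hi (by omega)).le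
      · rw [hold i (by omega), hold j hj']
        exact h.incr i j hij hj'
    · intro i hi
      rcases (Nat.lt_succ_iff.1 hi).eq_or_lt with rfl | hi'
      · exact ⟨p c, hc, c, hlast⟩
      · rw [hold i hi']
        exact h.src i hi'
    · intro i hi
      exact ⟨i, by omega, by rw [hold i hi], by rw [hold i hi]⟩
    · exact ⟨n', by omega, by rw [hlast], by rw [hlast]⟩
    · have := h.card
      omega
    · intro _ c' hc'
      rw [Nat.add_sub_cancel, hlast]
      exact hnext c' hc'
  -- The bucket is already present. Its representative is replaced only by one of larger total, so
  -- earlier dominations survive.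
  · have hbe : (f' (n'' - 1)).bucket δ = e.bucket δ := le_antisymm (h.last hpos c hc) hble
    have hbl : (f'' (n'' - 1)).bucket δ = e.bucket δ := by
      rcases hlast with ⟨hl, -⟩ | ⟨hl, -⟩
      · rw [hl]
      · rw [hl, hbe]
    have hb : ∀ i < n'', (f'' i).bucket δ = (f' i).bucket δ := by
      intro i hi
      rcases (show i ≤ n'' - 1 by omega).eq_or_lt with rfl | hi'
      · rw [hbl, hbe]
      · rw [hold i hi']
    have ht : ∀ i < n'', (f' i).tot ≤ (f'' i).tot := by
      intro i hi
      rcases (show i ≤ n'' - 1 by omega).eq_or_lt with rfl | hi'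
      · rcases hlast with ⟨hl, hl'⟩ | ⟨hl, -⟩
        · rwa [hl]
        · rw [hl]
      · rw [hold i hi']
    refine ⟨?_, ?_, hdom ?_ ?_, ?_, ?_, hle⟩
    · intro i j hij hj
      rw [hb i (by omega), hb j hj]
      exact h.incr i j hij hj
    · intro i hi
      rcases (show i ≤ n'' - 1 by omega).eq_or_lt with rfl | hi'
      · rcases hlast with ⟨hl, -⟩ | ⟨hl, -⟩
        · exact ⟨p c, hc, c, hl⟩
        · rw [hl]
          exact h.src _ hi
      · rw [hold i hi']
        exact h.src i hi
    · exact fun i hi => ⟨i, hi, hb i hi, ht i hi⟩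
    · refine ⟨n'' - 1, by omega, hbl, ?_⟩
      rcases hlast with ⟨hl, -⟩ | ⟨hl, hl'⟩
      · rw [hl]
      · rwa [hl]
    · have := h.card
      omega
    · intro _ c' hc'
      rw [hbl]
      exact hnext c' hc'

/-! ### Sign patterns and rounded lists of them -/

/-- The entry of the sign pattern `d` on the positions `i₀ ≤ i < i₁`, where `d i = 1` puts the item
`x i` into the first set and `d i = 2` puts it into the second set. -/
noncomputable def patternEntry (x : ℕ → ℝ) (d : ℕ → Fin 3) (i₀ i₁ : ℕ) : Entry where
  sx := ∑ i ∈ Finset.Ico i₀ i₁, if d i = 1 then x i else 0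
  sy := ∑ i ∈ Finset.Ico i₀ i₁, if d i = 2 then x i else 0
  -- The weight is `3 ^ i` and not `3 ^ (i - i₀)`, so codes of consecutive ranges simply add up.
  co := ∑ i ∈ Finset.Ico i₀ i₁, (d i : ℕ) * 3 ^ i

theorem patternEntry_succ (x : ℕ → ℝ) (d : ℕ → Fin 3) {i₀ i₁ : ℕ} (h : i₀ ≤ i₁) :
    patternEntry x d i₀ (i₁ + 1) = (patternEntry x d i₀ i₁).shift (x i₁) (3 ^ i₁) (d i₁) := by
  generalize hc : d i₁ = c
  fin_cases c <;> simp [patternEntry, Entry.shift, Finset.sum_Ico_succ_top h, hc]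

theorem patternEntry_congr (x : ℕ → ℝ) {d d' : ℕ → Fin 3} {i₀ i₁ : ℕ}
    (h : ∀ i, i₀ ≤ i → i < i₁ → d i = d' i) : patternEntry x d i₀ i₁ = patternEntry x d' i₀ i₁ := by
  have : ∀ i ∈ Finset.Ico i₀ i₁, d i = d' i := fun i hi => h i (Finset.mem_Ico.1 hi).1 (Finset.mem_Ico.1 hi).2
  simp only [patternEntry, Entry.mk.injEq]
  exact ⟨Finset.sum_congr rfl fun i hi => by rw [this i hi],
    Finset.sum_congr rfl fun i hi => by rw [this i hi],
    Finset.sum_congr rfl fun i hi => by rw [this i hi]⟩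

/-- The list `f` represents the sign patterns on the positions `i₀ ≤ i < i₁`. -/
structure Represents (δ : ℝ) (x : ℕ → ℝ) (i₀ i₁ : ℕ) (n : ℕ) (f : ℕ → Entry) : Prop where
  incr : Increasing δ n f
  sound : ∀ i < n, ∃ d, f i = patternEntry x d i₀ i₁
  -- The error in the total is one-sided, and on the useful side: the quantity `sx - (1 + lam) * sy`
  -- tested later equals `((2 + lam) * diff - lam * tot) / 2`, so for `lam ≥ 0` a larger total only
  -- helps.
  complete : ∀ d, ∃ i < n, |(f i).diff - (patternEntry x d i₀ i₁).diff| ≤ (i₁ - i₀ : ℕ) * δ ∧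
    (patternEntry x d i₀ i₁).tot ≤ (f i).tot
  card : n ≤ 3 ^ (i₁ - i₀)

theorem Represents.congr {δ : ℝ} {x : ℕ → ℝ} {i₀ i₁ n : ℕ} {f f' : ℕ → Entry}
    (h : Represents δ x i₀ i₁ n f) (hf : ∀ i < n, f' i = f i) : Represents δ x i₀ i₁ n f' where
  incr i j hij hj := by rw [hf i (by omega), hf j hj]; exact h.incr i j hij hj
  sound i hi := by rw [hf i hi]; exact h.sound i hi
  complete d := by
    obtain ⟨i, hi, h'⟩ := h.complete d
    exact ⟨i, hi, by rw [hf i hi]; exact h'⟩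
  card := h.card

theorem Represents.init (δ : ℝ) (x : ℕ → ℝ) (i₀ : ℕ) {f : ℕ → Entry} (hf : f 0 = ⟨0, 0, 0⟩) :
    Represents δ x i₀ i₀ 1 f := by
  refine ⟨fun i j hij hj => by omega, fun i hi => ⟨0, ?_⟩, fun d => ⟨0, one_pos, ?_, ?_⟩, by simp⟩
  · obtain rfl : i = 0 := by omega
    simp [patternEntry, hf]
  · simp [patternEntry, hf]
  · simp [patternEntry, hf]

/-- Adding the same signed item to a pattern and to its representative leaves the error unchanged.
Passing to the representative of the new bucket then adds less than `δ`. -/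
theorem Represents.extends {δ : ℝ} (hδ : 0 < δ) {x : ℕ → ℝ} {i₀ i₁ n n' : ℕ} {f f' : ℕ → Entry}
    (h : Represents δ x i₀ i₁ n f) (hi : i₀ ≤ i₁)
    (h' : Extends δ (x i₁) (3 ^ i₁) n f n' f') : Represents δ x i₀ (i₁ + 1) n' f' := by
  refine ⟨h'.incr, fun i hi' => ?_, fun d => ?_, ?_⟩
  · obtain ⟨j, hj, c, hc⟩ := h'.src i hi'
    obtain ⟨d, hd⟩ := h.sound j hj
    refine ⟨Function.update d i₁ c, ?_⟩
    rw [patternEntry_succ x _ hi, hc, hd, Function.update_self]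
    congr 1
    exact patternEntry_congr x fun i _ hi => by simp [hi.ne]
  · obtain ⟨j, hj, hd, ht⟩ := h.complete d
    obtain ⟨i, hi', hb, ht'⟩ := h'.dom j hj (d i₁)
    refine ⟨i, hi', ?_, ?_⟩
    · have h1 := Entry.abs_diff_sub_lt hδ hb
      rw [patternEntry_succ x _ hi, Entry.shift_diff]
      rw [Entry.shift_diff] at h1
      rw [Nat.succ_sub hi, Nat.succ_eq_add_one]
      push_cast
      rw [abs_le] at hd ⊢
      rw [abs_lt] at h1
      constructor <;> linarith
    · rw [patternEntry_succ x _ hi, Entry.shift_tot]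
      rw [Entry.shift_tot] at ht'
      linarith
  · have := h'.card
    have := h.card
    rw [Nat.succ_sub hi, pow_succ]
    omega

end SubsetSumRatio

/-! ### Programs for lists of signed sums

Array `0` holds the items and array `1` the output. A list of entries occupies three consecutive
arrays: `2, 3, 4` for the current list, `5, 6, 7` for the list under construction, and `8, 9, 10`
for the saved list. -/

namespace SubsetSumRatio

open RealRAM

infixr:20 ";;" => Program.seq
infix:30 "::=" => Program.assign
notation "reg" => Expr.var
notation "lit" => Expr.const
notation "cell" => Expr.read

notation "rCount" => (0 : ℕ)
notation "rK" => (17 : ℕ)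
notation "rDelta" => (23 : ℕ)
notation "rI" => (24 : ℕ)
notation "rEnd" => (25 : ℕ)
notation "rCap" => (26 : ℕ)
notation "rWeight" => (27 : ℕ)
notation "rLen" => (28 : ℕ)
notation "rItem" => (29 : ℕ)
notation "rMinus" => (30 : ℕ)
notation "rZero" => (31 : ℕ)
notation "rPlus" => (32 : ℕ)
notation "rNew" => (33 : ℕ)
notation "rSx" => (34 : ℕ)
notation "rSy" => (35 : ℕ)
notation "rCo" => (36 : ℕ)
notation "rCopy" => (38 : ℕ)

/-- The list of entries stored in the arrays `a, a + 1, a + 2`. -/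
def entries (s : State) (a i : ℕ) : Entry := ⟨s.arr a i, s.arr (a + 1) i, s.arr (a + 2) i⟩

/-- The difference of an entry of the current list. -/
def diffAt (e : Expr) : Expr := cell 2 e - cell 3 e

/-- Fetch the smallest remaining shifted entry. -/
def fetch : Program :=
  -- Ties go to the downward shift first and to the upward shift last. For a positive item this
  -- keeps `rPlus ≤ rZero ≤ rMinus`, so the missing range checks are implied by those that are
  -- present and by the loop test.
  .ite (.and (.lt (reg rMinus) (reg rLen))
      (.and (.le (diffAt (reg rMinus) - reg rItem) (diffAt (reg rZero)))
        (.le (diffAt (reg rMinus) - reg rItem) (diffAt (reg rPlus) + reg rItem))))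
    (rSx ::= cell 2 (reg rMinus);; rSy ::= cell 3 (reg rMinus) + reg rItem;;
      rCo ::= cell 4 (reg rMinus) + lit 2 * reg rWeight;; rMinus ::= reg rMinus + lit 1)
    (.ite (.and (.lt (reg rZero) (reg rLen))
        (.le (diffAt (reg rZero)) (diffAt (reg rPlus) + reg rItem)))
      (rSx ::= cell 2 (reg rZero);; rSy ::= cell 3 (reg rZero);;
        rCo ::= cell 4 (reg rZero);; rZero ::= reg rZero + lit 1)
      (rSx ::= cell 2 (reg rPlus) + reg rItem;; rSy ::= cell 3 (reg rPlus);;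
        rCo ::= cell 4 (reg rPlus) + reg rWeight;; rPlus ::= reg rPlus + lit 1))

/-- Store the fetched entry at position `e` of the new list. -/
def store (e : Expr) : Program :=
  .write 5 e (reg rSx);; .write 6 e (reg rSy);; .write 7 e (reg rCo)

/-- Insert the fetched entry into the new list. -/
def insertNew : Program :=
  .ite (.and (.lt (lit 0) (reg rNew))
      (.le (.floor ((reg rSx - reg rSy) / reg rDelta))
        (.floor ((cell 5 (reg rNew - lit 1) - cell 6 (reg rNew - lit 1)) / reg rDelta))))
    (.ite (.lt (cell 5 (reg rNew - lit 1) + cell 6 (reg rNew - lit 1)) (reg rSx + reg rSy))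
      (store (reg rNew - lit 1)) .skip)
    (store (reg rNew);; rNew ::= reg rNew + lit 1)

/-- Merge the three shifted copies of the current list into the new list. -/
def merge : Program :=
  (rMinus ::= lit 0;; rZero ::= lit 0;; rPlus ::= lit 0;; rNew ::= lit 0);;
  .loop (.lt (reg rPlus) (reg rLen)) (fetch;; insertNew)

/-- Make the new list the current list. -/
def copyBack : Program :=
  rCopy ::= lit 0;;
  .loop (.lt (reg rCopy) (reg rNew))
    (.write 2 (reg rCopy) (cell 5 (reg rCopy));; .write 3 (reg rCopy) (cell 6 (reg rCopy));;
      .write 4 (reg rCopy) (cell 7 (reg rCopy));; rCopy ::= reg rCopy + lit 1);;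
  rLen ::= reg rNew

/-- Add the item at position `rK - rI` to the current list. -/
def addItem : Program :=
  rItem ::= cell 0 (reg rK - reg rI);; merge;; copyBack;;
  (rI ::= reg rI + lit 1;; rWeight ::= reg rWeight * lit 3)

/-- Build the list of the items from `rI` up to `rEnd`, stopping when it has more than `rCap`
entries. -/
def build : Program :=
  (.write 2 (lit 0) (lit 0);; .write 3 (lit 0) (lit 0);; .write 4 (lit 0) (lit 0);; rLen ::= lit 1);;
  .loop (.and (.lt (reg rI) (reg rEnd)) (.le (reg rLen) (reg rCap))) addItem

/-- Pointers of the merge: shift `0` is unshifted, `1` is upwards, `2` is downwards. -/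
def pointers (i₀ i₁ i₂ : ℕ) : Fin 3 → ℕ := ![i₀, i₁, i₂]

theorem fetch_spec {s : State} {δ x w : ℝ} {n i₀ i₁ i₂ : ℕ} {f : ℕ → Entry}
    (hδ : 0 < δ) (hx : 0 < x) (hf : Increasing δ n f)
    (h01 : i₁ ≤ i₀) (h02 : i₀ ≤ i₂) (h1 : i₁ < n) (h2 : i₂ ≤ n)
    (hs : ∀ i < n, entries s 2 i = f i) (hlen : s.var rLen = n) (hitem : s.var rItem = x)
    (hw : s.var rWeight = w) (hi₀ : s.var rZero = i₀) (hi₁ : s.var rPlus = i₁)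
    (hi₂ : s.var rMinus = i₂) :
    Runs fetch s 200 fun s' => ∃ c, ∃ e : Entry, pointers i₀ i₁ i₂ c < n ∧
      e = (f (pointers i₀ i₁ i₂ c)).shift x w c ∧
      (∀ c', pointers i₀ i₁ i₂ c' < n →
        e.diff ≤ ((f (pointers i₀ i₁ i₂ c')).shift x w c').diff) ∧
      s'.var rSx = e.sx ∧ s'.var rSy = e.sy ∧ s'.var rCo = e.co ∧
      ∃ j₀ j₁ j₂ : ℕ, pointers j₀ j₁ j₂ = Function.update (pointers i₀ i₁ i₂) c
          (pointers i₀ i₁ i₂ c + 1) ∧ j₀ + j₁ + j₂ = i₀ + i₁ + i₂ + 1 ∧ j₁ ≤ j₀ ∧ j₀ ≤ j₂ ∧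
        s'.var rZero = j₀ ∧ s'.var rPlus = j₁ ∧ s'.var rMinus = j₂ := by
  have hdiff : ∀ i < n, s.arr 2 i - s.arr 3 i = (f i).diff := fun i hi => by
    rw [← hs i hi]; rfl
  have hsx : ∀ i < n, s.arr 2 i = (f i).sx := fun i hi => by rw [← hs i hi]; rfl
  have hsy : ∀ i < n, s.arr 3 i = (f i).sy := fun i hi => by rw [← hs i hi]; rfl
  have hco : ∀ i < n, s.arr 4 i = (f i).co := fun i hi => by rw [← hs i hi]; rfl
  have m01 := hf.diff_le hδ h01
  have m02 := hf.diff_le hδ h02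
  have d1 := hdiff i₁ h1
  apply Runs.of_loopFree rfl
  · have : fetch.bound ≤ 200 := Nat.le_of_ble_eq_true rfl
    exact_mod_cast this
  simp only [fetch, Program.run, Test.holds_and, Test.holds_lt, Test.holds_le, diffAt,
    Expr.eval_var, Expr.eval_sub, Expr.eval_add, Expr.eval_read, hlen, hi₀, hi₁, hi₂, hitem,
    address_natCast, Nat.cast_lt, d1]
  split_ifs with hA hB
  · have d2 := hdiff i₂ hA.1
    have d0 := hdiff i₀ (by omega)
    rw [d2, d0] at hA
    have hne : i₀ < i₂ ∨ i₀ = i₂ := h02.lt_or_eq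
    refine ⟨2, _, hA.1, rfl, ?_, ?_, ?_, ?_, i₀, i₁, i₂ + 1, ?_, by omega, h01, by omega, ?_, ?_, ?_⟩
    · intro c' hc'
      rw [Entry.shift_diff, Entry.shift_diff]
      fin_cases c' <;> simp [pointers] at hc' ⊢ <;> linarith [hA.2.1, hA.2.2]
    · simp [hi₂, pointers, Entry.shift, hsx _ hA.1]
    · simp [hi₂, pointers, Entry.shift, hsy _ hA.1, hitem]
    · simp [hi₂, pointers, Entry.shift, hco _ hA.1, hw]
    · funext c; fin_cases c <;> simp [pointers]
    · simp [hi₀]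
    · simp [hi₁]
    · simp [hi₂]
  · have d0 := hdiff i₀ hB.1
    rw [d0] at hB hA
    -- With equal pointers the downward copy is the smaller one, and the first branch would have
    -- been taken.
    have hlt : i₀ < i₂ := by
      rcases h02.lt_or_eq with h | h
      · exact h
      · subst h
        rw [d0] at hA
        exact absurd ⟨hB.1, by linarith, by linarith [hB.2]⟩ hA
    refine ⟨0, _, hB.1, rfl, ?_, ?_, ?_, ?_, i₀ + 1, i₁, i₂, ?_, by omega, by omega, by omega,
      ?_, ?_, ?_⟩
    · intro c' hc'
      rw [Entry.shift_diff, Entry.shift_diff]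
      fin_cases c' <;> simp [pointers] at hc' ⊢
      · linarith [hB.2]
      · rw [hdiff i₂ hc'] at hA
        by_contra! hcon
        exact hA ⟨hc', by linarith, by linarith [hB.2]⟩
    · simp [hi₀, pointers, Entry.shift, hsx _ hB.1]
    · simp [hi₀, pointers, Entry.shift, hsy _ hB.1]
    · simp [hi₀, pointers, Entry.shift, hco _ hB.1]
    · funext c; fin_cases c <;> simp [pointers]
    · simp [hi₀]
    · simp [hi₁]
    · simp [hi₂]
  -- With equal pointers the unshifted copy lies below the upward one because `x > 0`, so the second
  -- branch would have been taken.
  · have hlt : i₁ < i₀ := by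
      rcases h01.lt_or_eq with h | h
      · exact h
      · subst h
        rw [d1] at hB
        exact absurd ⟨h1, by linarith⟩ hB
    have h0 : i₀ < n → (f i₁).diff + x ≤ (f i₀).diff := by
      intro h0
      rw [hdiff _ h0] at hB
      by_contra! hcon
      exact hB ⟨h0, hcon.le⟩
    refine ⟨1, _, h1, rfl, ?_, ?_, ?_, ?_, i₀, i₁ + 1, i₂, ?_, by omega, by omega, by omega,
      ?_, ?_, ?_⟩
    · intro c' hc'
      rw [Entry.shift_diff, Entry.shift_diff]
      fin_cases c' <;> simp [pointers] at hc' ⊢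
      · exact h0 hc'
      · have h0' := h0 (by omega)
        rw [hdiff i₂ hc', hdiff i₀ (by omega)] at hA
        by_contra! hcon
        exact hA ⟨hc', by linarith, by linarith⟩
    · simp [hi₁, pointers, Entry.shift, hsx _ h1]
    · simp [hi₁, pointers, Entry.shift, hsy _ h1]
    · simp [hi₁, pointers, Entry.shift, hco _ h1, hw]
    · funext c; fin_cases c <;> simp [pointers]
    · simp [hi₀]
    · simp [hi₁]
    · simp [hi₂]

theorem insertNew_spec {s : State} {δ : ℝ} {n' : ℕ} {e : Entry}
    (hδ : s.var rDelta = δ) (hn : s.var rNew = n') (hsx : s.var rSx = e.sx)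
    (hsy : s.var rSy = e.sy) (hco : s.var rCo = e.co) :
    Runs insertNew s 200 fun s' => ∃ n'' : ℕ, s'.var rNew = n'' ∧
      (n'' = n' + 1 ∧ (∀ i < n', entries s' 5 i = entries s 5 i) ∧ entries s' 5 n' = e ∧
        (0 < n' → (entries s 5 (n' - 1)).bucket δ < e.bucket δ) ∨
      n'' = n' ∧ 0 < n' ∧ e.bucket δ ≤ (entries s 5 (n' - 1)).bucket δ ∧
        (∀ i < n' - 1, entries s' 5 i = entries s 5 i) ∧
        (entries s' 5 (n' - 1) = e ∧ (entries s 5 (n' - 1)).tot ≤ e.tot ∨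
          entries s' 5 (n' - 1) = entries s 5 (n' - 1) ∧ e.tot ≤ (entries s 5 (n' - 1)).tot)) := by
  apply Runs.of_loopFree rfl
  · have : insertNew.bound ≤ 200 := Nat.le_of_ble_eq_true rfl
    exact_mod_cast this
  simp only [insertNew, store, Program.run, Test.holds_and, Test.holds_lt, Test.holds_le,
    Expr.eval_floor, Expr.eval_div, Expr.eval_const, Rat.cast_zero, Rat.cast_one,
    Expr.eval_var, Expr.eval_sub, Expr.eval_add, Expr.eval_read, hn, hsx, hsy, hδ,
    address_natCast, Nat.cast_pos, address_sub_one, Int.cast_le]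
  split_ifs with hA hB
  · refine ⟨n', by simp [hn], .inr ⟨rfl, hA.1, hA.2, ?_, .inl ⟨?_, hB.le⟩⟩⟩
    · intro i hi
      simp [entries, hn, hi.ne]
    · simp [entries, hn, hsy, hco]
  · exact ⟨n', hn, .inr ⟨rfl, hA.1, hA.2, fun _ _ => rfl, .inr ⟨rfl, not_lt.1 hB⟩⟩⟩
  · refine ⟨n' + 1, by simp [hn], .inl ⟨rfl, ?_, ?_, ?_⟩⟩
    · intro i hi
      simp [entries, hn, hi.ne]
    · simp [entries, hn, hsy, hco]
    · intro h
      by_contra! hcon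
      exact hA ⟨h, hcon⟩

/-- Each iteration consumes one of the `3 * n` shifted entries, so the loop measure is `3 * n` minus
the sum of the pointers. The upward pointer trails the other two; when it reaches `n`, all three
have. -/
theorem merge_spec {s : State} {δ x w : ℝ} {n : ℕ} {f : ℕ → Entry}
    (hδ : 0 < δ) (hx : 0 < x) (hf : Increasing δ n f)
    (hs : ∀ i < n, entries s 2 i = f i) (hlen : s.var rLen = n) (hitem : s.var rItem = x)
    (hw : s.var rWeight = w) (hsδ : s.var rDelta = δ) :
    Runs merge s (1500 * n + 100) fun s' => ∃ n' : ℕ, s'.var rNew = n' ∧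
      Extends δ x w n f n' (entries s' 5) := by
  refine Runs.seq (T := 20) (T' := 1500 * n + 80)
    (Q := fun s' => s'.var rMinus = 0 ∧ s'.var rZero = 0 ∧ s'.var rPlus = 0 ∧ s'.var rNew = 0) ?_ ?_
    (by linarith)
  · apply Runs.of_loopFree rfl
    · norm_num [Program.bound, Expr.cost]
    · simp [Program.run]
  intro s₀ ⟨hm, hz, hp, hn⟩ hfr
  have hv : ∀ {s' : State}, Frame (fetch;; insertNew) s₀ s' →
      (∀ i < n, entries s' 2 i = f i) ∧ s'.var rLen = n ∧ s'.var rItem = x ∧ s'.var rWeight = w ∧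
        s'.var rDelta = δ := by
    intro s' h
    refine ⟨fun i hi => ?_, ?_, ?_, ?_, ?_⟩
    · rw [← hs i hi]
      simp only [entries, Entry.mk.injEq]
      rw [h.2 2 (by decide), h.2 3 (by decide), h.2 4 (by decide), hfr.2 2 (by decide),
        hfr.2 3 (by decide), hfr.2 4 (by decide)]
      exact ⟨rfl, rfl, rfl⟩
    all_goals rw [h.1 _ (by decide), hfr.1 _ (by decide)]; assumption
  refine Runs.mono (Runs.loop (c := 400) (T := 1500 * n + 80)
    (fun v s' => ∃ i₀ i₁ i₂ n' : ℕ, v + (i₀ + i₁ + i₂) = 3 * n ∧ i₁ ≤ i₀ ∧ i₀ ≤ i₂ ∧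
      s'.var rZero = i₀ ∧ s'.var rPlus = i₁ ∧ s'.var rMinus = i₂ ∧ s'.var rNew = n' ∧
      Merging δ x w n f (pointers i₀ i₁ i₂) n' (entries s' 5))
    (3 * n) (by norm_num) ?_ ?_ ?_) le_rfl ?_
  · refine ⟨0, 0, 0, 0, rfl, le_rfl, le_rfl, by simpa using hz, by simpa using hp,
      by simpa using hm, by simpa using hn, ?_⟩
    convert Merging.init δ x w n f (entries s₀ 5) using 1
    funext c; fin_cases c <;> rfl
  · rintro v s₁ ⟨i₀, i₁, i₂, n', hv', h01, h02, hz, hp, hm, hn, hM⟩ hfr₁ hb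
    obtain ⟨he, hl, hit, hwt, hd⟩ := hv hfr₁
    have h1 : i₁ < n := by
      simpa [hp, hl] using hb
    refine Runs.seq (fetch_spec hδ hx hf h01 h02 h1 (hM.le 2) he hl hit hwt hz hp hm) ?_
      (T' := 200) (by norm_num)
    rintro s₂ ⟨c, e, hc, rfl, hmin, hsx, hsy, hco, j₀, j₁, j₂, hj, hjs, hj01, hj02, hz', hp', hm'⟩
      hfr₂
    have hn₂ : s₂.var rNew = n' := by rw [hfr₂.1 _ (by decide), hn]
    have hd₂ : s₂.var rDelta = δ := by rw [hfr₂.1 _ (by decide), hd]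
    have he₂ : entries s₂ 5 = entries s₁ 5 := by
      funext i
      simp only [entries]
      rw [hfr₂.2 5 (by decide), hfr₂.2 6 (by decide), hfr₂.2 7 (by decide)]
    refine (insertNew_spec hd₂ hn₂ hsx hsy hco).frame.mono le_rfl ?_
    rintro s₃ ⟨⟨n'', hn'', hcases⟩, hfr₃⟩
    rw [he₂] at hcases
    have hM' := hM.step hδ hf c hc hmin hcases
    rw [← hj] at hM'
    have hle0 : j₀ ≤ n := hM'.le 0
    have hle1 : j₁ ≤ n := hM'.le 1
    have hle2 : j₂ ≤ n := hM'.le 2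
    refine ⟨3 * n - (j₀ + j₁ + j₂), by omega, j₀, j₁, j₂, n'', by omega, hj01, hj02, ?_, ?_, ?_,
      hn'', hM'⟩
    · rw [hfr₃.1 _ (by decide), hz']
    · rw [hfr₃.1 _ (by decide), hp']
    · rw [hfr₃.1 _ (by decide), hm']
  · norm_num [Test.cost, Expr.cost]
    have : (0 : ℝ) ≤ n := Nat.cast_nonneg n
    linarith
  · rintro s₁ ⟨⟨v, i₀, i₁, i₂, n', hv', h01, h02, hz, hp, hm, hn, hM⟩, hb, hfr₁⟩
    have hl := (hv hfr₁).2.1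
    have h1 : n ≤ i₁ := by
      simpa [hp, hl] using hb
    have hle0 : i₀ ≤ n := hM.le 0
    have hle1 : i₁ ≤ n := hM.le 1
    have hle2 : i₂ ≤ n := hM.le 2
    refine ⟨n', hn, hM.extends fun c => ?_⟩
    fin_cases c
    · show i₀ = n; omega
    · show i₁ = n; omega
    · show i₂ = n; omega

end SubsetSumRatio

/-! ### Building a list item by item -/

namespace SubsetSumRatio

open RealRAM

theorem entries_congr {s s' : State} {a : ℕ} (h : s'.arr a = s.arr a)
    (h' : s'.arr (a + 1) = s.arr (a + 1)) (h'' : s'.arr (a + 2) = s.arr (a + 2)) :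
    entries s' a = entries s a := by
  funext i
  simp only [entries, h, h', h'']

theorem copyBack_spec {s : State} {n : ℕ} (hn : s.var rNew = n) :
    Runs copyBack s (100 * n + 100) fun s' => s'.var rLen = n ∧
      ∀ i < n, entries s' 2 i = entries s 5 i := by
  refine Runs.seq (T := 10) (T' := 100 * n + 90) (Q := fun s' => s'.var rCopy = 0) ?_ ?_
    (by linarith)
  · apply Runs.of_loopFree rfl
    · norm_num [Program.bound, Expr.cost]
    · simp [Program.run]
  intro s₀ hc hfr
  refine Runs.seq (T := 100 * n + 80) (T' := 10) (Q := fun s' =>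
    (∃ v q : ℕ, v + q = n ∧ s'.var rCopy = q ∧ ∀ i < q, entries s' 2 i = entries s 5 i) ∧
    ¬ (Test.lt (reg rCopy) (reg rNew)).Holds s' ∧ _) (Runs.loop (c := 50) (fun v s' =>
      ∃ q : ℕ, v + q = n ∧ s'.var rCopy = q ∧ ∀ i < q, entries s' 2 i = entries s 5 i)
      n (by norm_num) ⟨0, by omega, by simpa using hc, by simp⟩ ?_ ?_) ?_ (by linarith)
  · rintro v s₁ ⟨q, hq, hr, hi⟩ hfr₁ hb
    have hn₁ : s₁.var rNew = n := by rw [hfr₁.1 _ (by decide), hfr.1 _ (by decide), hn]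
    have hqn : q < n := by simpa [hr, hn₁] using hb
    have he : entries s₁ 5 = entries s 5 := by
      rw [entries_congr (hfr₁.2 5 (by decide)) (hfr₁.2 6 (by decide)) (hfr₁.2 7 (by decide)),
        entries_congr (hfr.2 5 (by decide)) (hfr.2 6 (by decide)) (hfr.2 7 (by decide))]
    apply Runs.of_loopFree rfl
    · norm_num [Program.bound, Expr.cost]
    refine ⟨v - 1, by omega, q + 1, by omega, ?_, ?_⟩
    · simp [Program.run, hr]
    · intro i hi'
      rcases (Nat.lt_succ_iff.1 hi').eq_or_lt with rfl | hi'
      · rw [← he]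
        simp [Program.run, hr, entries]
      · rw [← hi i hi']
        simp [Program.run, hr, entries, hi'.ne]
  · norm_num [Test.cost, Expr.cost]
    have : (0 : ℝ) ≤ n := Nat.cast_nonneg n
    linarith
  · rintro s₁ ⟨⟨v, q, hq, hr, hi⟩, hb, hfr₁⟩ -
    have hn₁ : s₁.var rNew = n := by rw [hfr₁.1 _ (by decide), hfr.1 _ (by decide), hn]
    have hqn : n ≤ q := by simpa [hr, hn₁] using hb
    apply Runs.of_loopFree rfl
    · norm_num [Program.bound, Expr.cost]
    · refine ⟨by simp [Program.run, hn₁], fun i hi' => ?_⟩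
      rw [← hi i (by omega)]
      rfl

theorem addItem_spec {s : State} {I : ℕ → ℝ} {δ : ℝ} {k n i₀ i : ℕ} (hδ : 0 < δ)
    (hx : 0 < I (k - i)) (hi : i₀ ≤ i)
    (hf : Represents δ (fun i => I (k - i)) i₀ i n (entries s 2)) (hI : s.arr 0 = I)
    (hk : s.var rK = k) (hri : s.var rI = i) (hlen : s.var rLen = n)
    (hw : s.var rWeight = 3 ^ i) (hsδ : s.var rDelta = δ) :
    Runs addItem s (2000 * n + 300) fun s' => ∃ n' : ℕ, s'.var rLen = n' ∧ n' ≤ 3 * n ∧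
      s'.var rI = (i + 1 : ℕ) ∧ s'.var rWeight = 3 ^ (i + 1) ∧
      Represents δ (fun i => I (k - i)) i₀ (i + 1) n' (entries s' 2) := by
  have hn0 : (0 : ℝ) ≤ n := Nat.cast_nonneg n
  refine Runs.seq (T := 10) (T' := 2000 * n + 290) (Q := fun s' => s'.var rItem = I (k - i)) ?_ ?_
    (by linarith)
  · apply Runs.of_loopFree rfl
    · norm_num [Program.bound, Expr.cost, show ∀ e f : Expr, e - f = .sub e f from fun _ _ => rfl]
    · simp [Program.run, hk, hri, address_sub, hI]
  intro s₁ hit hfr₁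
  have he₁ : entries s₁ 2 = entries s 2 :=
    entries_congr (hfr₁.2 2 (by decide)) (hfr₁.2 3 (by decide)) (hfr₁.2 4 (by decide))
  refine Runs.seq (T := 1500 * n + 100) (T' := 500 * n + 190)
    (merge_spec hδ hx hf.incr (fun i _ => by rw [he₁]) (by rw [hfr₁.1 _ (by decide), hlen]) hit
      (by rw [hfr₁.1 _ (by decide), hw]) (by rw [hfr₁.1 _ (by decide), hsδ])) ?_ (by linarith)
  rintro s₂ ⟨n', hn', hE⟩ hfr₂
  have hR := hf.extends hδ hi hE
  have hcard : (n' : ℝ) ≤ 3 * n := by exact_mod_cast hE.card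
  refine Runs.seq (T := 300 * n + 100) (T' := 60)
    ((copyBack_spec hn').mono (by linarith) fun _ h => h) ?_ (by linarith)
  rintro s₃ ⟨hl, he⟩ hfr₃
  have hri' : s₃.var rI = i := by
    rw [hfr₃.1 _ (by decide), hfr₂.1 _ (by decide), hfr₁.1 _ (by decide), hri]
  have hw' : s₃.var rWeight = 3 ^ i := by
    rw [hfr₃.1 _ (by decide), hfr₂.1 _ (by decide), hfr₁.1 _ (by decide), hw]
  apply Runs.of_loopFree rfl
  · norm_num [Program.bound, Expr.cost, show ∀ e f : Expr, e + f = .add e f from fun _ _ => rfl,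
      show ∀ e f : Expr, e * f = .mul e f from fun _ _ => rfl]
  refine ⟨n', by simp [Program.run, hl], hE.card, by simp [Program.run, hri'],
    by simp [Program.run, hw', pow_succ], ?_⟩
  refine hR.congr fun i hi => ?_
  rw [← he i hi]
  rfl

/-- An item is added only while the length is at most `cap`, and it at most triples the list. Hence
the length never exceeds `3 * cap` and every item costs `O(cap)`. -/
theorem build_spec {s : State} {I : ℕ → ℝ} {δ cap : ℝ} {k i₀ i₁ : ℕ} (hδ : 0 < δ)
    (hcap : 1 ≤ cap) (hi : i₀ ≤ i₁) (hx : ∀ i < i₁, 0 < I (k - i)) (hI : s.arr 0 = I)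
    (hk : s.var rK = k) (hri : s.var rI = i₀) (hend : s.var rEnd = i₁)
    (hw : s.var rWeight = 3 ^ i₀) (hsδ : s.var rDelta = δ) (hsc : s.var rCap = cap) :
    Runs build s ((i₁ - i₀ : ℕ) * (2500 * cap) + 100) fun s' => ∃ i n : ℕ, i₀ ≤ i ∧ i ≤ i₁ ∧
      (n : ℝ) ≤ 3 * cap ∧ s'.var rLen = n ∧ s'.var rI = i ∧ s'.var rWeight = 3 ^ i ∧
      Represents δ (fun i => I (k - i)) i₀ i n (entries s' 2) ∧ (i < i₁ → cap < n) := by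
  refine Runs.seq (T := 20) (T' := (i₁ - i₀ : ℕ) * (2500 * cap) + 80)
    (Q := fun s' => s'.var rLen = 1 ∧ entries s' 2 0 = ⟨0, 0, 0⟩) ?_ ?_ (by linarith)
  · apply Runs.of_loopFree rfl
    · norm_num [Program.bound, Expr.cost]
    · simp [Program.run, entries]
  intro s₀ ⟨hl, he⟩ hfr
  refine (Runs.loop (c := 2300 * cap) (fun v s' => ∃ i n : ℕ, v + i = i₁ ∧ i₀ ≤ i ∧
      (n : ℝ) ≤ 3 * cap ∧ s'.var rLen = n ∧ s'.var rI = i ∧ s'.var rWeight = 3 ^ i ∧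
      Represents δ (fun i => I (k - i)) i₀ i n (entries s' 2)) (i₁ - i₀) (by positivity)
      ⟨i₀, 1, by omega, le_rfl, by norm_num; linarith, by simpa using hl,
        by rw [hfr.1 _ (by decide), hri], by rw [hfr.1 _ (by decide), hw], .init _ _ _ he⟩
      ?_ ?_).mono le_rfl ?_
  · rintro v s₁ ⟨i, n, hv, hi', hn, hl, hri, hw, hR⟩ hfr₁ hb
    have hend : s₁.var rEnd = i₁ := by rw [hfr₁.1 _ (by decide), hfr.1 _ (by decide), hend]
    have hsc : s₁.var rCap = cap := by rw [hfr₁.1 _ (by decide), hfr.1 _ (by decide), hsc]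
    simp only [Test.holds_and, Test.holds_lt, Test.holds_le, Expr.eval_var, hri, hend, hl, hsc,
      Nat.cast_lt] at hb
    refine (addItem_spec hδ (hx i hb.1) hi' hR
      (by rw [hfr₁.2 _ (by decide), hfr.2 _ (by decide), hI])
      (by rw [hfr₁.1 _ (by decide), hfr.1 _ (by decide), hk]) hri hl hw
      (by rw [hfr₁.1 _ (by decide), hfr.1 _ (by decide), hsδ])).mono (by linarith [hb.2]) ?_
    rintro s₂ ⟨n', hl', hn', hri', hw', hR'⟩
    refine ⟨v - 1, by omega, i + 1, n', by omega, by omega, ?_, hl', hri', hw', hR'⟩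
    have : (n' : ℝ) ≤ 3 * n := by exact_mod_cast hn'
    linarith [hb.2]
  · norm_num [Test.cost, Expr.cost]
    have : (0 : ℝ) ≤ (i₁ - i₀ : ℕ) := Nat.cast_nonneg _
    nlinarith
  · rintro s₁ ⟨⟨v, i, n, hv, hi', hn, hl, hri, hw, hR⟩, hb, hfr₁⟩
    have hend : s₁.var rEnd = i₁ := by rw [hfr₁.1 _ (by decide), hfr.1 _ (by decide), hend]
    have hsc : s₁.var rCap = cap := by rw [hfr₁.1 _ (by decide), hfr.1 _ (by decide), hsc]
    refine ⟨i, n, hi', by omega, hn, hl, hri, hw, hR, fun h => ?_⟩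
    by_contra! hcon
    apply hb
    simpa only [Test.holds_and, Test.holds_lt, Test.holds_le, Expr.eval_var, hri, hend, hl, hsc,
      Nat.cast_lt] using ⟨h, hcon⟩

end SubsetSumRatio

/-! ### Searching for a good pair of entries -/

namespace SubsetSumRatio

open RealRAM

notation "rLam" => (13 : ℕ)
notation "rFound" => (18 : ℕ)
notation "rFoundK" => (19 : ℕ)
notation "rFoundCo" => (20 : ℕ)
notation "rTau" => (22 : ℕ)
notation "rSaved" => (37 : ℕ)
notation "rLeft" => (39 : ℕ)
notation "rRight" => (40 : ℕ)
notation "rBest" => (41 : ℕ)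
notation "rBestCo" => (42 : ℕ)

/-- Negative if the ratio of the two sums is less than `1 + lam`. -/
def Entry.slack (lam : ℝ) (e : Entry) : ℝ := e.sx - (1 + lam) * e.sy

/-- The acceptance criterion of the search. -/
def Accepts (tau lam : ℝ) (e f : Entry) : Prop :=
  -- For the combined sums `sx` and `sy`, the two conditions give `lam * sy > 3 * tau` and `sy ≤ sx
  -- + tau`. For `0 < lam ≤ 2` this yields `sy < (1 + lam) * sx`, so testing one slack certifies
  -- both inequalities.
  0 ≤ e.diff + f.diff + tau ∧ e.slack lam + f.slack lam + 4 * tau < 0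

/-- Save the current list. -/
def saveList : Program :=
  rSaved ::= lit 0;;
  .loop (.lt (reg rSaved) (reg rLen))
    (.write 8 (reg rSaved) (cell 2 (reg rSaved));; .write 9 (reg rSaved) (cell 3 (reg rSaved));;
      .write 10 (reg rSaved) (cell 4 (reg rSaved));; rSaved ::= reg rSaved + lit 1)

/-- The slack of an entry of the current list. -/
def slackAt (e : Expr) : Expr := cell 2 e - (lit 1 + reg rLam) * cell 3 e

/-- Enlarge the range of candidates in the current list. -/
def advance : Program :=
  rRight ::= reg rRight - lit 1;;
  -- At the first candidate `rBest` has no meaning yet and is overwritten unconditionally.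
  .ite (.and (.lt (reg rRight + lit 1) (reg rLen)) (.le (reg rBest) (slackAt (reg rRight))))
    .skip
    (rBest ::= slackAt (reg rRight);; rBestCo ::= cell 4 (reg rRight))

/-- Test the best candidate and move on in the saved list. -/
def tryBest : Program :=
  .ite (.and (.lt (reg rRight) (reg rLen))
      (.lt ((cell 8 (reg rLeft) - (lit 1 + reg rLam) * cell 9 (reg rLeft)) + reg rBest +
        lit 4 * reg rTau) (lit 0)))
    (rFound ::= lit 1;; rFoundK ::= reg rK;; rFoundCo ::= cell 10 (reg rLeft) + reg rBestCo)
    .skip;;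
  rLeft ::= reg rLeft + lit 1

/-- Search for an acceptable pair of an entry of the saved list and an entry of the current list. -/
def search : Program :=
  (rLeft ::= lit 0;; rRight ::= reg rLen);;
  .loop (.lt (reg rLeft) (reg rSaved))
    (.ite (.and (.lt (lit 0) (reg rRight))
        (.le (lit 0) ((cell 8 (reg rLeft) - cell 9 (reg rLeft)) + diffAt (reg rRight - lit 1) +
          reg rTau)))
      advance tryBest)

theorem saveList_spec {s : State} {n : ℕ} (hn : s.var rLen = n) :
    Runs saveList s (100 * n + 100) fun s' => s'.var rSaved = n ∧
      ∀ i < n, entries s' 8 i = entries s 2 i := by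
  refine Runs.seq (T := 10) (T' := 100 * n + 90) (Q := fun s' => s'.var rSaved = 0) ?_ ?_
    (by linarith)
  · apply Runs.of_loopFree rfl
    · norm_num [Program.bound, Expr.cost]
    · simp [Program.run]
  intro s₀ hc hfr
  refine (Runs.loop (c := 50) (fun v s' =>
      ∃ q : ℕ, v + q = n ∧ s'.var rSaved = q ∧ ∀ i < q, entries s' 8 i = entries s 2 i)
      n (by norm_num) ⟨0, by omega, by simpa using hc, by simp⟩ ?_ ?_).mono le_rfl ?_
  · rintro v s₁ ⟨q, hq, hr, hi⟩ hfr₁ hb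
    have hn₁ : s₁.var rLen = n := by rw [hfr₁.1 _ (by decide), hfr.1 _ (by decide), hn]
    have hqn : q < n := by simpa [hr, hn₁] using hb
    have he : entries s₁ 2 = entries s 2 := by
      rw [entries_congr (hfr₁.2 2 (by decide)) (hfr₁.2 3 (by decide)) (hfr₁.2 4 (by decide)),
        entries_congr (hfr.2 2 (by decide)) (hfr.2 3 (by decide)) (hfr.2 4 (by decide))]
    apply Runs.of_loopFree rfl
    · norm_num [Program.bound, Expr.cost]
    refine ⟨v - 1, by omega, q + 1, by omega, ?_, ?_⟩
    · simp [Program.run, hr]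
    · intro i hi'
      rcases (Nat.lt_succ_iff.1 hi').eq_or_lt with rfl | hi'
      · rw [← he]
        simp [Program.run, hr, entries]
      · rw [← hi i hi']
        simp [Program.run, hr, entries, hi'.ne]
  · norm_num [Test.cost, Expr.cost]
    have : (0 : ℝ) ≤ n := Nat.cast_nonneg n
    linarith
  · rintro s₁ ⟨⟨v, q, hq, hr, hi⟩, hb, hfr₁⟩
    have hn₁ : s₁.var rLen = n := by rw [hfr₁.1 _ (by decide), hfr.1 _ (by decide), hn]
    have hqn : n ≤ q := by simpa [hr, hn₁] using hb
    obtain rfl : q = n := by omega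
    exact ⟨hr, hi⟩

/-- The three registers that report success. -/
def report (s : State) : ℝ × ℝ × ℝ := (s.var rFound, s.var rFoundK, s.var rFoundCo)

/-- The list of the entries `f j` with `j₀ ≤ j < n` has minimal slack `b`, attained with code `c`. -/
def IsBest (lam : ℝ) (n : ℕ) (f : ℕ → Entry) (j₀ : ℕ) (b c : ℝ) : Prop :=
  -- The condition is vacuous for an empty range, so the initial contents of the registers do not
  -- matter.
  j₀ < n → (∀ j, j₀ ≤ j → j < n → b ≤ (f j).slack lam) ∧
    ∃ j, j₀ ≤ j ∧ j < n ∧ b = (f j).slack lam ∧ c = (f j).co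

theorem IsBest.step {lam : ℝ} {n : ℕ} {f : ℕ → Entry} {j₀ : ℕ} {b c b' c' : ℝ}
    (h : IsBest lam n f (j₀ + 1) b c)
    (h' : j₀ + 1 < n ∧ b ≤ (f j₀).slack lam ∧ b' = b ∧ c' = c ∨
      ¬ (j₀ + 1 < n ∧ b ≤ (f j₀).slack lam) ∧ b' = (f j₀).slack lam ∧ c' = (f j₀).co) :
    IsBest lam n f j₀ b' c' := by
  intro hj
  rcases h' with ⟨h1, h2, rfl, rfl⟩ | ⟨h1, rfl, rfl⟩
  · obtain ⟨h3, j, hj1, hj2, hj3, hj4⟩ := h h1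
    refine ⟨fun i hi hin => ?_, j, by omega, hj2, hj3, hj4⟩
    rcases hi.eq_or_lt with rfl | hi
    · exact h2
    · exact h3 i hi hin
  · refine ⟨fun i hi hin => ?_, j₀, le_rfl, hj, rfl, rfl⟩
    rcases hi.eq_or_lt with rfl | hi
    · exact le_rfl
    · obtain ⟨h3, -⟩ := h (by omega)
      have h4 : (f j₀).slack lam < b := by
        by_contra! hcon
        exact h1 ⟨by omega, hcon⟩
      exact h4.le.trans (h3 i hi hin)

/-- As the index in the saved list grows, the partners satisfying the difference condition form a
growing final segment of the current list. The slack of a pair is the sum of the slacks, so only the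
minimum over that segment matters. Every iteration moves one of the two pointers. -/
theorem search_spec {s : State} {δ tau lam : ℝ} {k m n : ℕ} {e f : ℕ → Entry} (hδ : 0 < δ)
    (he : Increasing δ m e) (hf : Increasing δ n f)
    (hse : ∀ i < m, entries s 8 i = e i) (hsf : ∀ i < n, entries s 2 i = f i)
    (hk : s.var rK = k) (hm : s.var rSaved = m) (hn : s.var rLen = n)
    (htau : s.var rTau = tau) (hlam : s.var rLam = lam) :
    Runs search s (300 * (m + n) + 100) fun s' =>
      (report s' = report s ∧ ∀ i < m, ∀ j < n, ¬ Accepts tau lam (e i) (f j)) ∨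
      ∃ i < m, ∃ j < n, Accepts tau lam (e i) (f j) ∧ report s' = (1, (k : ℝ), (e i).co + (f j).co) := by
  refine Runs.seq (T := 10) (T' := 300 * (m + n) + 90)
    (Q := fun s' => s'.var rLeft = 0 ∧ s'.var rRight = n) ?_ ?_ (by linarith)
  · apply Runs.of_loopFree rfl
    · norm_num [Program.bound, Expr.cost]
    · simp [Program.run, hn]
  intro s₀ ⟨hl, hr⟩ hfr
  have hrep : report s₀ = report s := by
    simp only [report]
    rw [hfr.1 rFound (by decide), hfr.1 rFoundK (by decide), hfr.1 rFoundCo (by decide)]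
  refine (Runs.loop (c := 200) (fun v s' => ∃ i j : ℕ, v + i = m + j ∧ i ≤ m ∧ j ≤ n ∧
      s'.var rLeft = i ∧ s'.var rRight = j ∧ IsBest lam n f j (s'.var rBest) (s'.var rBestCo) ∧
      (i < m → ∀ j', j ≤ j' → j' < n → 0 ≤ (e i).diff + (f j').diff + tau) ∧
      ((report s' = report s ∧ ∀ i' < i, ∀ j < n, ¬ Accepts tau lam (e i') (f j)) ∨
      ∃ i < m, ∃ j < n, Accepts tau lam (e i) (f j) ∧ report s' = (1, (k : ℝ), (e i).co + (f j).co)))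
      (m + n) (by norm_num) ?_ ?_ ?_).mono le_rfl ?_
  · refine ⟨0, n, rfl, by omega, le_rfl, by simpa using hl, hr, fun h => absurd h (lt_irrefl _),
      fun _ j' h h' => by omega, .inl ⟨hrep, by simp⟩⟩
  · rintro v s₁ ⟨i, j, hv, hi, hj, hl, hr, hbest, hge, hrep⟩ hfr₁ hb
    have hvar : ∀ x, x ∉ search.wv → s₁.var x = s.var x := fun x hx => by
      rw [hfr₁.1 x fun h => hx (List.mem_append_right _ h),
        hfr.1 x fun h => hx (List.mem_append_left _ h)]
    have harr : s₁.arr = s.arr := funext fun a => by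
      rw [hfr₁.2 a (by simp [Program.wa, advance, tryBest]), hfr.2 a (by simp [Program.wa])]
    have him : i < m := by simpa [hl, hvar rSaved (by decide), hm] using hb
    have hn₁ : s₁.var rLen = n := by rw [hvar _ (by decide), hn]
    have htau₁ : s₁.var rTau = tau := by rw [hvar _ (by decide), htau]
    have hlam₁ : s₁.var rLam = lam := by rw [hvar _ (by decide), hlam]
    have hk₁ : s₁.var rK = k := by rw [hvar _ (by decide), hk]
    have e1 : ∀ i < m, s.arr 8 i = (e i).sx := fun i hi => by rw [← hse i hi]; rfl
    have e2 : ∀ i < m, s.arr 9 i = (e i).sy := fun i hi => by rw [← hse i hi]; rfl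
    have e3 : ∀ i < m, s.arr 10 i = (e i).co := fun i hi => by rw [← hse i hi]; rfl
    have f1 : ∀ i < n, s.arr 2 i = (f i).sx := fun i hi => by rw [← hsf i hi]; rfl
    have f2 : ∀ i < n, s.arr 3 i = (f i).sy := fun i hi => by rw [← hsf i hi]; rfl
    have f3 : ∀ i < n, s.arr 4 i = (f i).co := fun i hi => by rw [← hsf i hi]; rfl
    refine Runs.ite (T := 150) (fun hA => ?_) (fun hA => ?_)
      (by norm_num [Test.cost, Expr.cost, diffAt,
        show ∀ e f : Expr, e + f = .add e f from fun _ _ => rfl,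
        show ∀ e f : Expr, e - f = .sub e f from fun _ _ => rfl])
    all_goals simp only [Test.holds_and, Test.holds_lt, Test.holds_le, diffAt, Expr.eval_const,
      Rat.cast_zero, Rat.cast_one, Expr.eval_var, Expr.eval_sub, Expr.eval_add, Expr.eval_read,
      hl, hr, harr, htau₁, address_natCast, Nat.cast_pos, address_sub_one, e1 i him, e2 i him] at hA
    · obtain ⟨j, rfl⟩ : ∃ j', j = j' + 1 := ⟨j - 1, by omega⟩
      have hjn : j < n := hj
      rw [Nat.add_sub_cancel, f1 j hjn, f2 j hjn] at hA
      have hge' : ∀ j', j ≤ j' → j' < n → 0 ≤ (e i).diff + (f j').diff + tau := by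
        intro j' hj' hjn'
        have := hf.diff_le hδ hj' hjn'
        have := hA.2
        simp only [Entry.diff] at *
        linarith
      refine (Runs.mono (T := 100) (Q := fun s' => s'.var rRight = j ∧
        IsBest lam n f j (s'.var rBest) (s'.var rBestCo)) ?_ le_rfl fun s' h => h).frame.mono
          (by norm_num) ?_
      · apply Runs.of_loopFree rfl
        · have : advance.bound ≤ 100 := Nat.le_of_ble_eq_true rfl
          exact_mod_cast this
        have hj1 : (j : ℝ) + 1 < n ↔ j + 1 < n := by norm_cast
        simp only [advance, Program.run, Test.holds_and, Test.holds_lt, Test.holds_le, slackAt,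
          Expr.eval_const, Rat.cast_one, Expr.eval_var, Expr.eval_sub, Expr.eval_add,
          Expr.eval_mul, Expr.eval_read, hr, harr, hlam₁, address_natCast, State.setVar_var,
          State.setVar_arr, hn₁, Nat.cast_add, Nat.cast_one, add_sub_cancel_right, if_true,
          Nat.reduceEqDiff, if_false, f1 j hjn, f2 j hjn, f3 j hjn, hj1]
        split_ifs with hB
        · exact ⟨by simp, hbest.step (.inl ⟨hB.1, hB.2, by simp, by simp⟩)⟩
        · exact ⟨by simp, hbest.step (.inr ⟨hB, by simp [Entry.slack], by simp⟩)⟩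
      · rintro s₂ ⟨⟨hr₂, hbest₂⟩, hfr₂⟩
        have hrep₂ : report s₂ = report s₁ := by
          simp only [report]
          rw [hfr₂.1 rFound (by decide), hfr₂.1 rFoundK (by decide), hfr₂.1 rFoundCo (by decide)]
        exact ⟨v - 1, by omega, i, j, by omega, hi, by omega, by rw [hfr₂.1 _ (by decide), hl],
          hr₂, hbest₂, fun _ => hge', by rwa [hrep₂]⟩
    -- An acceptable partner before position `j` would, by monotonicity, make position `j - 1` pass
    -- the difference test that has just failed.
    · have hacc : (∃ j < n, Accepts tau lam (e i) (f j)) →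
          j < n ∧ (e i).slack lam + s₁.var rBest + 4 * tau < 0 := by
        rintro ⟨j', hj', ha⟩
        by_cases hjj : j ≤ j'
        · have := (hbest (by omega)).1 j' hjj hj'
          exact ⟨by omega, by linarith [ha.2]⟩
        · exfalso
          have h1 := hf.diff_le hδ (show j' ≤ j - 1 by omega) (by omega)
          rw [f1 (j - 1) (by omega), f2 (j - 1) (by omega)] at hA
          apply hA
          refine ⟨by omega, ?_⟩
          have h2 := ha.1
          simp only [Entry.diff] at *
          linarith
      have hge' : i + 1 < m → ∀ j', j ≤ j' → j' < n → 0 ≤ (e (i + 1)).diff + (f j').diff + tau := by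
        intro h j' hj' hjn'
        have := he.diff_le hδ (Nat.le_succ i) h
        have := hge him j' hj' hjn'
        linarith
      refine (Runs.mono (T := 100) (Q := fun s' => s'.var rLeft = (i + 1 : ℕ) ∧
        ((j < n ∧ (e i).slack lam + s₁.var rBest + 4 * tau < 0) ∧
          report s' = (1, (k : ℝ), (e i).co + s₁.var rBestCo) ∨
        ¬ (j < n ∧ (e i).slack lam + s₁.var rBest + 4 * tau < 0) ∧ report s' = report s₁))
        ?_ le_rfl fun s' h => h).frame.mono (by norm_num) ?_
      · apply Runs.of_loopFree rfl
        · have : tryBest.bound ≤ 100 := Nat.le_of_ble_eq_true rfl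
          exact_mod_cast this
        simp only [tryBest, Program.run, Test.holds_and, Test.holds_lt, Expr.eval_const,
          Rat.cast_zero, Rat.cast_one, Rat.cast_ofNat, Expr.eval_var, Expr.eval_sub, Expr.eval_add,
          Expr.eval_mul, Expr.eval_read, hl, hr, harr, hlam₁, htau₁, address_natCast, hn₁,
          e1 i him, e2 i him, Nat.cast_lt]
        split_ifs with hB
        · exact ⟨by simp [hl], .inl ⟨hB, by simp [report, hk₁, hl, harr, e3 i him]⟩⟩
        · exact ⟨by simp [hl], .inr ⟨hB, by simp [report]⟩⟩
      · rintro s₂ ⟨⟨hl₂, hrep₂⟩, hfr₂⟩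
        refine ⟨v - 1, by omega, i + 1, j, by omega, him, hj, hl₂,
          by rw [hfr₂.1 _ (by decide), hr],
          by rwa [hfr₂.1 rBest (by decide), hfr₂.1 rBestCo (by decide)], hge', ?_⟩
        rcases hrep₂ with ⟨⟨hjn, hneg⟩, hrep₂⟩ | ⟨hno, hrep₂⟩
        · obtain ⟨-, j', hj', hjn', hb1, hb2⟩ := hbest hjn
          refine .inr ⟨i, him, j', hjn', ⟨hge him j' hj' hjn', by rw [← hb1]; exact hneg⟩, ?_⟩
          rw [hrep₂, hb2]
        · rw [hrep₂]
          rcases hrep with ⟨hrep, hnone⟩ | hrep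
          · refine .inl ⟨hrep, fun i' hi' j' hj' ha => ?_⟩
            rcases (Nat.lt_succ_iff.1 hi').eq_or_lt with rfl | hi'
            · exact hno (hacc ⟨j', hj', ha⟩)
            · exact hnone i' hi' j' hj' ha
          · exact .inr hrep
  · norm_num [Test.cost, Expr.cost]
    have : (0 : ℝ) ≤ n := Nat.cast_nonneg n
    have : (0 : ℝ) ≤ m := Nat.cast_nonneg m
    linarith
  · rintro s₁ ⟨⟨v, i, j, hv, hi, hj, hl, hr, hbest, hge, hrep⟩, hb, hfr₁⟩
    have hm₁ : s₁.var rSaved = m := by rw [hfr₁.1 _ (by decide), hfr.1 _ (by decide), hm]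
    have hmi : m ≤ i := by simpa [hl, hm₁] using hb
    obtain rfl : i = m := by omega
    exact hrep

end SubsetSumRatio

/-! ### Lower bounds from unsuccessful searches -/

namespace SubsetSumRatio

/-- The numerical parameters of the algorithm: `1 / N` is the accuracy, `m` the number of large
items, `J` the number of relevant items, and `B` a bound on the length of the lists. -/
structure Params where
  m : ℕ
  J : ℕ
  N : ℝ
  G : ℝ
  B : ℝ

namespace Params

/-- The tolerance of the search for the largest item `I k`. -/
noncomputable def tau (p : Params) (I : ℕ → ℝ) (k : ℕ) : ℝ :=
  open Classical in
  -- A collision of subset sums only guarantees a total of `G * I k`, so the tolerance is finer by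
  -- the factor `G` where collisions are used.
  if p.m ≤ k ∧ p.G * I k ≤ I (k - p.m) then I k / (100 * p.N) * p.G else I k / (100 * p.N)

/-- The width of the buckets. -/
noncomputable def delta (p : Params) (I : ℕ → ℝ) (k : ℕ) : ℝ := p.tau I k / (2 * p.J)

/-- The search with largest item `I k` can fail with the threshold `1 + lam`. -/
def Unsuccessful (p : Params) (I : ℕ → ℝ) (lam : ℝ) (k : ℕ) : Prop :=
  ∃ (i n n' : ℕ) (f f' : ℕ → Entry), min p.m (k + 1) ≤ i ∧ i ≤ min p.J (k + 1) ∧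
    Represents (p.delta I k) (fun i => I (k - i)) 0 (min p.m (k + 1)) n f ∧
    Represents (p.delta I k) (fun i => I (k - i)) (min p.m (k + 1)) i n' f' ∧
    (i < min p.J (k + 1) → p.B < n') ∧
    ∀ j < n, ∀ j' < n', ¬ Accepts (p.tau I k) lam (f j) (f' j')

/-- The code `co` describes two sets of ratio less than `1 + lam`. -/
def Witness (p : Params) (I : ℕ → ℝ) (lam : ℝ) (k : ℕ) (co : ℝ) : Prop :=
  ∃ d : ℕ → Fin 3,
    (patternEntry (fun i => I (k - i)) d 0 (min p.J (k + 1))).co = co ∧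
    (patternEntry (fun i => I (k - i)) d 0 (min p.J (k + 1))).sx <
      (1 + lam) * (patternEntry (fun i => I (k - i)) d 0 (min p.J (k + 1))).sy ∧
    (patternEntry (fun i => I (k - i)) d 0 (min p.J (k + 1))).sy <
      (1 + lam) * (patternEntry (fun i => I (k - i)) d 0 (min p.J (k + 1))).sx

/-- The relations between the parameters that the correctness of the algorithm rests on. -/
structure Valid (p : Params) (M q : ℕ) : Prop where
  m_pos : 0 < p.m
  m_le : p.m ≤ M
  J_eq : p.J = q * M
  q_pos : 0 < q
  G_pos : 0 < p.G
  G_le : p.G ≤ 1 / 2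
  N_ge : 400 * M ≤ p.N
  -- After `q` blocks of decay the items are negligible.
  pow_le : p.G ^ q ≤ p.G / p.N ^ 2
  -- There are more subsets of `M` items than cells of width `tau` for their sums.
  pigeon : 100 * M * p.N / p.G + 1 < 2 ^ M
  -- This bounds the second list in the sparse case; the next field does so in the dense case.
  B_ge : 800 * M * p.J * p.N * p.G + 2 ≤ p.B
  B_ge' : 8 * (400 * p.J ^ 2 * p.N / p.G + 1) ^ 2 ≤ p.B * 4 ^ p.m

end Params

theorem patternEntry_nonneg {x : ℕ → ℝ} {d : ℕ → Fin 3} {a b : ℕ}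
    (hx : ∀ i, a ≤ i → i < b → 0 ≤ x i) :
    0 ≤ (patternEntry x d a b).sx ∧ 0 ≤ (patternEntry x d a b).sy := by
  simp only [patternEntry]
  constructor <;>
  · refine Finset.sum_nonneg fun i hi => ?_
    split_ifs
    · exact hx i (Finset.mem_Ico.1 hi).1 (Finset.mem_Ico.1 hi).2
    · exact le_rfl

theorem patternEntry_append (x : ℕ → ℝ) (d : ℕ → Fin 3) {a b c : ℕ} (hab : a ≤ b) (hbc : b ≤ c) :
    (patternEntry x d a c).sx = (patternEntry x d a b).sx + (patternEntry x d b c).sx ∧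
    (patternEntry x d a c).sy = (patternEntry x d a b).sy + (patternEntry x d b c).sy ∧
    (patternEntry x d a c).co = (patternEntry x d a b).co + (patternEntry x d b c).co := by
  simp only [patternEntry]
  rw [Finset.sum_Ico_consecutive _ hab hbc, Finset.sum_Ico_consecutive _ hab hbc,
    Finset.sum_Ico_consecutive _ hab hbc]
  exact ⟨rfl, rfl, rfl⟩

/-- Exchange the two sets. -/
def swapPattern (d : ℕ → Fin 3) (i : ℕ) : Fin 3 := -d i

theorem patternEntry_swap (x : ℕ → ℝ) (d : ℕ → Fin 3) (a b : ℕ) :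
    (patternEntry x (swapPattern d) a b).sx = (patternEntry x d a b).sy ∧
    (patternEntry x (swapPattern d) a b).sy = (patternEntry x d a b).sx := by
  -- Negation modulo `3` exchanges `1` and `2` and fixes `0`.
  have h1 : ∀ c : Fin 3, -c = 1 ↔ c = 2 := by decide
  have h2 : ∀ c : Fin 3, -c = 2 ↔ c = 1 := by decide
  simp only [patternEntry, swapPattern, h1, h2, and_self]

theorem le_patternEntry_tot {x : ℕ → ℝ} {d : ℕ → Fin 3} {a b i : ℕ}
    (hx : ∀ i, a ≤ i → i < b → 0 ≤ x i) (ha : a ≤ i) (hb : i < b) (hd : d i ≠ 0) :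
    x i ≤ (patternEntry x d a b).tot := by
  have hsum : (patternEntry x d a b).tot = ∑ i ∈ Finset.Ico a b, if d i = 0 then 0 else x i := by
    simp only [Entry.tot, patternEntry, ← Finset.sum_add_distrib]
    refine Finset.sum_congr rfl fun i _ => ?_
    generalize d i = c
    fin_cases c <;> simp
  rw [hsum]
  refine le_trans ?_ (Finset.single_le_sum (f := fun i => if d i = 0 then 0 else x i)
    (fun i hi => ?_) (Finset.mem_Ico.2 ⟨ha, hb⟩))
  · simp [hd]
  · split_ifs
    · exact le_rfl
    · exact hx i (Finset.mem_Ico.1 hi).1 (Finset.mem_Ico.1 hi).2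

open Classical in
/-- The pattern of the difference of two sets. -/
noncomputable def diffPattern (S S' : Finset ℕ) (i : ℕ) : Fin 3 :=
  if i ∈ S ∧ i ∉ S' then 1 else if i ∈ S' ∧ i ∉ S then 2 else 0

theorem diffPattern_diff (x : ℕ → ℝ) {S S' : Finset ℕ} {e : ℕ} (hS : S ⊆ Finset.range e)
    (hS' : S' ⊆ Finset.range e) :
    (patternEntry x (diffPattern S S') 0 e).diff = ∑ i ∈ S, x i - ∑ i ∈ S', x i := by
  have h1 : ∀ {S : Finset ℕ}, S ⊆ Finset.range e →
      ∑ i ∈ S, x i = ∑ i ∈ Finset.range e, if i ∈ S then x i else 0 := by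
    intro S hS
    rw [← Finset.sum_filter, Finset.filter_mem_eq_inter, Finset.inter_eq_right.2 hS]
  rw [h1 hS, h1 hS']
  simp only [Entry.diff, patternEntry, ← Finset.sum_sub_distrib, Nat.Ico_zero_eq_range]
  refine Finset.sum_congr rfl fun i _ => ?_
  by_cases h : i ∈ S <;> by_cases h' : i ∈ S' <;> simp [diffPattern, h, h']

theorem diffPattern_ne_zero {S S' : Finset ℕ} {i : ℕ} (h : ¬ (i ∈ S ↔ i ∈ S')) :
    diffPattern S S' i ≠ 0 := by
  by_cases h1 : i ∈ S <;> by_cases h2 : i ∈ S' <;> simp_all [diffPattern]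

theorem abs_sub_lt_of_floor_eq {a b c : ℝ} (hc : 0 < c) (h : ⌊a / c⌋ = ⌊b / c⌋) : |a - b| < c := by
  have := Int.abs_sub_lt_one_of_floor_eq_floor h
  rwa [← sub_div, abs_div, abs_of_pos hc, div_lt_one hc] at this

/-- Close numbers lie in equal or adjacent cells, and parity separates adjacent cells. In the
counting arguments one extra bit thus replaces exactness. -/
theorem floor_eq_of_parity {a b c : ℝ} (hc : 0 < c) (h : |a - b| < c)
    (h' : ⌊a / c⌋ % 2 = ⌊b / c⌋ % 2) : ⌊a / c⌋ = ⌊b / c⌋ := by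
  have h1 : |a / c - b / c| < 1 := by
    rwa [← sub_div, abs_div, abs_of_pos hc, div_lt_one hc]
  rw [abs_lt] at h1
  have h2 : ⌊a / c⌋ < ⌊b / c⌋ + 2 := by
    rw [Int.floor_lt]
    push_cast
    linarith [Int.lt_floor_add_one (b / c)]
  have h3 : ⌊b / c⌋ < ⌊a / c⌋ + 2 := by
    rw [Int.floor_lt]
    push_cast
    linarith [Int.lt_floor_add_one (a / c)]
  omega

namespace Params

variable {p : Params} {M q : ℕ} {I : ℕ → ℝ} {lam : ℝ} {k : ℕ}

theorem Valid.M_pos (hp : p.Valid M q) : 0 < M := hp.m_pos.trans_le hp.m_le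

theorem Valid.m_le_J (hp : p.Valid M q) : p.m ≤ p.J := by
  rw [hp.J_eq]
  exact hp.m_le.trans (Nat.le_mul_of_pos_left _ hp.q_pos)

theorem Valid.M_le_J (hp : p.Valid M q) : M ≤ p.J := by
  rw [hp.J_eq]
  exact Nat.le_mul_of_pos_left _ hp.q_pos

theorem Valid.N_pos (hp : p.Valid M q) : 0 < p.N := by
  have : (0 : ℝ) < M := by exact_mod_cast hp.M_pos
  linarith [hp.N_ge]

theorem Valid.J_pos (hp : p.Valid M q) : (0 : ℝ) < p.J := by
  exact_mod_cast hp.m_pos.trans_le hp.m_le_J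

theorem tau_pos (hp : p.Valid M q) (hI : 0 < I k) : 0 < p.tau I k := by
  have := hp.N_pos
  have := hp.G_pos
  unfold tau
  split_ifs <;> positivity

theorem delta_pos (hp : p.Valid M q) (hI : 0 < I k) : 0 < p.delta I k := by
  have := tau_pos hp hI
  have := hp.J_pos
  unfold delta
  positivity

theorem tau_le (hp : p.Valid M q) (hI : 0 < I k) : p.tau I k ≤ I k / (100 * p.N) := by
  have := hp.N_pos
  unfold tau
  split_ifs
  · have : 0 ≤ I k / (100 * p.N) := by positivity
    nlinarith [hp.G_le]
  · exact le_rfl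

theorem le_tau (hp : p.Valid M q) (hI : 0 < I k) : I k / (100 * p.N) * p.G ≤ p.tau I k := by
  have := hp.N_pos
  unfold tau
  split_ifs
  · exact le_rfl
  · have : 0 ≤ I k / (100 * p.N) := by positivity
    nlinarith [hp.G_le]

/-- An unsuccessful search excludes all patterns that are clearly good. -/
theorem excluded (hp : p.Valid M q) (hI : 0 < I k) (hlam : 0 ≤ lam) (hlam' : lam ≤ 2)
    {i n n' : ℕ} {f f' : ℕ → Entry} (hi : min p.m (k + 1) ≤ i) (hi' : i ≤ min p.J (k + 1))
    (h : Represents (p.delta I k) (fun i => I (k - i)) 0 (min p.m (k + 1)) n f)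
    (h' : Represents (p.delta I k) (fun i => I (k - i)) (min p.m (k + 1)) i n' f')
    (hno : ∀ j < n, ∀ j' < n', ¬ Accepts (p.tau I k) lam (f j) (f' j')) (d : ℕ → Fin 3)
    (hdiff : -(p.tau I k / 2) ≤ (patternEntry (fun i => I (k - i)) d 0 i).diff)
    (hslack : (patternEntry (fun i => I (k - i)) d 0 i).slack lam < -(5 * p.tau I k)) : False := by
  obtain ⟨j, hj, hd, ht⟩ := h.complete d
  obtain ⟨j', hj', hd', ht'⟩ := h'.complete d
  obtain ⟨a1, a2, -⟩ := patternEntry_append (fun i => I (k - i)) d (Nat.zero_le _) hi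
  apply hno j hj j' hj'
  have htau := tau_pos hp hI
  have hδ := delta_pos hp hI
  -- The two lists together undergo at most `J` roundings, each of size at most `tau / (2 * J)`.
  have hsum : ((min p.m (k + 1) - 0 : ℕ) : ℝ) * p.delta I k +
      ((i - min p.m (k + 1) : ℕ) : ℝ) * p.delta I k ≤ p.tau I k / 2 := by
    rw [← add_mul, ← Nat.cast_add]
    have h1 : min p.m (k + 1) - 0 + (i - min p.m (k + 1)) ≤ p.J := by omega
    have h2 : ((min p.m (k + 1) - 0 + (i - min p.m (k + 1)) : ℕ) : ℝ) ≤ p.J := by exact_mod_cast h1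
    have h3 : p.J * p.delta I k = p.tau I k / 2 := by
      have := hp.J_pos
      unfold delta
      field_simp
    nlinarith
  rw [abs_le] at hd hd'
  simp only [Entry.diff, Entry.tot, Entry.slack, Accepts] at *
  rw [a1, a2] at hdiff hslack
  constructor
  · linarith [hd.1, hd'.1]
  -- As the slack is `((2 + lam) * diff - lam * tot) / 2` and `lam ≤ 2`, rounding raises it by at
  -- most `tau`, from below `-5 * tau` to below `-4 * tau`.
  · nlinarith [hd.2, hd'.2]

/-- The largest items have comparable sizes. -/
def Dense (p : Params) (I : ℕ → ℝ) (k : ℕ) : Prop := p.m ≤ k ∧ p.G * I k ≤ I (k - p.m)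

theorem tau_of_not_dense (h : ¬ p.Dense I k) : p.tau I k = I k / (100 * p.N) := if_neg h

theorem tau_of_dense (h : p.Dense I k) : p.tau I k = I k / (100 * p.N) * p.G := if_pos h

/-- Cancelling the common items leaves a pattern with difference at most `tau` in absolute value and
total at least `G * I k`. Half of `lam` times this total is at least `25 * tau`. Oriented so that
the difference is nonnegative, the pattern has slack far below `-5 * tau`, which contradicts
`excluded`. -/
theorem excluded_collision (hp : p.Valid M q) (hI : ∀ i ≤ k, 0 < I i)
    (hlam : 1 / (2 * p.N) ≤ lam) (hlam' : lam ≤ 2)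
    {i n n' : ℕ} {f f' : ℕ → Entry} (hi : min p.m (k + 1) ≤ i) (hi' : i ≤ min p.J (k + 1))
    (h : Represents (p.delta I k) (fun i => I (k - i)) 0 (min p.m (k + 1)) n f)
    (h' : Represents (p.delta I k) (fun i => I (k - i)) (min p.m (k + 1)) i n' f')
    (hno : ∀ j < n, ∀ j' < n', ¬ Accepts (p.tau I k) lam (f j) (f' j'))
    (hdense : p.Dense I k) {S S' : Finset ℕ} (hS : S ⊆ Finset.range i)
    (hS' : S' ⊆ Finset.range i)
    {j : ℕ} (hj : ¬ (j ∈ S ↔ j ∈ S')) (hjk : p.G * I k ≤ I (k - j))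
    (hclose : |∑ i ∈ S, I (k - i) - ∑ i ∈ S', I (k - i)| ≤ p.tau I k) : False := by
  have hIk := hI k le_rfl
  have hN := hp.N_pos
  have hlam0 : 0 ≤ lam := le_trans (by positivity) hlam
  have htau := tau_pos hp hIk
  have hji : j < i := by
    by_contra hcon
    apply hj
    have h1 : j ∉ S := fun h => hcon (Finset.mem_range.1 (hS h))
    have h2 : j ∉ S' := fun h => hcon (Finset.mem_range.1 (hS' h))
    simp [h1, h2]
  have htot := le_patternEntry_tot (x := fun i => I (k - i)) (d := diffPattern S S') (a := 0) (b := i)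
    (fun i _ _ => (hI _ (Nat.sub_le _ _)).le) (Nat.zero_le j) hji (diffPattern_ne_zero hj)
  have hd := diffPattern_diff (fun i => I (k - i)) hS hS'
  have hkey : 25 * p.tau I k ≤ lam / 2 * (p.G * I k) := by
    rw [tau_of_dense hdense]
    have h1 : 25 * (I k / (100 * p.N) * p.G) = 1 / (2 * p.N) / 2 * (p.G * I k) := by
      field_simp; ring
    rw [h1]
    have := hp.G_pos
    gcongr
  obtain ⟨w1, w2⟩ := patternEntry_swap (fun i => I (k - i)) (diffPattern S S') 0 i
  have hbig : lam / 2 * (p.G * I k) ≤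
      lam / 2 * (patternEntry (fun i => I (k - i)) (diffPattern S S') 0 i).tot := by
    gcongr
    exact hjk.trans htot
  rw [abs_le, ← hd] at hclose
  simp only [Entry.diff, Entry.tot] at *
  rcases le_total 0 ((patternEntry (fun i => I (k - i)) (diffPattern S S') 0 i).sx -
    (patternEntry (fun i => I (k - i)) (diffPattern S S') 0 i).sy) with hs | hs
  · refine excluded hp hIk hlam0 hlam' hi hi' h h' hno (diffPattern S S') ?_ ?_
    · simp only [Entry.diff]; linarith
    · simp only [Entry.slack]
      nlinarith
  · refine excluded hp hIk hlam0 hlam' hi hi' h h' hno (swapPattern (diffPattern S S')) ?_ ?_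
    · simp only [Entry.diff, w1, w2]; linarith
    · simp only [Entry.slack, w1, w2]
      nlinarith

end Params

end SubsetSumRatio

/-! ### The dense case: separated subset sums, and the decay they force -/

namespace SubsetSumRatio

namespace Params

variable {p : Params} {M q : ℕ} {I : ℕ → ℝ} {lam : ℝ} {k : ℕ}

open Classical in
/-- If the largest items have comparable sizes, then an unsuccessful search is exhaustive, since
otherwise two different sums of items would collide. -/
theorem exhaustive_of_dense (hp : p.Valid M q) (hI : ∀ i ≤ k, 0 < I i)
    (hmono : ∀ i j, i ≤ j → j ≤ k → I i ≤ I j)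
    (hlam : 1 / (2 * p.N) ≤ lam) (hlam' : lam ≤ 2)
    {i n n' : ℕ} {f f' : ℕ → Entry} (hi : min p.m (k + 1) ≤ i) (hi' : i ≤ min p.J (k + 1))
    (h : Represents (p.delta I k) (fun i => I (k - i)) 0 (min p.m (k + 1)) n f)
    (h' : Represents (p.delta I k) (fun i => I (k - i)) (min p.m (k + 1)) i n' f')
    (hno : ∀ j < n, ∀ j' < n', ¬ Accepts (p.tau I k) lam (f j) (f' j'))
    (hdense : p.Dense I k) : (n' : ℝ) ≤ p.B := by
  have hIk := hI k le_rfl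
  have hN := hp.N_pos
  have hJ := hp.J_pos
  have hG := hp.G_pos
  have htau := tau_pos hp hIk
  have hδ := delta_pos hp hIk
  have hcol := @excluded_collision p M q I lam k hp hI hlam hlam' i n n' f f' hi hi' h h' hno hdense
  have hm : min p.m (k + 1) = p.m := min_eq_left (by have := hdense.1; omega)
  rw [hm] at hi h'
  -- Half a bucket: if both sums of two entries agree up to `c`, their differences agree up to
  -- `delta`.
  set c := p.delta I k / 2 with hc
  have hc0 : 0 < c := by positivity
  have hJ1 : (1 : ℝ) ≤ p.J := by exact_mod_cast hJ
  have hctau : c ≤ p.tau I k := by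
    rw [hc, delta, div_div, div_le_iff₀ (by positivity)]
    nlinarith
  set W := Finset.Ico p.m i with hW
  set cellOf : Finset ℕ → ℤ := fun S => ⌊(∑ j ∈ S, I (k - j)) / c⌋ with hcellOf
  set 𝒞 : Finset ℤ := W.powerset.image cellOf with h𝒞
  have hpar : ∀ z : ℤ, z % 2 ∈ Finset.Ico (0 : ℤ) 2 := fun z => by
    rw [Finset.mem_Ico]; omega
  -- the list is at most quadratically longer than the number of cells
  have hlist : n' ≤ 𝒞.card * (𝒞.card * 2) := by
    have hsx : ∀ d : ℕ → Fin 3, ∀ c' : Fin 3, (∑ j ∈ W, if d j = c' then I (k - j) else 0) =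
        ∑ j ∈ W.filter fun j => d j = c', I (k - j) := fun d c' => (Finset.sum_filter _ _).symm
    have hmem : ∀ j < n', ⌊(f' j).sx / c⌋ ∈ 𝒞 ∧ ⌊(f' j).sy / c⌋ ∈ 𝒞 := by
      intro j hj
      obtain ⟨d, hd⟩ := h'.sound j hj
      rw [hd]
      constructor
      · refine Finset.mem_image.2 ⟨W.filter fun j => d j = 1, by simp, ?_⟩
        simp only [hcellOf, ← hsx]; rfl
      · refine Finset.mem_image.2 ⟨W.filter fun j => d j = 2, by simp, ?_⟩
        simp only [hcellOf, ← hsx]; rfl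
    -- An entry is determined by the cells of its two sums and the parity of its bucket.
    have := Finset.card_le_card_of_injOn (s := Finset.range n')
      (t := 𝒞 ×ˢ (𝒞 ×ˢ Finset.Ico (0 : ℤ) 2))
      (fun j => (⌊(f' j).sx / c⌋, ⌊(f' j).sy / c⌋, (f' j).bucket (p.delta I k) % 2))
      (fun j hj => by
        have := hmem j (by simpa using hj)
        simp only [Finset.coe_product, Set.mem_prod, Finset.mem_coe]
        exact ⟨this.1, this.2, hpar _⟩)
      (fun a ha b hb hab => by
        simp only [Prod.mk.injEq] at hab
        have h1 := abs_sub_lt_of_floor_eq hc0 hab.1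
        have h2 := abs_sub_lt_of_floor_eq hc0 hab.2.1
        have h3 : |(f' a).diff - (f' b).diff| < p.delta I k := by
          rw [abs_lt] at *
          simp only [Entry.diff]
          constructor <;> linarith
        have h4 := floor_eq_of_parity hδ h3 hab.2.2
        by_contra hne
        rcases Nat.lt_or_gt_of_ne hne with hlt | hlt
        · exact absurd h4 (h'.incr a b hlt (by simpa using hb)).ne
        · exact absurd h4.symm (h'.incr b a hlt (by simpa using ha)).ne)
    simpa using this
  -- the cells together with the sets of large items give almost distinct sums
  have hcells : 2 ^ p.m * 𝒞.card ≤ (⌊2 * p.J * I k / p.delta I k⌋₊ + 1) * 2 := by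
    have hch : ∀ z ∈ 𝒞, ∃ S ∈ W.powerset, cellOf S = z := fun z hz => Finset.mem_image.1 hz
    choose! S hSW hS using hch
    have hdisj : ∀ A ∈ (Finset.range p.m).powerset, ∀ z ∈ 𝒞, Disjoint A (S z) := by
      intro A hA z hz
      rw [Finset.disjoint_left]
      intro j hj hj'
      have h1 := Finset.mem_range.1 (Finset.mem_powerset.1 hA hj)
      have h2 := (Finset.mem_Ico.1 (Finset.mem_powerset.1 (hSW z hz) hj')).1
      omega
    have hsub : ∀ A ∈ (Finset.range p.m).powerset, ∀ z ∈ 𝒞, A ∪ S z ⊆ Finset.range i := by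
      intro A hA z hz j hj
      rcases Finset.mem_union.1 hj with hj | hj
      · exact Finset.mem_range.2 ((Finset.mem_range.1 (Finset.mem_powerset.1 hA hj)).trans_le hi)
      · exact Finset.mem_range.2 (Finset.mem_Ico.1 (Finset.mem_powerset.1 (hSW z hz) hj)).2
    -- If `A ∪ S z` and `A' ∪ S z'` have sums in the same cell, then `A = A'`, since otherwise they
    -- would collide while differing in a large item. Then the sums over `S z` and `S z'` are close,
    -- and the parities of `z` and `z'` decide.
    have := Finset.card_le_card_of_injOn (s := (Finset.range p.m).powerset ×ˢ 𝒞)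
      (t := Finset.range (⌊2 * p.J * I k / p.delta I k⌋₊ + 1) ×ˢ Finset.Ico (0 : ℤ) 2)
      (fun Az => (⌊(∑ j ∈ Az.1 ∪ S Az.2, I (k - j)) / c⌋₊, Az.2 % 2))
      (fun ⟨A, z⟩ hAz => by
        obtain ⟨hA, hz⟩ := Finset.mem_product.1 (Finset.mem_coe.1 hAz)
        simp only [Finset.coe_product, Set.mem_prod, Finset.mem_coe]
        refine ⟨Finset.mem_range.2 (Nat.lt_succ_of_le (Nat.floor_le_floor ?_)), hpar _⟩
        have h1 : ∑ j ∈ A ∪ S z, I (k - j) ≤ p.J * I k := by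
          calc ∑ j ∈ A ∪ S z, I (k - j) ≤ ∑ j ∈ Finset.range i, I (k - j) :=
                Finset.sum_le_sum_of_subset_of_nonneg (hsub A hA z hz)
                  fun j _ _ => (hI _ (Nat.sub_le _ _)).le
            _ ≤ ∑ j ∈ Finset.range i, I k :=
                Finset.sum_le_sum fun j _ => hmono _ _ (Nat.sub_le _ _) le_rfl
            _ = i * I k := by simp
            _ ≤ p.J * I k := by
                have : i ≤ p.J := by omega
                gcongr
        have h2 : 2 * p.J * I k / p.delta I k = (p.J * I k) / c := by
          rw [hc]; field_simp
        rw [h2]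
        gcongr)
      (fun ⟨A, z⟩ hAz ⟨A', z'⟩ hAz' heq => by
        obtain ⟨hA, hz⟩ := Finset.mem_product.1 (Finset.mem_coe.1 hAz)
        obtain ⟨hA', hz'⟩ := Finset.mem_product.1 (Finset.mem_coe.1 hAz')
        simp only [Prod.mk.injEq] at heq hA hA' hz hz'
        have hpos : ∀ T : Finset ℕ, 0 ≤ (∑ j ∈ T, I (k - j)) / c := fun T =>
          div_nonneg (Finset.sum_nonneg fun j _ => (hI _ (Nat.sub_le _ _)).le) hc0.le
        have hfl : ⌊(∑ j ∈ A ∪ S z, I (k - j)) / c⌋ = ⌊(∑ j ∈ A' ∪ S z', I (k - j)) / c⌋ := by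
          rw [← Int.natCast_floor_eq_floor (hpos _), ← Int.natCast_floor_eq_floor (hpos _), heq.1]
        have hlt := abs_sub_lt_of_floor_eq hc0 hfl
        have hAA : A = A' := by
          by_contra hne
          have : ∃ j, ¬ (j ∈ A ↔ j ∈ A') := by
            by_contra! hall
            exact hne (Finset.ext hall)
          obtain ⟨j, hj⟩ := this
          have hjm : j < p.m := by
            by_contra hcon
            apply hj
            have h1 : j ∉ A := fun h => hcon (Finset.mem_range.1 (Finset.mem_powerset.1 hA h))
            have h2 : j ∉ A' := fun h => hcon (Finset.mem_range.1 (Finset.mem_powerset.1 hA' h))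
            simp [h1, h2]
          have hnot : ∀ z ∈ 𝒞, j ∉ S z := fun z hz hj' => by
            have := (Finset.mem_Ico.1 (Finset.mem_powerset.1 (hSW z hz) hj')).1
            omega
          refine hcol (hsub A hA z hz) (hsub A' hA' z' hz') (j := j) ?_ ?_ (hlt.le.trans hctau)
          · simpa [hnot z hz, hnot z' hz'] using hj
          · exact hdense.2.trans (hmono _ _ (by omega) (Nat.sub_le _ _))
        subst hAA
        rw [Finset.sum_union (hdisj A hA z hz), Finset.sum_union (hdisj A hA z' hz'),
          add_sub_add_left_eq_sub] at hlt
        have h1 := hS z hz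
        have h2 := hS z' hz'
        simp only [hcellOf] at h1 h2
        have := floor_eq_of_parity hc0 hlt (by rw [h1, h2]; exact heq.2)
        rw [h1, h2] at this
        rw [this])
    simpa using this
  have hcells' : (2 : ℝ) ^ p.m * 𝒞.card ≤ (400 * p.J ^ 2 * p.N / p.G + 1) * 2 := by
    have h1 : (2 : ℝ) ^ p.m * 𝒞.card ≤ (⌊2 * p.J * I k / p.delta I k⌋₊ + 1) * 2 := by
      exact_mod_cast hcells
    have h2 : (⌊2 * p.J * I k / p.delta I k⌋₊ : ℝ) ≤ 2 * p.J * I k / p.delta I k :=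
      Nat.floor_le (by positivity)
    have h3 : 2 * p.J * I k / p.delta I k = 400 * p.J ^ 2 * p.N / p.G := by
      rw [delta, tau_of_dense hdense]
      field_simp
      ring
    rw [h3] at h2
    rw [h3] at h1
    linarith
  have hlist' : (n' : ℝ) ≤ 2 * (𝒞.card : ℝ) ^ 2 := by
    have : (n' : ℝ) ≤ 𝒞.card * (𝒞.card * 2) := by exact_mod_cast hlist
    linarith
  have h4 : (0 : ℝ) < 4 ^ p.m := by positivity
  have h5 : (4 : ℝ) ^ p.m = (2 ^ p.m) ^ 2 := by
    rw [← pow_mul, mul_comm, pow_mul]; norm_num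
  -- The list has at most twice the square of the number of cells, and the cell count carries
  -- another factor `2`; together they give the `8` in `B_ge'`.
  refine le_of_mul_le_mul_right ?_ h4
  refine le_trans ?_ hp.B_ge'
  calc (n' : ℝ) * 4 ^ p.m ≤ 2 * (𝒞.card : ℝ) ^ 2 * 4 ^ p.m := by gcongr
    _ = 2 * (2 ^ p.m * (𝒞.card : ℝ)) ^ 2 := by rw [h5]; ring
    _ ≤ 2 * ((400 * p.J ^ 2 * p.N / p.G + 1) * 2) ^ 2 := by gcongr
    _ = _ := by ring

/-- Unsuccessful searches force the item sizes to decrease geometrically. -/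
theorem decay (hp : p.Valid M q) (hI : ∀ i ≤ k, 0 < I i)
    (hmono : ∀ i j, i ≤ j → j ≤ k → I i ≤ I j)
    (hlam : 1 / (2 * p.N) ≤ lam) (hlam' : lam ≤ 2) (hU : p.Unsuccessful I lam k) (hMk : M ≤ k) :
    I (k - M) < p.G * I k := by
  by_contra! hcon
  have hIk := hI k le_rfl
  have hN := hp.N_pos
  have hG := hp.G_pos
  have htau := tau_pos hp hIk
  obtain ⟨i, n, n', f, f', hi, hi', h, h', hB, hno⟩ := hU
  have hmM := hp.m_le
  -- As `m ≤ M`, a large item at distance `M` forces a large item at distance `m`.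
  have hdense : p.Dense I k := ⟨by omega, hcon.trans (hmono _ _ (by omega) (Nat.sub_le _ _))⟩
  have hex := exhaustive_of_dense hp hI hmono hlam hlam' hi hi' h h' hno hdense
  have hMJ := hp.M_le_J
  -- The second list was not cut off, so the lists cover all `M` items needed for the pigeonhole.
  have hMi : M ≤ i := by
    by_contra hlt
    exact absurd (hB (by omega)) (not_lt.2 hex)
  have hcard : (Finset.range (⌊100 * M * p.N / p.G⌋₊ + 1)).card <
      (Finset.range M).powerset.card := by
    rw [Finset.card_range, Finset.card_powerset, Finset.card_range]
    have h1 : (⌊100 * M * p.N / p.G⌋₊ : ℝ) ≤ 100 * M * p.N / p.G := Nat.floor_le (by positivity)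
    have h2 := hp.pigeon
    have : ((⌊100 * M * p.N / p.G⌋₊ + 1 : ℕ) : ℝ) < (2 ^ M : ℕ) := by
      push_cast
      linarith
    exact_mod_cast this
  obtain ⟨S, hS, S', hS', hne, heq⟩ := Finset.exists_ne_map_eq_of_card_lt_of_maps_to hcard
    (f := fun S => ⌊(∑ j ∈ S, I (k - j)) / p.tau I k⌋₊) (fun S hS => by
      refine Finset.mem_coe.2 (Finset.mem_range.2 (Nat.lt_succ_of_le (Nat.floor_le_floor ?_)))
      have h1 : ∑ j ∈ S, I (k - j) ≤ M * I k := by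
        calc ∑ j ∈ S, I (k - j) ≤ ∑ j ∈ Finset.range M, I (k - j) :=
              Finset.sum_le_sum_of_subset_of_nonneg (Finset.mem_powerset.1 (Finset.mem_coe.1 hS))
                fun j _ _ => (hI _ (Nat.sub_le _ _)).le
          _ ≤ ∑ j ∈ Finset.range M, I k :=
              Finset.sum_le_sum fun j _ => hmono _ _ (Nat.sub_le _ _) le_rfl
          _ = M * I k := by simp
      have h2 : 100 * M * p.N / p.G = M * I k / p.tau I k := by
        rw [tau_of_dense hdense]
        field_simp
      rw [h2]
      gcongr)
  rw [Finset.mem_powerset] at hS hS'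
  have hpos : ∀ T : Finset ℕ, 0 ≤ (∑ j ∈ T, I (k - j)) / p.tau I k := fun T =>
    div_nonneg (Finset.sum_nonneg fun j _ => (hI _ (Nat.sub_le _ _)).le) htau.le
  have hfl : ⌊(∑ j ∈ S, I (k - j)) / p.tau I k⌋ = ⌊(∑ j ∈ S', I (k - j)) / p.tau I k⌋ := by
    rw [← Int.natCast_floor_eq_floor (hpos _), ← Int.natCast_floor_eq_floor (hpos _)]
    exact congrArg _ heq
  have : ∃ j, ¬ (j ∈ S ↔ j ∈ S') := by
    by_contra! hall
    exact hne (Finset.ext hall)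
  obtain ⟨j, hj⟩ := this
  have hjM : j < M := by
    by_contra hcon
    apply hj
    have h1 : j ∉ S := fun h => hcon (Finset.mem_range.1 (hS h))
    have h2 : j ∉ S' := fun h => hcon (Finset.mem_range.1 (hS' h))
    simp [h1, h2]
  have hsub : Finset.range M ⊆ Finset.range i := Finset.range_subset_range.2 hMi
  exact excluded_collision hp hI hlam hlam' hi hi' h h' hno hdense (hS.trans hsub) (hS'.trans hsub)
    hj (hcon.trans (hmono _ _ (by omega) (Nat.sub_le _ _))) (abs_sub_lt_of_floor_eq htau hfl).le

end Params

end SubsetSumRatio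

/-! ### Geometric decay: small tails, the sparse case, the lower bound -/

namespace SubsetSumRatio

namespace Params

variable {p : Params} {M q n : ℕ} {I : ℕ → ℝ} {lam : ℝ} {k : ℕ}

/-- The terms of a sequence that decays geometrically along blocks of length `M` sum up to at most
a multiple of the largest. -/
theorem sum_le_of_decay (hG : p.G ≤ 1 / 2) (hI : ∀ i < n, 0 < I i)
    (hmono : ∀ i j, i ≤ j → j < n → I i ≤ I j)
    (hdecay : ∀ k < n, M ≤ k → I (k - M) < p.G * I k) (hk : k < n) (hM : 0 < M) :
    ∑ i ∈ Finset.range (k + 1), I i ≤ 2 * M * I k := by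
  induction k using Nat.strong_induction_on with
  | _ k ih =>
    have hIk := hI k hk
    have hM' : (0 : ℝ) < M := by exact_mod_cast hM
    by_cases hMk : M ≤ k
    · have h1 := ih (k - M) (by omega) (by omega)
      have h2 := hdecay k hk hMk
      -- The top block contributes at most `M * I k`. The rest is at most `2 * M * I (k - M)`, again
      -- at most `M * I k` because `G ≤ 1 / 2`.
      have h3 : ∑ i ∈ Finset.Ico (k - M + 1) (k + 1), I i ≤ M * I k := by
        calc ∑ i ∈ Finset.Ico (k - M + 1) (k + 1), I i ≤ ∑ i ∈ Finset.Ico (k - M + 1) (k + 1), I k :=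
              Finset.sum_le_sum fun i hi => hmono _ _ (by have := Finset.mem_Ico.1 hi; omega) hk
          _ = M * I k := by
            rw [Finset.sum_const, Nat.card_Ico, nsmul_eq_mul]
            congr 2
            omega
      rw [← Finset.sum_range_add_sum_Ico _ (show k - M + 1 ≤ k + 1 by omega)]
      have h4 : I (k - M) ≤ 1 / 2 * I k := h2.le.trans (by gcongr)
      nlinarith
    · calc ∑ i ∈ Finset.range (k + 1), I i ≤ ∑ i ∈ Finset.range (k + 1), I k :=
            Finset.sum_le_sum fun i hi => hmono _ _ (by have := Finset.mem_range.1 hi; omega) hk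
        _ = (k + 1 : ℕ) * I k := by simp
        _ ≤ M * I k := by
            have : k + 1 ≤ M := by omega
            gcongr
        _ ≤ 2 * M * I k := by nlinarith

theorem pow_decay (hG : 0 < p.G)
    (hdecay : ∀ k < n, M ≤ k → I (k - M) < p.G * I k) (hk : k < n) (j : ℕ) (hj : j * M ≤ k) :
    I (k - j * M) ≤ p.G ^ j * I k := by
  induction j with
  | zero => simp
  | succ j ih =>
    rw [Nat.succ_mul] at hj ⊢
    have h1 := ih (by omega)
    have h2 := hdecay (k - j * M) (by omega) (by omega)
    rw [Nat.sub_sub] at h2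
    rw [pow_succ]
    nlinarith

theorem sum_Ico_rev (I : ℕ → ℝ) (a k : ℕ) :
    ∑ i ∈ Finset.Ico a (k + 1), I (k - i) = ∑ i ∈ Finset.range (k + 1 - a), I i := by
  rw [Finset.sum_Ico_reflect I a le_rfl, Nat.sub_self, Finset.range_eq_Ico]

/-- The items beyond the relevant ones are negligible. -/
theorem tail_le (hp : p.Valid M q) (hI : ∀ i < n, 0 < I i)
    (hmono : ∀ i j, i ≤ j → j < n → I i ≤ I j)
    (hdecay : ∀ k < n, M ≤ k → I (k - M) < p.G * I k) (hk : k < n) :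
    ∑ i ∈ Finset.Ico (min p.J (k + 1)) (k + 1), I (k - i) ≤ p.tau I k / 2 := by
  have hIk := hI k hk
  have hN := hp.N_pos
  have hG := hp.G_pos
  by_cases hJk : p.J ≤ k
  · rw [min_eq_left (by omega), sum_Ico_rev I _ _,
      show k + 1 - p.J = (k - p.J) + 1 by omega]
    have h1 := sum_le_of_decay hp.G_le hI hmono hdecay (k := k - p.J) (by omega) hp.M_pos
    have h2 := pow_decay hG hdecay hk q (by rw [← hp.J_eq]; exact hJk)
    rw [← hp.J_eq] at h2
    refine (h1.trans ?_).trans (div_le_div_of_nonneg_right (le_tau hp hIk) zero_le_two)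
    have h3 : I (k - p.J) ≤ p.G / p.N ^ 2 * I k := h2.trans (by gcongr; exact hp.pow_le)
    have h4 : (M : ℝ) ≤ p.N / 400 := by linarith [hp.N_ge]
    calc 2 * M * I (k - p.J) ≤ 2 * (p.N / 400) * (p.G / p.N ^ 2 * I k) := by
          have := hI (k - p.J) (by omega)
          gcongr
      _ = I k / (100 * p.N) * p.G / 2 := by field_simp; norm_num
  · rw [min_eq_right (by omega)]
    have := tau_pos hp hIk
    simp only [Finset.Ico_self, Finset.sum_empty]
    positivity

/-- Under geometric decay, an unsuccessful search is exhaustive. -/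
theorem exhaustive (hp : p.Valid M q) (hI : ∀ i < n, 0 < I i)
    (hmono : ∀ i j, i ≤ j → j < n → I i ≤ I j)
    (hdecay : ∀ k < n, M ≤ k → I (k - M) < p.G * I k) (hk : k < n)
    {i n' : ℕ} {f' : ℕ → Entry} (hi : min p.m (k + 1) ≤ i) (hi' : i < min p.J (k + 1))
    (h' : Represents (p.delta I k) (fun i => I (k - i)) (min p.m (k + 1)) i n' f')
    (hdense : ¬ p.Dense I k) : (n' : ℝ) ≤ p.B := by
  have hIk := hI k hk
  have hN := hp.N_pos
  have hJ := hp.J_pos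
  have hG := hp.G_pos
  have hM : (0 : ℝ) < M := by exact_mod_cast hp.M_pos
  have hδ := delta_pos hp hIk
  have hmk : p.m ≤ k := by omega
  rw [min_eq_left (by omega)] at h' hi
  have hsmall : I (k - p.m) < p.G * I k := by
    by_contra! hcon
    exact hdense ⟨hmk, hcon⟩
  -- A bound for the sum of all items from the `m`-th on, hence for the absolute value of every
  -- difference in the second list. At most `2 * R / delta + 2` buckets can occur.
  set R := 2 * M * p.G * I k with hR
  have hR0 : 0 ≤ R := by positivity
  have hsum : ∑ j ∈ Finset.Ico p.m i, I (k - j) ≤ R := by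
    calc ∑ j ∈ Finset.Ico p.m i, I (k - j) ≤ ∑ j ∈ Finset.Ico p.m (k + 1), I (k - j) :=
          Finset.sum_le_sum_of_subset_of_nonneg (Finset.Ico_subset_Ico_right (by omega))
            fun j _ _ => (hI _ (by omega)).le
      _ = ∑ j ∈ Finset.range (k - p.m + 1), I j := by
          rw [sum_Ico_rev I _ _, show k + 1 - p.m = k - p.m + 1 by omega]
      _ ≤ 2 * M * I (k - p.m) := sum_le_of_decay hp.G_le hI hmono hdecay (by omega) hp.M_pos
      _ ≤ 2 * M * (p.G * I k) := by gcongr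
      _ = R := by rw [hR]; ring
  have hle : ∀ (d : ℕ → Fin 3) (c : Fin 3),
      ∑ j ∈ Finset.Ico p.m i, (if d j = c then I (k - j) else 0) ≤ R := fun d c => by
    refine (Finset.sum_le_sum fun j _ => ?_).trans hsum
    split_ifs
    · exact le_rfl
    · exact (hI _ (by omega)).le
  have hbd : ∀ j < n', -R ≤ (f' j).diff ∧ (f' j).diff ≤ R := by
    intro j hj
    obtain ⟨d, hd⟩ := h'.sound j hj
    obtain ⟨h1, h2⟩ := patternEntry_nonneg (x := fun i => I (k - i)) (d := d) (a := p.m) (b := i)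
      fun j _ _ => (hI _ (by omega)).le
    have h3 := hle d 1
    have h4 := hle d 2
    rw [hd, Entry.diff]
    simp only [patternEntry] at *
    constructor <;> linarith
  have hcard := Finset.card_le_card_of_injOn (s := Finset.range n')
    (t := Finset.Icc ⌊-R / p.delta I k⌋ ⌊R / p.delta I k⌋)
    (fun j => (f' j).bucket (p.delta I k))
    (fun j hj => by
      have := hbd j (by simpa using hj)
      simp only [Finset.coe_Icc, Set.mem_Icc, Entry.bucket]
      exact ⟨Int.floor_le_floor (by gcongr; exact this.1),
        Int.floor_le_floor (by gcongr; exact this.2)⟩)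
    (fun a ha b hb hab => by
      by_contra hne
      rcases Nat.lt_or_gt_of_ne hne with hlt | hlt
      · exact absurd hab (h'.incr a b hlt (by simpa using hb)).ne
      · exact absurd hab.symm (h'.incr b a hlt (by simpa using ha)).ne)
  rw [Finset.card_range, Int.card_Icc] at hcard
  have h1 : (⌊R / p.delta I k⌋ : ℝ) ≤ R / p.delta I k := Int.floor_le _
  have h2 : -R / p.delta I k - 1 < ⌊-R / p.delta I k⌋ := Int.sub_one_lt_floor _
  have h3 : ⌊-R / p.delta I k⌋ ≤ ⌊R / p.delta I k⌋ :=
    Int.floor_le_floor (by gcongr; linarith)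
  have h4 : ((n' : ℤ) : ℝ) ≤ ((⌊R / p.delta I k⌋ + 1 - ⌊-R / p.delta I k⌋ : ℤ) : ℝ) := by
    have : (n' : ℤ) ≤ ⌊R / p.delta I k⌋ + 1 - ⌊-R / p.delta I k⌋ := by omega
    exact_mod_cast this
  push_cast at h4
  have h5 : R / p.delta I k = 400 * M * p.J * p.N * p.G := by
    rw [delta, tau_of_not_dense hdense, hR]
    field_simp
    ring
  have h6 := hp.B_ge
  rw [neg_div] at h2 h4
  linarith

/-- If all searches are unsuccessful, then no ratio is much less than `1 + lam`. -/
theorem not_good_of_unsuccessful (hp : p.Valid M q) (hI : ∀ i < n, 0 < I i)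
    (hmono : ∀ i j, i ≤ j → j < n → I i ≤ I j)
    (hlam : 1 / (2 * p.N) ≤ lam) (hlam' : lam ≤ 2) (hU : ∀ k < n, p.Unsuccessful I lam k)
    (hk : k < n) (d : ℕ → Fin 3) (hd : d 0 ≠ 0) :
    ¬ ((patternEntry (fun i => I (k - i)) d 0 (k + 1)).sx ≤
        (1 + lam - 1 / (2 * p.N)) * (patternEntry (fun i => I (k - i)) d 0 (k + 1)).sy ∧
      (patternEntry (fun i => I (k - i)) d 0 (k + 1)).sy ≤
        (1 + lam - 1 / (2 * p.N)) * (patternEntry (fun i => I (k - i)) d 0 (k + 1)).sx) := by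
  -- Decay at every position is needed, and therefore the failure of the searches at every position.
  have hdecay : ∀ k < n, M ≤ k → I (k - M) < p.G * I k := fun k hk hMk =>
    decay hp (fun i hi => hI i (by omega)) (fun i j hij hj => hmono i j hij (by omega)) hlam hlam'
      (hU k hk) hMk
  have hIk := hI k hk
  have hN := hp.N_pos
  have htau := tau_pos hp hIk
  have htau' := tau_le hp hIk
  have hη : 0 < 1 / (2 * p.N) := by positivity
  obtain ⟨i, m', n', f, f', hi, hi', h, h', hB, hno⟩ := hU k hk
  have hie : i = min p.J (k + 1) := by
    by_contra hne
    refine absurd (hB (by omega)) (not_lt.2 ?_)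
    by_cases hdense : p.Dense I k
    · exact exhaustive_of_dense hp (fun i hi => hI i (by omega))
        (fun i j hij hj => hmono i j hij (by omega)) hlam hlam' hi hi' h h' hno hdense
    · exact exhaustive hp hI hmono hdecay hk hi (by omega) h' hdense
  have htail := tail_le hp hI hmono hdecay hk
  rw [← hie] at htail
  -- it suffices to treat patterns whose first sum is the larger one
  suffices key : ∀ d : ℕ → Fin 3, d 0 ≠ 0 →
      (patternEntry (fun i => I (k - i)) d 0 (k + 1)).sy ≤
        (patternEntry (fun i => I (k - i)) d 0 (k + 1)).sx →
      (patternEntry (fun i => I (k - i)) d 0 (k + 1)).sx ≤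
        (1 + lam - 1 / (2 * p.N)) * (patternEntry (fun i => I (k - i)) d 0 (k + 1)).sy → False by
    rintro ⟨h1, h2⟩
    rcases le_total (patternEntry (fun i => I (k - i)) d 0 (k + 1)).sy
      (patternEntry (fun i => I (k - i)) d 0 (k + 1)).sx with hs | hs
    · exact key d hd hs h1
    · obtain ⟨w1, w2⟩ := patternEntry_swap (fun i => I (k - i)) d 0 (k + 1)
      refine key (swapPattern d) ?_ (by rwa [w1, w2]) (by rwa [w1, w2])
      simpa [swapPattern] using hd
  intro d hd hs hr
  have htot := le_patternEntry_tot (x := fun i => I (k - i)) (d := d) (a := 0) (b := k + 1) (i := 0)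
    (fun i _ _ => (hI _ (by omega)).le) le_rfl (Nat.succ_pos k) hd
  obtain ⟨a1, a2, -⟩ := patternEntry_append (fun i => I (k - i)) d (Nat.zero_le i)
    (show i ≤ k + 1 by omega)
  obtain ⟨b1, b2⟩ := patternEntry_nonneg (x := fun i => I (k - i)) (d := d) (a := i) (b := k + 1)
    fun i _ _ => (hI _ (by omega)).le
  have hle : ∀ c : Fin 3, ∑ j ∈ Finset.Ico i (k + 1), (if d j = c then I (k - j) else 0) ≤
      p.tau I k / 2 := fun c => by
    refine (Finset.sum_le_sum fun j _ => ?_).trans htail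
    split_ifs
    · exact le_rfl
    · exact (hI _ (by omega)).le
  have c1 : (patternEntry (fun i => I (k - i)) d i (k + 1)).sx ≤ p.tau I k / 2 := hle 1
  have c2 : (patternEntry (fun i => I (k - i)) d i (k + 1)).sy ≤ p.tau I k / 2 := hle 2
  have hlam0 : 0 ≤ lam := hη.le.trans hlam
  simp only [Nat.sub_zero, Entry.tot] at htot
  set X := (patternEntry (fun i => I (k - i)) d 0 (k + 1)).sx
  set Y := (patternEntry (fun i => I (k - i)) d 0 (k + 1)).sy
  have hY0 : 0 ≤ Y := by
    by_contra! hcon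
    have : (1 + lam - 1 / (2 * p.N)) * Y < 0 := mul_neg_of_pos_of_neg (by linarith) hcon
    linarith
  -- Here `X ≤ 3 * Y`, and `X + Y ≥ I k` because the pattern uses the largest item.
  have hY : I k ≤ 4 * Y := by nlinarith
  refine excluded hp hIk hlam0 hlam' hi hi' h h' hno d ?_ ?_
  · simp only [Entry.diff]
    linarith
  · simp only [Entry.slack]
    have e1 : X - (1 + lam) * Y ≤ -(I k / (8 * p.N)) := by
      have : 1 / (2 * p.N) * (I k / 4) ≤ 1 / (2 * p.N) * Y := by gcongr; linarith
      have e : 1 / (2 * p.N) * (I k / 4) = I k / (8 * p.N) := by field_simp; norm_num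
      rw [e] at this
      linarith
    -- The full pattern has slack at most `-12.5 * tau`. Dropping its tail raises this by at most
    -- `1.5 * tau`, which stays below `-5 * tau`.
    have e2 : I k / (8 * p.N) = 12.5 * (I k / (100 * p.N)) := by field_simp; norm_num
    have e3 : (1 + lam) * (patternEntry (fun i => I (k - i)) d i (k + 1)).sy ≤
        3 * (p.tau I k / 2) := by gcongr; linarith
    have e4 : 0 < I k / (100 * p.N) := by positivity
    nlinarith

/-- An accepted pair is a good pair of sets. -/
theorem witness_of_accepts (hp : p.Valid M q) (hI : ∀ i ≤ k, 0 < I i) (hlam : 0 < lam)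
    (hlam' : lam ≤ 2) {i n n' : ℕ} {f f' : ℕ → Entry} (hi : min p.m (k + 1) ≤ i)
    (hi' : i ≤ min p.J (k + 1))
    (h : Represents (p.delta I k) (fun i => I (k - i)) 0 (min p.m (k + 1)) n f)
    (h' : Represents (p.delta I k) (fun i => I (k - i)) (min p.m (k + 1)) i n' f')
    {j j' : ℕ} (hj : j < n) (hj' : j' < n') (ha : Accepts (p.tau I k) lam (f j) (f' j')) :
    p.Witness I lam k ((f j).co + (f' j').co) := by
  obtain ⟨d, hd⟩ := h.sound j hj
  obtain ⟨d', hd'⟩ := h'.sound j' hj'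
  have htau := tau_pos hp (hI k le_rfl)
  set D : ℕ → Fin 3 := fun l => if l < min p.m (k + 1) then d l else if l < i then d' l else 0
    with hD
  obtain ⟨a1, a2, a3⟩ := patternEntry_append (fun i => I (k - i)) D (Nat.zero_le _) hi
  obtain ⟨b1, b2, b3⟩ := patternEntry_append (fun i => I (k - i)) D (Nat.zero_le i) hi'
  have e1 : patternEntry (fun i => I (k - i)) D 0 (min p.m (k + 1)) = f j := by
    rw [hd]
    exact patternEntry_congr _ fun l _ hl => by simp only [hD, if_pos hl]
  have e2 : patternEntry (fun i => I (k - i)) D (min p.m (k + 1)) i = f' j' := by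
    rw [hd']
    exact patternEntry_congr _ fun l hl hl' => by simp only [hD, if_neg (not_lt.2 hl), if_pos hl']
  have e3 : patternEntry (fun i => I (k - i)) D i (min p.J (k + 1)) = ⟨0, 0, 0⟩ := by
    rw [patternEntry_congr (d' := 0) _ fun l hl hl' => by
      simp only [hD, if_neg (not_lt.2 hl), if_neg (not_lt.2 (hi.trans hl)), Pi.zero_apply]]
    simp [patternEntry]
  rw [e1, e2] at a1 a2 a3
  rw [e3] at b1 b2 b3
  simp only [add_zero] at b1 b2 b3
  obtain ⟨n1, n2⟩ := patternEntry_nonneg (x := fun i => I (k - i)) (d := D) (a := 0)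
    (b := min p.J (k + 1)) fun i _ _ => (hI _ (Nat.sub_le _ _)).le
  refine ⟨D, by rw [b3, a3], ?_, ?_⟩
  all_goals
    rw [b1, b2, a1, a2] at *
    obtain ⟨ha1, ha2⟩ := ha
    simp only [Entry.diff, Entry.slack] at ha1 ha2
    nlinarith

end Params

end SubsetSumRatio

/-! ### The main search -/

namespace SubsetSumRatio

open RealRAM

notation "rN" => (3 : ℕ)
notation "rG" => (4 : ℕ)
notation "rB" => (5 : ℕ)
notation "rPow" => (6 : ℕ)
notation "rM" => (7 : ℕ)
notation "rJ" => (8 : ℕ)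
notation "rRounds" => (9 : ℕ)
notation "rRound" => (10 : ℕ)
notation "rLo" => (11 : ℕ)
notation "rHi" => (12 : ℕ)
notation "rWit" => (14 : ℕ)
notation "rWitK" => (15 : ℕ)
notation "rWitCo" => (16 : ℕ)

/-- Set the parameters of the search with largest item at position `rK`. -/
def prepare : Program :=
  rTau ::= cell 0 (reg rK) / (lit 100 * reg rN);;
  .ite (.and (.le (reg rM) (reg rK)) (.le (reg rG * cell 0 (reg rK)) (cell 0 (reg rK - reg rM))))
    (rTau ::= reg rTau * reg rG) .skip;;
  rDelta ::= reg rTau / (lit 2 * reg rJ);;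
  rI ::= lit 0;; rWeight ::= lit 1;; rCap ::= reg rPow;; rEnd ::= reg rK + lit 1;;
  .ite (.lt (reg rM) (reg rEnd)) (rEnd ::= reg rM) .skip

/-- Set the parameters for the second list. -/
def prepare' : Program :=
  rCap ::= reg rB;; rEnd ::= reg rK + lit 1;;
  .ite (.lt (reg rJ) (reg rEnd)) (rEnd ::= reg rJ) .skip

/-- Search for a good pair of sets with largest item at position `rK`. -/
def examine : Program :=
  prepare;; build;; saveList;; prepare';; build;; search

/-- Search for a pair of sets of ratio less than `1 + rLam`. -/
def probe : Program :=
  (rFound ::= lit 0;; rK ::= lit 0);;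
  .loop (.lt (reg rK) (reg rCount)) (examine;; rK ::= reg rK + lit 1)

/-- Binary search for the optimal ratio. -/
def bisect : Program :=
  (rLo ::= lit 1 / (lit 2 * reg rN);; rHi ::= lit 2;; rWit ::= lit 0;; rRound ::= lit 0);;
  .loop (.lt (reg rRound) (reg rRounds))
    (rLam ::= (reg rLo + reg rHi) / lit 2;; probe;;
      (.ite (.lt (lit 0) (reg rFound))
        (rHi ::= reg rLam;; rWit ::= lit 1;; rWitK ::= reg rFoundK;; rWitCo ::= reg rFoundCo)
        (rLo ::= reg rLam);;
      rRound ::= reg rRound + lit 1))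

/-- The items and the parameters are in place. -/
structure Ready (p : Params) (I : ℕ → ℝ) (n : ℕ) (s : State) : Prop where
  items : s.arr 0 = I
  count : s.var rCount = n
  m : s.var rM = p.m
  J : s.var rJ = p.J
  N : s.var rN = p.N
  G : s.var rG = p.G
  B : s.var rB = p.B
  pow : s.var rPow = 3 ^ p.m

theorem Ready.of_frame {p : Params} {I : ℕ → ℝ} {n : ℕ} {s s' : State} {P : Program}
    (h : Ready p I n s) (hf : Frame P s s')
    (hw : ∀ x ∈ [rCount, rM, rJ, rN, rG, rB, rPow], x ∉ P.wv) (ha : 0 ∉ P.wa) :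
    Ready p I n s' where
  items := by rw [hf.2 _ ha, h.items]
  count := by rw [hf.1 _ (hw _ (by decide)), h.count]
  m := by rw [hf.1 _ (hw _ (by decide)), h.m]
  J := by rw [hf.1 _ (hw _ (by decide)), h.J]
  N := by rw [hf.1 _ (hw _ (by decide)), h.N]
  G := by rw [hf.1 _ (hw _ (by decide)), h.G]
  B := by rw [hf.1 _ (hw _ (by decide)), h.B]
  pow := by rw [hf.1 _ (hw _ (by decide)), h.pow]

/-- The size of the lists, up to constants. -/
noncomputable def Params.work (p : Params) : ℝ := p.J * (3 ^ p.m + p.B)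

namespace Params

variable {p : Params} {M q n : ℕ} {I : ℕ → ℝ} {lam : ℝ} {k : ℕ}

theorem Valid.one_le_B (hp : p.Valid M q) : 1 ≤ p.B := by
  have := hp.B_ge
  have := hp.N_pos
  have := hp.G_pos
  have : 0 ≤ 800 * M * p.J * p.N * p.G := by positivity
  linarith

theorem Valid.one_le_work (hp : p.Valid M q) : 1 ≤ p.work := by
  have h1 : (1 : ℝ) ≤ p.J := by exact_mod_cast hp.J_pos
  have h2 := hp.one_le_B
  have h3 : (0 : ℝ) ≤ 3 ^ p.m := by positivity
  unfold work
  nlinarith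

end Params

theorem prepare_spec {p : Params} {I : ℕ → ℝ} {n k : ℕ} {s : State} (h : Ready p I n s)
    (hk : s.var rK = k) :
    Runs prepare s 100 fun s' => s'.var rTau = p.tau I k ∧ s'.var rDelta = p.delta I k ∧
      s'.var rI = (0 : ℕ) ∧ s'.var rWeight = 3 ^ 0 ∧ s'.var rCap = 3 ^ p.m ∧
      s'.var rEnd = (min p.m (k + 1) : ℕ) := by
  apply Runs.of_loopFree rfl
  · have : prepare.bound ≤ 100 := Nat.le_of_ble_eq_true rfl
    exact_mod_cast this
  have hkm : (p.m : ℝ) < k + 1 ↔ p.m < k + 1 := by norm_cast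
  have htau : p.tau I k =
      if p.m ≤ k ∧ p.G * I k ≤ I (k - p.m) then I k / (100 * p.N) * p.G else I k / (100 * p.N) := by
    rfl
  simp only [prepare, Program.run, Test.holds_and, Test.holds_le, Test.holds_lt, Expr.eval_var,
    Expr.eval_read, Expr.eval_mul, Expr.eval_sub, Expr.eval_add, Expr.eval_div, Expr.eval_const,
    State.setVar_var, State.setVar_arr, h.items, h.m, h.N, hk, address_natCast, address_sub,
    Nat.reduceEqDiff, if_false, h.G, Nat.cast_le, Rat.cast_one, Rat.cast_ofNat,
    apply_ite (fun t : State => t.var), if_true, ite_apply]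
  by_cases hA : p.m ≤ k ∧ p.G * I k ≤ I (k - p.m) <;> by_cases hB : p.m < k + 1 <;>
    simp [hA, hB, hkm, Params.delta, htau, h.J, h.pow]
  all_goals
    norm_cast
    omega

theorem prepare'_spec {p : Params} {I : ℕ → ℝ} {n k : ℕ} {s : State} (h : Ready p I n s)
    (hk : s.var rK = k) :
    Runs prepare' s 50 fun s' => s'.var rCap = p.B ∧ s'.var rEnd = (min p.J (k + 1) : ℕ) := by
  apply Runs.of_loopFree rfl
  · have : prepare'.bound ≤ 50 := Nat.le_of_ble_eq_true rfl
    exact_mod_cast this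
  have hkm : (p.J : ℝ) < k + 1 ↔ p.J < k + 1 := by norm_cast
  by_cases hB : p.J < k + 1 <;>
    simp [prepare', Program.run, hB, hkm, h.J, h.B, hk]
  all_goals
    norm_cast
    omega

theorem examine_spec {p : Params} {M q n k : ℕ} {I : ℕ → ℝ} {lam : ℝ} {s : State}
    (hp : p.Valid M q) (hI : ∀ i ≤ k, 0 < I i) (hlam : 0 < lam) (hlam' : lam ≤ 2)
    (h : Ready p I n s) (hk : s.var rK = k) (hsl : s.var rLam = lam) :
    Runs examine s (5000 * p.work) fun s' =>
      (report s' = report s ∧ p.Unsuccessful I lam k) ∨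
      ∃ co, report s' = (1, (k : ℝ), co) ∧ p.Witness I lam k co := by
  have hIk := hI k le_rfl
  have hδ := Params.delta_pos hp hIk
  have hJm := hp.m_le_J
  have hpow : (1 : ℝ) ≤ 3 ^ p.m := one_le_pow₀ (by norm_num)
  have hB := hp.one_le_B
  have hJ1 : (1 : ℝ) ≤ p.J := by exact_mod_cast hp.J_pos
  refine Runs.seq (prepare_spec h hk) ?_ (T' := 5000 * p.work - 100) (by linarith)
  rintro s₁ ⟨htau, hdel, hri, hw, hcap, hend⟩ f₁
  have h₁ := h.of_frame f₁ (by decide) (by decide)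
  have hk₁ : s₁.var rK = k := by rw [f₁.1 _ (by decide), hk]
  refine Runs.seq (T := p.J * (2500 * 3 ^ p.m) + 100) (T' := 5000 * p.work - p.J * (2500 * 3 ^ p.m) - 200)
    ((build_spec hδ hpow (Nat.zero_le _) (fun i _ => hI _ (Nat.sub_le _ _)) h₁.items hk₁ hri hend hw hdel
      hcap).mono ?_ fun _ h => h) ?_ (by linarith)
  · have : ((min p.m (k + 1) - 0 : ℕ) : ℝ) ≤ p.J := by
      have : min p.m (k + 1) - 0 ≤ p.J := by omega
      exact_mod_cast this
    gcongr
  rintro s₂ ⟨i, a, -, hi, -, hlen, hri₂, hw₂, hR, hlong⟩ f₂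
  have ha : (a : ℝ) ≤ 3 ^ p.m := by
    have : a ≤ 3 ^ p.m := hR.card.trans (Nat.pow_le_pow_right (by norm_num) (by omega))
    exact_mod_cast this
  -- A list never has more entries than there are patterns, so the cap `3 ^ m` is never exceeded and
  -- the first list is complete.
  obtain rfl : i = min p.m (k + 1) := by
    by_contra hne
    exact absurd (hlong (by omega)) (not_lt.2 ha)
  refine Runs.seq (T := 100 * 3 ^ p.m + 100)
    (T' := 5000 * p.work - p.J * (2500 * 3 ^ p.m) - 100 * 3 ^ p.m - 300)
    ((saveList_spec hlen).mono (by linarith) fun _ h => h) ?_ (by linarith)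
  rintro s₃ ⟨hsav, hent⟩ f₃
  have h₃ := (h₁.of_frame f₂ (by decide) (by decide)).of_frame f₃ (by decide) (by decide)
  have hk₃ : s₃.var rK = k := by rw [f₃.1 _ (by decide), f₂.1 _ (by decide), hk₁]
  refine Runs.seq (prepare'_spec h₃ hk₃)
    (T' := 5000 * p.work - p.J * (2500 * 3 ^ p.m) - 100 * 3 ^ p.m - 350) ?_ (by linarith)
  rintro s₄ ⟨hcap₄, hend₄⟩ f₄
  have h₄ := h₃.of_frame f₄ (by decide) (by decide)
  have hk₄ : s₄.var rK = k := by rw [f₄.1 _ (by decide), hk₃]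
  -- The second list continues with `rI` and `rWeight` where the first one stopped, so the codes of
  -- a pair can be added.
  refine Runs.seq (T := p.J * (2500 * p.B) + 100) (T' := 5000 * p.work - p.J * (2500 * 3 ^ p.m) -
      100 * 3 ^ p.m - p.J * (2500 * p.B) - 450)
    ((build_spec (i₀ := min p.m (k + 1)) (i₁ := min p.J (k + 1)) hδ hB (by omega)
      (fun i _ => hI _ (Nat.sub_le _ _)) h₄.items hk₄
      (by rw [f₄.1 _ (by decide), f₃.1 _ (by decide), hri₂]) hend₄
      (by rw [f₄.1 _ (by decide), f₃.1 _ (by decide), hw₂])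
      (by rw [f₄.1 _ (by decide), f₃.1 _ (by decide), f₂.1 _ (by decide), hdel]) hcap₄).mono
        ?_ fun _ h => h) ?_ (by linarith)
  · have : ((min p.J (k + 1) - min p.m (k + 1) : ℕ) : ℝ) ≤ p.J := by
      have : min p.J (k + 1) - min p.m (k + 1) ≤ p.J := by omega
      exact_mod_cast this
    gcongr
  rintro s₅ ⟨i, b, hi₀, hi₁, hb, hlen₅, -, -, hR', hlong'⟩ f₅
  have hk₅ : s₅.var rK = k := by rw [f₅.1 _ (by decide), hk₄]
  have hP : ∀ j < a, entries s₅ 8 j = entries s₂ 2 j := fun j hj => by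
    rw [entries_congr (f₅.2 8 (by decide)) (f₅.2 9 (by decide)) (f₅.2 10 (by decide)),
      entries_congr (f₄.2 8 (by decide)) (f₄.2 9 (by decide)) (f₄.2 10 (by decide)), hent j hj]
  have hrep : report s₅ = report s := by
    simp only [report]
    rw [f₅.1 rFound (by decide), f₄.1 rFound (by decide), f₃.1 rFound (by decide),
      f₂.1 rFound (by decide), f₁.1 rFound (by decide),
      f₅.1 rFoundK (by decide), f₄.1 rFoundK (by decide), f₃.1 rFoundK (by decide),
      f₂.1 rFoundK (by decide), f₁.1 rFoundK (by decide),
      f₅.1 rFoundCo (by decide), f₄.1 rFoundCo (by decide), f₃.1 rFoundCo (by decide),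
      f₂.1 rFoundCo (by decide), f₁.1 rFoundCo (by decide)]
  refine (search_spec hδ hR.incr hR'.incr hP (fun _ _ => rfl) hk₅
    (by rw [f₅.1 _ (by decide), f₄.1 _ (by decide), hsav]) hlen₅
    (by rw [f₅.1 _ (by decide), f₄.1 _ (by decide), f₃.1 _ (by decide), f₂.1 _ (by decide), htau])
    (by rw [f₅.1 _ (by decide), f₄.1 _ (by decide), f₃.1 _ (by decide), f₂.1 _ (by decide),
      f₁.1 _ (by decide), hsl])).mono ?_ ?_
  · unfold Params.work
    nlinarith [mul_le_mul hJ1 hpow zero_le_one (by linarith), mul_le_mul hJ1 hB zero_le_one (by linarith)]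
  · rintro s₆ (⟨hrep₆, hno⟩ | ⟨j, hj, j', hj', hacc, hrep₆⟩)
    · exact .inl ⟨hrep₆.trans hrep, i, a, b, _, _, hi₀, hi₁, hR, hR', hlong', hno⟩
    · exact .inr ⟨_, hrep₆, Params.witness_of_accepts hp hI hlam hlam' hi₀ hi₁ hR hR' hj hj' hacc⟩

/-- A failing search leaves the report untouched, so a success survives until the end or is replaced
by a later success. -/
theorem probe_spec {p : Params} {M q n : ℕ} {I : ℕ → ℝ} {lam : ℝ} {s : State}
    (hp : p.Valid M q) (hI : ∀ i < n, 0 < I i) (hlam : 0 < lam) (hlam' : lam ≤ 2)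
    (h : Ready p I n s) (hsl : s.var rLam = lam) :
    Runs probe s (6000 * (n + 1) * p.work) fun s' =>
      (s'.var rFound = 0 ∧ ∀ k < n, p.Unsuccessful I lam k) ∨
      (s'.var rFound = 1 ∧ ∃ k < n, s'.var rFoundK = (k : ℝ) ∧
        p.Witness I lam k (s'.var rFoundCo)) := by
  have hw := hp.one_le_work
  have hn0 : (0 : ℝ) ≤ n := Nat.cast_nonneg n
  refine Runs.seq (T := 10) (T' := 6000 * (n + 1) * p.work - 10)
    (Q := fun s' => s'.var rFound = 0 ∧ s'.var rK = 0) ?_ ?_ (by linarith)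
  · apply Runs.of_loopFree rfl
    · norm_num [Program.bound, Expr.cost]
    · simp [Program.run]
  intro s₀ ⟨hf, hk⟩ f₀
  have h₀ := h.of_frame f₀ (by decide) (by decide)
  refine (Runs.loop (c := 5000 * p.work + 10) (fun v s' => ∃ k : ℕ, v + k = n ∧ s'.var rK = k ∧
      ((s'.var rFound = 0 ∧ ∀ k' < k, p.Unsuccessful I lam k') ∨
      (s'.var rFound = 1 ∧ ∃ k < n, s'.var rFoundK = (k : ℝ) ∧
        p.Witness I lam k (s'.var rFoundCo)))) n (by linarith)
      ⟨0, by omega, by simpa using hk, .inl ⟨hf, by simp⟩⟩ ?_ ?_).mono le_rfl ?_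
  · rintro v s₁ ⟨k, hv, hk, hinv⟩ f₁ hb
    have h₁ := h₀.of_frame f₁ (by decide) (by decide)
    have hkn : k < n := by simpa [hk, h₁.count] using hb
    refine Runs.seq (examine_spec hp (fun i hi => hI i (by omega)) hlam hlam' h₁ hk
      (by rw [f₁.1 _ (by decide), f₀.1 _ (by decide), hsl])) (T' := 10) ?_ le_rfl
    rintro s₂ hcase f₂
    have hk₂ : s₂.var rK = k := by rw [f₂.1 _ (by decide), hk]
    apply Runs.of_loopFree rfl
    · norm_num [Program.bound, Expr.cost, show ∀ e f : Expr, e + f = .add e f from fun _ _ => rfl]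
    refine ⟨v - 1, by omega, k + 1, by omega, by simp [Program.run, hk₂], ?_⟩
    simp only [Program.run, State.setVar_var, Nat.reduceEqDiff, if_false]
    rcases hcase with ⟨hrep, hU⟩ | ⟨co, hrep, hW⟩
    · simp only [report, Prod.mk.injEq] at hrep
      rw [hrep.1, hrep.2.1, hrep.2.2]
      rcases hinv with ⟨hf, hall⟩ | hfound
      · refine .inl ⟨hf, fun k' hk' => ?_⟩
        rcases (Nat.lt_succ_iff.1 hk').eq_or_lt with rfl | hlt
        · exact hU
        · exact hall k' hlt
      · exact .inr hfound
    · simp only [report, Prod.mk.injEq] at hrep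
      rw [hrep.1, hrep.2.1, hrep.2.2]
      exact .inr ⟨rfl, k, hkn, rfl, hW⟩
  · norm_num [Test.cost, Expr.cost]
    nlinarith
  · rintro s₁ ⟨⟨v, k, hv, hk, hinv⟩, hb, f₁⟩
    have h₁ := h₀.of_frame f₁ (by decide) (by decide)
    have hkn : n ≤ k := by simpa [hk, h₁.count] using hb
    obtain rfl : k = n := by omega
    exact hinv

/-- An endpoint carries information only if it was itself tested: a failure at `lo`, a witness at
`hi`. The outcome of a probe need not be monotone in `lam`. -/
theorem bisect_spec {p : Params} {M q n T : ℕ} {I : ℕ → ℝ} {s : State}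
    (hp : p.Valid M q) (hN : 1 ≤ p.N) (hI : ∀ i < n, 0 < I i)
    (h : Ready p I n s) (hT : s.var rRounds = T) :
    Runs bisect s (7000 * (T + 1) * (n + 1) * p.work) fun s' => ∃ lo hi : ℝ,
      1 / (2 * p.N) ≤ lo ∧ lo ≤ hi ∧ hi ≤ 2 ∧ hi - lo ≤ 2 / 2 ^ T ∧
      (lo = 1 / (2 * p.N) ∨ ∀ k < n, p.Unsuccessful I lo k) ∧
      ((s'.var rWit = 0 ∧ hi = 2) ∨ (s'.var rWit = 1 ∧ ∃ k < n, s'.var rWitK = (k : ℝ) ∧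
        p.Witness I hi k (s'.var rWitCo))) := by
  have hw := hp.one_le_work
  have hn0 : (0 : ℝ) ≤ n := Nat.cast_nonneg n
  have hT0 : (0 : ℝ) ≤ T := Nat.cast_nonneg T
  have hN0 : 0 < 1 / (2 * p.N) := by positivity
  have hN2 : 1 / (2 * p.N) ≤ 2 := by
    rw [div_le_iff₀ (by positivity)]
    linarith
  have hnw : 1 ≤ (n + 1) * p.work := by nlinarith
  refine Runs.seq (T := 30) (T' := 7000 * (T + 1) * (n + 1) * p.work - 30)
    (Q := fun s' => s'.var rLo = 1 / (2 * p.N) ∧ s'.var rHi = 2 ∧ s'.var rWit = 0 ∧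
      s'.var rRound = 0) ?_ ?_ (by linarith)
  · apply Runs.of_loopFree rfl
    · norm_num [Program.bound, Expr.cost, show ∀ e f : Expr, e * f = .mul e f from fun _ _ => rfl,
        show ∀ e f : Expr, e / f = .div e f from fun _ _ => rfl]
    · simp [Program.run, h.N]
  rintro s₀ ⟨hlo, hhi, hwit, hround⟩ f₀
  have h₀ := h.of_frame f₀ (by decide) (by decide)
  have hT₀ : s₀.var rRounds = T := by rw [f₀.1 _ (by decide), hT]
  refine (Runs.loop (c := 6000 * (n + 1) * p.work + 60) (fun v s' => ∃ (c : ℕ) (lo hi : ℝ), v + c = T ∧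
      s'.var rRound = c ∧ s'.var rLo = lo ∧ s'.var rHi = hi ∧
      1 / (2 * p.N) ≤ lo ∧ lo ≤ hi ∧ hi ≤ 2 ∧ hi - lo ≤ 2 / 2 ^ c ∧
      (lo = 1 / (2 * p.N) ∨ ∀ k < n, p.Unsuccessful I lo k) ∧
      ((s'.var rWit = 0 ∧ hi = 2) ∨ (s'.var rWit = 1 ∧ ∃ k < n, s'.var rWitK = (k : ℝ) ∧
        p.Witness I hi k (s'.var rWitCo)))) T (by nlinarith)
      ⟨0, _, _, by omega, by simpa using hround, hlo, hhi, le_rfl, hN2, le_rfl,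
        by simp only [pow_zero]; linarith, .inl rfl, .inl ⟨hwit, rfl⟩⟩ ?_ ?_).mono le_rfl ?_
  · rintro v s₁ ⟨c, lo, hi, hv, hc, hlo, hhi, hlo1, hlohi, hhi2, hwidth, hL, hH⟩ f₁ hb
    have h₁ := h₀.of_frame f₁ (by decide) (by decide)
    have hT₁ : s₁.var rRounds = T := by rw [f₁.1 _ (by decide), hT₀]
    have hcT : c < T := by simpa [hc, hT₁] using hb
    refine Runs.seq (T := 10) (T' := 6000 * (n + 1) * p.work + 50)
      (Q := fun s' => s'.var rLam = (lo + hi) / 2) ?_ ?_ (by linarith)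
    · apply Runs.of_loopFree rfl
      · norm_num [Program.bound, Expr.cost, show ∀ e f : Expr, e + f = .add e f from fun _ _ => rfl,
          show ∀ e f : Expr, e / f = .div e f from fun _ _ => rfl]
      · simp [Program.run, hlo, hhi]
    rintro s₂ hlam f₂
    have h₂ := h₁.of_frame f₂ (by decide) (by decide)
    refine Runs.seq (probe_spec hp hI (by linarith) (by linarith) h₂ hlam) (T' := 50) ?_ le_rfl
    rintro s₃ hcase f₃
    have hlo₃ : s₃.var rLo = lo := by rw [f₃.1 _ (by decide), f₂.1 _ (by decide), hlo]
    have hhi₃ : s₃.var rHi = hi := by rw [f₃.1 _ (by decide), f₂.1 _ (by decide), hhi]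
    have hc₃ : s₃.var rRound = c := by rw [f₃.1 _ (by decide), f₂.1 _ (by decide), hc]
    have hwit₃ : s₃.var rWit = s₁.var rWit := by rw [f₃.1 _ (by decide), f₂.1 _ (by decide)]
    have hwitK₃ : s₃.var rWitK = s₁.var rWitK := by rw [f₃.1 _ (by decide), f₂.1 _ (by decide)]
    have hwitCo₃ : s₃.var rWitCo = s₁.var rWitCo := by
      rw [f₃.1 _ (by decide), f₂.1 _ (by decide)]
    have hlam₃ : s₃.var rLam = (lo + hi) / 2 := by rw [f₃.1 _ (by decide), hlam]
    have hhalf : (hi - lo) / 2 ≤ 2 / 2 ^ (c + 1) := by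
      rw [pow_succ, ← div_div]
      linarith
    apply Runs.of_loopFree rfl
    · norm_num [Program.bound, Expr.cost, Test.cost,
        show ∀ e f : Expr, e + f = .add e f from fun _ _ => rfl]
    simp only [Program.run, Test.holds_lt, Expr.eval_const, Expr.eval_var, Expr.eval_add,
      Rat.cast_zero, Rat.cast_one]
    rcases hcase with ⟨hf, hU⟩ | ⟨hf, k, hk, hfk, hW⟩
    · rw [if_neg (by rw [hf]; exact lt_irrefl _)]
      refine ⟨v - 1, by omega, c + 1, (lo + hi) / 2, hi, by omega, by simp [hc₃], by simp [hlam₃],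
        by simp [hhi₃], by linarith, by linarith, hhi2, by linarith, .inr hU, ?_⟩
      simpa [hwit₃, hwitK₃, hwitCo₃] using hH
    · rw [if_pos (by rw [hf]; exact one_pos)]
      refine ⟨v - 1, by omega, c + 1, lo, (lo + hi) / 2, by omega, by simp [hc₃], by simp [hlo₃],
        by simp [hlam₃], by linarith, by linarith, by linarith, by linarith, hL,
        .inr ⟨by simp, k, hk, by simp [hfk], by simpa using hW⟩⟩
  · norm_num [Test.cost, Expr.cost]
    have h1 : (T : ℝ) * 1 ≤ T * ((n + 1) * p.work) := by gcongr
    nlinarith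
  · rintro s₁ ⟨⟨v, c, lo, hi, hv, hc, hlo, hhi, hlo1, hlohi, hhi2, hwidth, hL, hH⟩, hb, f₁⟩
    have hT₁ : s₁.var rRounds = T := by rw [f₁.1 _ (by decide), hT₀]
    have hcT : T ≤ c := by simpa [hc, hT₁] using hb
    obtain rfl : c = T := by omega
    exact ⟨lo, hi, hlo1, hlohi, hhi2, hwidth, hL, hH⟩

end SubsetSumRatio

/-! ### Setting up the parameters and writing the output -/

namespace SubsetSumRatio

open RealRAM

notation "rEps" => (1 : ℕ)
notation "rSteps" => (2 : ℕ)
notation "rDigit" => (43 : ℕ)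
notation "rSum" => (44 : ℕ)
notation "rRatio" => (45 : ℕ)

/-- The growth rates of the parameters. -/
structure Rates where
  h : ℕ
  m : ℕ
  g : ℕ
  b : ℕ
  J : ℕ
  c : ℕ

/-- The parameters after `r` steps. -/
noncomputable def Rates.params (R : Rates) (r : ℕ) : Params where
  m := R.m * r
  J := R.J * r
  N := (2 ^ R.h) ^ r
  G := (1 / 2 ^ R.g) ^ r
  B := (2 ^ R.b) ^ r * (R.c * (R.J * r : ℕ) ^ 4)

/-- Compute the parameters from `ε`. -/
def setup (R : Rates) : Program :=
  (rN ::= lit 1;; rG ::= lit 1;; rB ::= lit 1;; rPow ::= lit 1;; rSteps ::= lit 0);;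
  .loop (.lt (reg rN * reg rEps) (lit 1))
    (rN ::= reg rN * lit (2 ^ R.h);; rG ::= reg rG * lit (1 / 2 ^ R.g);;
      rB ::= reg rB * lit (2 ^ R.b);; rPow ::= reg rPow * lit (3 ^ R.m);;
      rSteps ::= reg rSteps + lit 1);;
  (rM ::= lit R.m * reg rSteps;; rJ ::= lit R.J * reg rSteps;;
    rRounds ::= lit R.h * reg rSteps + lit 4;;
    rB ::= reg rB * (lit R.c * (reg rJ * reg rJ * (reg rJ * reg rJ))))

/-- Write the sets encoded in the witness. -/
def decode : Program :=
  (rI ::= lit 0;; rCo ::= reg rWitCo;; rEnd ::= reg rWitK + lit 1;;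
    .ite (.lt (reg rJ) (reg rEnd)) (rEnd ::= reg rJ) .skip);;
  .loop (.lt (reg rI) (reg rEnd))
    (rDigit ::= reg rCo - lit 3 * .floor (reg rCo / lit 3);;
      .ite (.lt (lit 1) (reg rDigit)) (.write 1 (reg rWitK - reg rI) (lit (-1)))
        (.write 1 (reg rWitK - reg rI) (reg rDigit));;
      rCo ::= .floor (reg rCo / lit 3);; rI ::= reg rI + lit 1)

/-- Choose one item against all smaller ones, in the best way. -/
def greedy : Program :=
  (rSum ::= cell 0 (lit 0);; rWitK ::= lit 1;; rRatio ::= cell 0 (lit 1) / cell 0 (lit 0);;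
    rK ::= lit 1);;
  .loop (.lt (reg rK) (reg rCount))
    (.ite (.lt (cell 0 (reg rK) / reg rSum) (reg rRatio))
      (rRatio ::= cell 0 (reg rK) / reg rSum;; rWitK ::= reg rK) .skip;;
      rSum ::= reg rSum + cell 0 (reg rK);; rK ::= reg rK + lit 1);;
  (.write 1 (reg rWitK) (lit 1);; rI ::= lit 0);;
  .loop (.lt (reg rI) (reg rWitK)) (.write 1 (reg rI) (lit (-1));; rI ::= reg rI + lit 1)

/-- The algorithm. -/
def algorithm (R : Rates) : Program :=
  setup R;; bisect;; .ite (.lt (lit 0) (reg rWit)) decode greedy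

/-- The number `r` is least with `N * ε ≥ 1`. Minimality bounds `N` by `2 ^ h / ε`, which later
converts powers of `N` into powers of `1 / ε`. -/
theorem setup_spec (R : Rates) (hR : 0 < R.h) {s : State} {I : ℕ → ℝ} {n : ℕ} {ε : ℝ}
    (hI : s.arr 0 = I) (hn : s.var rCount = n) (hs : s.var rEps = ε) (hε : 0 < ε) (hε' : ε < 1) :
    ∃ r : ℕ, 0 < r ∧ 1 ≤ (R.params r).N * ε ∧ (R.params r).N * ε ≤ 2 ^ R.h ∧
      Runs (setup R) s (100 * r + 100) fun s' =>
        Ready (R.params r) I n s' ∧ s'.var rRounds = (R.h * r + 4 : ℕ) := by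
  classical
  have h2 : (1 : ℝ) < 2 ^ R.h := one_lt_pow₀ (by norm_num) hR.ne'
  have hex : ∃ r : ℕ, 1 ≤ ((2 : ℝ) ^ R.h) ^ r * ε := by
    obtain ⟨r, hr⟩ := pow_unbounded_of_one_lt (1 / ε) h2
    exact ⟨r, by rw [div_lt_iff₀ hε] at hr; exact hr.le⟩
  obtain ⟨r, hr, hmin⟩ : ∃ r : ℕ, 1 ≤ ((2 : ℝ) ^ R.h) ^ r * ε ∧
      ∀ r' < r, ((2 : ℝ) ^ R.h) ^ r' * ε < 1 :=
    ⟨Nat.find hex, Nat.find_spec hex, fun r' h => not_le.1 (Nat.find_min hex h)⟩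
  have hr0 : 0 < r := by
    rcases Nat.eq_zero_or_pos r with rfl | h
    · simp only [pow_zero, one_mul] at hr
      linarith
    · exact h
  refine ⟨r, hr0, hr, ?_, ?_⟩
  · have h3 := hmin (r - 1) (by omega)
    have h4 : ((2 : ℝ) ^ R.h) ^ r = 2 ^ R.h * (2 ^ R.h) ^ (r - 1) := by
      rw [← pow_succ', Nat.sub_add_cancel hr0]
    simp only [Rates.params, h4]
    nlinarith
  have hr' : (0 : ℝ) ≤ r := Nat.cast_nonneg r
  refine Runs.seq (T := 20) (T' := 100 * r + 80) (Q := fun s' => s'.var rN = 1 ∧ s'.var rG = 1 ∧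
    s'.var rB = 1 ∧ s'.var rPow = 1 ∧ s'.var rSteps = 0) ?_ ?_ (by linarith)
  · apply Runs.of_loopFree rfl
    · norm_num [Program.bound, Expr.cost]
    · simp [Program.run]
  rintro s₀ ⟨h1, h2, h3, h4, h5⟩ f₀
  refine Runs.seq (T := 100 * r + 20) (T' := 60)
    (Q := fun s' => (∃ v c : ℕ, v + c = r ∧ s'.var rN = (2 ^ R.h) ^ c ∧
      s'.var rG = (1 / 2 ^ R.g) ^ c ∧ s'.var rB = (2 ^ R.b) ^ c ∧ s'.var rPow = (3 ^ R.m) ^ c ∧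
      s'.var rSteps = c) ∧ ¬ (Test.lt (reg rN * reg rEps) (lit 1)).Holds s' ∧ _)
    (Runs.loop (c := 60) (fun v s' => ∃ c : ℕ, v + c = r ∧ s'.var rN = (2 ^ R.h) ^ c ∧
      s'.var rG = (1 / 2 ^ R.g) ^ c ∧ s'.var rB = (2 ^ R.b) ^ c ∧ s'.var rPow = (3 ^ R.m) ^ c ∧
      s'.var rSteps = c) r (by norm_num)
      ⟨0, by omega, by simpa using h1, by simpa using h2, by simpa using h3, by simpa using h4,
        by simpa using h5⟩ ?_ ?_) ?_ (by linarith)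
  · rintro v s₁ ⟨c, hv, h1, h2, h3, h4, h5⟩ f₁ hb
    have heps : s₁.var rEps = ε := by rw [f₁.1 _ (by simp [Program.wv]), f₀.1 _ (by decide), hs]
    have hcr : c < r := by
      by_contra hcon
      obtain rfl : c = r := by omega
      simp only [Test.holds_lt, Expr.eval_mul, Expr.eval_var, Expr.eval_const, h1, heps,
        Rat.cast_one] at hb
      linarith
    apply Runs.of_loopFree rfl
    · norm_num [Program.bound, Expr.cost, show ∀ e f : Expr, e + f = .add e f from fun _ _ => rfl,
        show ∀ e f : Expr, e * f = .mul e f from fun _ _ => rfl]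
    refine ⟨v - 1, by omega, c + 1, by omega, ?_⟩
    simp only [Program.run, State.setVar_var, Expr.eval_mul, Expr.eval_var, Expr.eval_const,
      Expr.eval_add, Nat.reduceEqDiff, if_true, if_false, h1, h2, h3, h4, h5, pow_succ,
      Rat.cast_pow, Rat.cast_div, Rat.cast_one, Rat.cast_ofNat, Nat.cast_add, Nat.cast_one, and_self]
  · norm_num [Test.cost, Expr.cost, show ∀ e f : Expr, e * f = .mul e f from fun _ _ => rfl]
    linarith
  · rintro s₁ ⟨⟨v, c, hv, h1, h2, h3, h4, h5⟩, hb, f₁⟩ -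
    have heps : s₁.var rEps = ε := by rw [f₁.1 _ (by simp [Program.wv]), f₀.1 _ (by decide), hs]
    obtain rfl : c = r := by
      by_contra hne
      apply hb
      simp only [Test.holds_lt, Expr.eval_mul, Expr.eval_var, Expr.eval_const, h1, heps,
        Rat.cast_one]
      exact hmin c (by omega)
    apply Runs.of_loopFree rfl
    · norm_num [Program.bound, Expr.cost, show ∀ e f : Expr, e + f = .add e f from fun _ _ => rfl,
        show ∀ e f : Expr, e * f = .mul e f from fun _ _ => rfl]
    refine ⟨⟨?_, ?_, ?_, ?_, ?_, ?_, ?_, ?_⟩, ?_⟩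
    · simp [Program.run, f₁.2 0 (by simp [Program.wa]), f₀.2 0 (by decide), hI]
    · simp [Program.run, f₁.1 rCount (by simp [Program.wv]), f₀.1 rCount (by decide), hn]
    · simp [Program.run, h5, Rates.params]
    · simp [Program.run, h5, Rates.params]
    · simp [Program.run, h1, Rates.params]
    · simp [Program.run, h2, Rates.params]
    · simp only [Program.run, State.setVar_var, Expr.eval_mul, Expr.eval_var, Expr.eval_const,
        Nat.reduceEqDiff, if_true, if_false, h3, h5, Rates.params, Nat.cast_mul, Rat.cast_natCast]
      ring
    · simp [Program.run, h4, Rates.params, pow_mul]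
    · simp [Program.run, h5]

/-- The output value of a position of a pattern. -/
def mark (c : Fin 3) : ℝ := if c = 1 then 1 else if c = 2 then -1 else 0

/-- The code of the positions `i ≤ j < e`. -/
def codeFrom (d : ℕ → Fin 3) (e i : ℕ) : ℕ := ∑ j ∈ Finset.Ico i e, (d j : ℕ) * 3 ^ (j - i)

theorem codeFrom_eq (d : ℕ → Fin 3) {e i : ℕ} (h : i < e) :
    codeFrom d e i = d i + 3 * codeFrom d e (i + 1) := by
  rw [codeFrom, Finset.sum_eq_sum_Ico_succ_bot h, codeFrom, Finset.mul_sum]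
  simp only [Nat.sub_self, pow_zero, mul_one]
  congr 1
  refine Finset.sum_congr rfl fun j hj => ?_
  rw [show j - i = (j - (i + 1)) + 1 by have := Finset.mem_Ico.1 hj; omega, pow_succ]
  ring

theorem floor_codeFrom (d : ℕ → Fin 3) {e i : ℕ} (h : i < e) :
    ⌊(codeFrom d e i : ℝ) / 3⌋ = (codeFrom d e (i + 1) : ℤ) := by
  rw [codeFrom_eq d h, Int.floor_eq_iff]
  have h1 : ((d i : ℕ) : ℝ) ≤ 2 := by exact_mod_cast (show (d i : ℕ) ≤ 2 by omega)
  have h2 : (0 : ℝ) ≤ (d i : ℕ) := Nat.cast_nonneg _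
  push_cast
  constructor <;> linarith

/-- Ternary digit `i` of the code belongs to the item at position `k - i`. Positions that are never
visited keep their initial `0`. -/
theorem decode_spec {s : State} {p : Params} {I : ℕ → ℝ} {n k : ℕ} {d : ℕ → Fin 3}
    (h : Ready p I n s) (hk : s.var rWitK = k)
    (hco : (patternEntry (fun i => I (k - i)) d 0 (min p.J (k + 1))).co = s.var rWitCo)
    (hout : ∀ a, s.arr 1 a = 0) :
    Runs decode s (100 * p.J + 100) fun s' => ∀ a, s'.arr 1 a =
      if a ≤ k ∧ k - a < min p.J (k + 1) then mark (d (k - a)) else 0 := by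
  set e := min p.J (k + 1) with he
  have hJ0 : (0 : ℝ) ≤ p.J := Nat.cast_nonneg _
  refine Runs.seq (T := 30) (T' := 100 * p.J + 70) (Q := fun s' => s'.var rI = 0 ∧
    s'.var rCo = codeFrom d e 0 ∧ s'.var rEnd = e) ?_ ?_ (by linarith)
  · apply Runs.of_loopFree rfl
    · norm_num [Program.bound, Expr.cost, Test.cost,
        show ∀ e f : Expr, e + f = .add e f from fun _ _ => rfl]
    have hkm : (p.J : ℝ) < k + 1 ↔ p.J < k + 1 := by norm_cast
    have hco' : s.var rWitCo = codeFrom d e 0 := by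
      rw [← hco]
      simp [patternEntry, codeFrom]
    by_cases hB : p.J < k + 1
    · have : e = p.J := by omega
      simp [Program.run, hkm, hB, h.J, hk, hco', this]
    · have : e = k + 1 := by omega
      simp [Program.run, hkm, hB, h.J, hk, hco', this]
  rintro s₀ ⟨hi, hc, hend⟩ f₀
  refine (Runs.loop (c := 60) (fun v s' => ∃ i : ℕ, v + i = e ∧ s'.var rI = i ∧
      s'.var rCo = codeFrom d e i ∧ ∀ a, s'.arr 1 a =
        if a ≤ k ∧ k - a < i then mark (d (k - a)) else 0) e (by norm_num)
      ⟨0, by omega, by simpa using hi, hc, fun a => by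
        rw [f₀.2 1 (by decide), hout]; simp⟩ ?_ ?_).mono le_rfl ?_
  · rintro v s₁ ⟨i, hv, hi, hc, ha⟩ f₁ hb
    have hend₁ : s₁.var rEnd = e := by rw [f₁.1 _ (by decide), hend]
    have hk₁ : s₁.var rWitK = k := by rw [f₁.1 _ (by decide), f₀.1 _ (by decide), hk]
    have hie : i < e := by simpa [hi, hend₁] using hb
    have hdig : (codeFrom d e i : ℝ) - 3 * (codeFrom d e (i + 1) : ℝ) = (d i : ℕ) := by
      rw [codeFrom_eq d hie]
      push_cast
      ring
    have hfl := floor_codeFrom d hie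
    apply Runs.of_loopFree rfl
    · norm_num [Program.bound, Expr.cost, Test.cost,
        show ∀ e f : Expr, e + f = .add e f from fun _ _ => rfl,
        show ∀ e f : Expr, e * f = .mul e f from fun _ _ => rfl,
        show ∀ e f : Expr, e / f = .div e f from fun _ _ => rfl,
        show ∀ e f : Expr, e - f = .sub e f from fun _ _ => rfl]
    have hstep : ∀ (t : State), t.arr 1 = Function.update (s₁.arr 1) (k - i) (mark (d i)) →
        ∀ a, t.arr 1 a = if a ≤ k ∧ k - a < i + 1 then mark (d (k - a)) else 0 := by
      intro t ht a
      rw [ht, Function.update_apply]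
      by_cases hai : a = k - i
      · have : k - a = i := by omega
        rw [if_pos hai, if_pos (by omega), this]
      · rw [if_neg hai, ha]
        congr 1
        apply propext
        omega
    refine ⟨v - 1, by omega, i + 1, by omega, ?_, ?_, hstep _ ?_⟩
    · by_cases hone : (1 : ℝ) < (d i : ℕ) <;>
        simp [Program.run, hi, hc, hfl, hdig, hone]
    · by_cases hone : (1 : ℝ) < (d i : ℕ) <;>
        simp [Program.run, hc, hfl, hdig, hone]
    · by_cases hone : (1 : ℝ) < (d i : ℕ)
      · have hd : d i = 2 := by
          have : 1 < (d i : ℕ) := by exact_mod_cast hone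
          omega
        funext a
        simp [Program.run, hc, hfl, hdig, hi, hk₁, address_sub, Function.update_apply, mark, hd]
      · have hd : d i = 0 ∨ d i = 1 := by
          have : ¬ 1 < (d i : ℕ) := by exact_mod_cast hone
          omega
        funext a
        rcases hd with hd | hd <;>
          simp [Program.run, hc, hfl, hdig, hi, hk₁, address_sub, Function.update_apply, mark, hd,
            not_lt.2 (zero_le_one' ℝ)]
  · norm_num [Test.cost, Expr.cost]
    have : (e : ℝ) ≤ p.J := by exact_mod_cast (show e ≤ p.J by omega)
    linarith
  · rintro s₁ ⟨⟨v, i, hv, hi, hc, ha⟩, hb, f₁⟩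
    have hend₁ : s₁.var rEnd = e := by rw [f₁.1 _ (by decide), hend]
    have hie : e ≤ i := by simpa [hi, hend₁] using hb
    obtain rfl : i = e := by omega
    exact ha

theorem greedy_spec {s : State} {p : Params} {I : ℕ → ℝ} {n : ℕ} (hn : 2 ≤ n)
    (h : Ready p I n s) (hout : ∀ a, s.arr 1 a = 0) :
    Runs greedy s (200 * n + 200) fun s' => ∃ k, 1 ≤ k ∧ k < n ∧
      (∀ j, 1 ≤ j → j < n → I k / ∑ i ∈ Finset.range k, I i ≤ I j / ∑ i ∈ Finset.range j, I i) ∧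
      ∀ a, s'.arr 1 a = if a = k then 1 else if a < k then -1 else 0 := by
  have hn0 : (0 : ℝ) ≤ n := Nat.cast_nonneg n
  refine Runs.seq (T := 30) (T' := 200 * n + 170) (Q := fun s' => s'.var rSum = I 0 ∧
    s'.var rWitK = 1 ∧ s'.var rRatio = I 1 / I 0 ∧ s'.var rK = 1) ?_ ?_ (by linarith)
  · apply Runs.of_loopFree rfl
    · norm_num [Program.bound, Expr.cost, show ∀ e f : Expr, e / f = .div e f from fun _ _ => rfl]
    · have : address 1 = 1 := by simpa using address_natCast 1
      simp [Program.run, h.items, this]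
  rintro s₀ ⟨h1, h2, h3, h4⟩ f₀
  have h₀ := h.of_frame f₀ (by decide) (by decide)
  refine Runs.seq (T := 100 * n + 70) (T' := 100 * n + 100) (Q := fun s' => s'.arr 1 = s₀.arr 1 ∧
      ∃ k, 1 ≤ k ∧ k < n ∧ s'.var rWitK = k ∧
      ∀ j, 1 ≤ j → j < n → I k / ∑ i ∈ Finset.range k, I i ≤ I j / ∑ i ∈ Finset.range j, I i)
    -- The exceptional case is the start, where candidate `1` is recorded before the loop has
    -- processed it.
    ((Runs.loop (c := 60) (fun v s' => ∃ c k : ℕ, v + c = n ∧ 1 ≤ c ∧ 1 ≤ k ∧ (k < c ∨ c = 1 ∧ k = 1) ∧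
      s'.var rK = c ∧ s'.var rSum = ∑ i ∈ Finset.range c, I i ∧ s'.var rWitK = k ∧
      s'.var rRatio = I k / ∑ i ∈ Finset.range k, I i ∧
      ∀ j, 1 ≤ j → j < c → I k / ∑ i ∈ Finset.range k, I i ≤ I j / ∑ i ∈ Finset.range j, I i)
      (n - 1) (by norm_num) ⟨1, 1, by omega, le_rfl, le_rfl, .inr ⟨rfl, rfl⟩, by simpa using h4,
        by simpa using h1, by simpa using h2, by simpa using h3, fun j hj hj' => by omega⟩
      ?_ ?_).mono le_rfl ?_) ?_ (by linarith)
  · rintro v s₁ ⟨c, k, hv, hc1, hk1, hkc, hc, hsum, hk, hrat, hmin⟩ f₁ hb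
    have h₁ := h₀.of_frame f₁ (by decide) (by decide)
    have hcn : c < n := by simpa [hc, h₁.count] using hb
    apply Runs.of_loopFree rfl
    · norm_num [Program.bound, Expr.cost, Test.cost,
        show ∀ e f : Expr, e + f = .add e f from fun _ _ => rfl,
        show ∀ e f : Expr, e / f = .div e f from fun _ _ => rfl]
    by_cases hlt : I c / ∑ i ∈ Finset.range c, I i < I k / ∑ i ∈ Finset.range k, I i
    · refine ⟨v - 1, by omega, c + 1, c, by omega, by omega, by omega, .inl (by omega), ?_, ?_, ?_,
        ?_, ?_⟩
      · simp [Program.run, hc, hsum, hrat, h₁.items, hlt]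
      · simp [Program.run, hc, hsum, hrat, h₁.items, hlt, Finset.sum_range_succ]
      · simp [Program.run, hc, hsum, hrat, h₁.items, hlt]
      · simp [Program.run, hc, hsum, hrat, h₁.items, hlt]
      · intro j hj hj'
        rcases (Nat.lt_succ_iff.1 hj').eq_or_lt with rfl | hj'
        · exact le_rfl
        · exact hlt.le.trans (hmin j hj hj')
    · refine ⟨v - 1, by omega, c + 1, k, by omega, by omega, hk1, .inl (by omega), ?_, ?_, ?_, ?_, ?_⟩
      · simp [Program.run, hc, hsum, hrat, h₁.items, hlt]
      · simp [Program.run, hc, hsum, hrat, h₁.items, hlt, Finset.sum_range_succ]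
      · simp [Program.run, hc, hsum, hrat, h₁.items, hlt, hk]
      · simp [Program.run, hc, hsum, hrat, h₁.items, hlt]
      · intro j hj hj'
        rcases (Nat.lt_succ_iff.1 hj').eq_or_lt with rfl | hj'
        · exact not_lt.1 hlt
        · exact hmin j hj hj'
  · norm_num [Test.cost, Expr.cost]
    have : ((n - 1 : ℕ) : ℝ) ≤ n := by exact_mod_cast Nat.sub_le n 1
    linarith
  · rintro s₁ ⟨⟨v, c, k, hv, hc1, hk1, hkc, hc, hsum, hk, hrat, hmin⟩, hb, f₁⟩
    have h₁ := h₀.of_frame f₁ (by decide) (by decide)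
    have hcn : n ≤ c := by simpa [hc, h₁.count] using hb
    obtain rfl : c = n := by omega
    exact ⟨f₁.2 1 (by decide), k, hk1, by omega, hk, hmin⟩
  rintro s₁ ⟨ha, k, hk1, hkn, hk, hmin⟩ -
  refine Runs.seq (T := 20) (T' := 100 * n + 80) (Q := fun s' => s'.var rI = 0 ∧ s'.var rWitK = k ∧
    ∀ a, s'.arr 1 a = if a = k then 1 else 0) ?_ ?_ (by linarith)
  · apply Runs.of_loopFree rfl
    · norm_num [Program.bound, Expr.cost]
    · simp [Program.run, hk, ha, f₀.2 1 (by decide), hout]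
  rintro s₂ ⟨hi, hk₂, ha₂⟩ f₂
  refine (Runs.loop (c := 30) (fun v s' => ∃ i : ℕ, v + i = k ∧ s'.var rI = i ∧
      ∀ a, s'.arr 1 a = if a = k then 1 else if a < i then -1 else 0) k (by norm_num)
      ⟨0, by omega, by simpa using hi, fun a => by simp [ha₂]⟩ ?_ ?_).mono le_rfl ?_
  · rintro v s₃ ⟨i, hv, hi, ha₃⟩ f₃ hb
    have hk₃ : s₃.var rWitK = k := by rw [f₃.1 _ (by decide), hk₂]
    have hik : i < k := by simpa [hi, hk₃] using hb
    apply Runs.of_loopFree rfl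
    · norm_num [Program.bound, Expr.cost, show ∀ e f : Expr, e + f = .add e f from fun _ _ => rfl]
    refine ⟨v - 1, by omega, i + 1, by omega, by simp [Program.run, hi], fun a => ?_⟩
    simp only [Program.run, State.setVar_arr, State.setArr_arr, Expr.eval_var, Expr.eval_const, hi,
      address_natCast, ha₃, true_and, Rat.cast_neg, Rat.cast_one]
    by_cases h1 : a = i
    · rw [if_pos h1, if_neg (by omega), if_pos (by omega)]
    · rw [if_neg h1]
      congr 2
      apply propext
      omega
  · norm_num [Test.cost, Expr.cost]
    have : (k : ℝ) ≤ n := by exact_mod_cast hkn.le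
    linarith
  · rintro s₃ ⟨⟨v, i, hv, hi, ha₃⟩, hb, f₃⟩
    have hk₃ : s₃.var rWitK = k := by rw [f₃.1 _ (by decide), hk₂]
    have hik : k ≤ i := by simpa [hi, hk₃] using hb
    obtain rfl : i = k := by omega
    exact ⟨i, hk1, hkn, hmin, ha₃⟩

end SubsetSumRatio

/-! ### The choice of the parameters -/

namespace SubsetSumRatio

open RealRAM

theorem linear_le_two_pow {x : ℕ} (hx : 14 ≤ x) : (800 : ℝ) * x ≤ 2 ^ x := by
  induction x, hx using Nat.le_induction with
  | base => norm_num
  | succ x hx ih =>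
    have : (14 : ℝ) ≤ x := by exact_mod_cast hx
    rw [pow_succ]
    push_cast
    linarith

/-- In base-2 logarithms, up to polynomial factors, the conditions are linear in the rates: `h₁` is
`pow_le`, `h₂` says `B ≥ N G`, and `h₃` says `B ≥ (N/G)^2 / 4^m`. The factor `c * J ^ 4` in `B` pays
for the polynomial factors in the last two. -/
theorem Rates.valid (R : Rates) {q r : ℕ} (hr : 0 < r) (hq : 0 < q) (hm : 0 < R.m)
    (hm' : R.m ≤ 2 * R.h) (hJ : R.J = q * (2 * R.h)) (hg : 0 < R.g) (hgh : 2 * R.g ≤ R.h)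
    (hh : 28 ≤ R.h) (h₁ : 2 * R.h + R.g ≤ q * R.g) (h₂ : R.h ≤ R.b + R.g)
    (h₃ : 2 * (R.h + R.g) ≤ R.b + 2 * R.m) (hc : 2000000 ≤ R.c) :
    (R.params r).Valid (2 * R.h * r) q := by
  have h2 : (1 : ℝ) ≤ 2 := by norm_num
  have hhr : 28 ≤ R.h * r := hh.trans (Nat.le_mul_of_pos_right _ hr)
  have hM : (1 : ℝ) ≤ (2 * R.h * r : ℕ) := by exact_mod_cast (by nlinarith : 1 ≤ 2 * R.h * r)
  have hMJ : ((2 * R.h * r : ℕ) : ℝ) ≤ (R.J * r : ℕ) := by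
    rw [hJ]
    exact_mod_cast Nat.mul_le_mul_right r (Nat.le_mul_of_pos_left _ hq)
  have hc' : (2000000 : ℝ) ≤ R.c := by exact_mod_cast hc
  have hG : (R.params r).G = 1 / 2 ^ (R.g * r) := by
    simp only [Rates.params, one_div, inv_pow, pow_mul]
  have hN : (R.params r).N = 2 ^ (R.h * r) := by simp only [Rates.params, pow_mul]
  have hB : (R.params r).B = 2 ^ (R.b * r) * (R.c * ((R.J * r : ℕ) : ℝ) ^ 4) := by
    simp only [Rates.params, pow_mul]
  have hJ' : (R.params r).J = R.J * r := rfl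
  have hm'' : (R.params r).m = R.m * r := rfl
  have hJ4 : (1 : ℝ) ≤ ((R.J * r : ℕ) : ℝ) ^ 2 := one_le_pow₀ (hM.trans hMJ)
  constructor
  · exact Nat.mul_pos hm hr
  · exact Nat.mul_le_mul_right r hm'
  · simp only [Rates.params, hJ]; ring
  · exact hq
  · rw [hG]; positivity
  · rw [hG]
    exact one_div_le_one_div_of_le two_pos (le_self_pow₀ h2 (Nat.mul_pos hg hr).ne')
  · rw [hN]
    have := linear_le_two_pow (x := R.h * r) (by omega)
    push_cast at this ⊢
    linarith
  · rw [hG, hN, div_pow, one_pow, ← pow_mul, div_div, ← pow_mul, ← pow_add]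
    refine one_div_le_one_div_of_le (by positivity) (pow_le_pow_right₀ h2 ?_)
    nlinarith
  · rw [hG, hN, div_div_eq_mul_div, div_one]
    -- Since `2 ^ M = N ^ 2 = (N / G) * (N * G)`, the factor `N * G = 2 ^ y` is to spare, and `y` is
    -- at least half of `h * r`.
    obtain ⟨y, hy⟩ : ∃ y, R.h * r = y + R.g * r :=
      ⟨R.h * r - R.g * r, by have := Nat.mul_le_mul_right r (show R.g ≤ R.h by omega); omega⟩
    have hxy : R.h * r ≤ 2 * y := by nlinarith
    have := linear_le_two_pow (x := y) (by omega)
    have hxy' : ((2 * R.h * r : ℕ) : ℝ) ≤ 4 * y := by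
      exact_mod_cast (by nlinarith : 2 * R.h * r ≤ 4 * y)
    have hy1 : (1 : ℝ) ≤ y := by exact_mod_cast (show 1 ≤ y by omega)
    have h4 : (2 : ℝ) ^ (2 * R.h * r) = 2 ^ y * (2 ^ (R.h * r) * 2 ^ (R.g * r)) := by
      rw [← pow_add, ← pow_add]; congr 1; rw [mul_assoc]; omega
    rw [h4]
    have h5 : (1 : ℝ) ≤ 2 ^ (R.h * r) * 2 ^ (R.g * r) := by
      rw [← pow_add]; exact one_le_pow₀ h2
    nlinarith
  · rw [hG, hN, hB, hJ']
    have h4 : (2 : ℝ) ^ (R.h * r) * (1 / 2 ^ (R.g * r)) ≤ 2 ^ (R.b * r) := by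
      rw [mul_one_div, div_le_iff₀ (by positivity), ← pow_add]
      exact pow_le_pow_right₀ h2 (by nlinarith)
    have h5 : (1 : ℝ) ≤ 2 ^ (R.b * r) := one_le_pow₀ h2
    set J : ℝ := ((R.J * r : ℕ) : ℝ)
    calc 800 * ((2 * R.h * r : ℕ) : ℝ) * J * 2 ^ (R.h * r) * (1 / 2 ^ (R.g * r)) + 2
        = 800 * ((2 * R.h * r : ℕ) : ℝ) * J * (2 ^ (R.h * r) * (1 / 2 ^ (R.g * r))) + 2 := by ring
      _ ≤ 800 * J * J * 2 ^ (R.b * r) + 2 * 2 ^ (R.b * r) := by gcongr; linarith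
      _ = 2 ^ (R.b * r) * (800 * J ^ 2 + 2) := by ring
      _ ≤ 2 ^ (R.b * r) * (R.c * J ^ 4) := by
        gcongr
        calc 800 * J ^ 2 + 2 ≤ 2000000 * J ^ 2 := by linarith
          _ ≤ 2000000 * (J ^ 2 * J ^ 2) := by nlinarith
          _ = 2000000 * J ^ 4 := by ring
          _ ≤ R.c * J ^ 4 := by gcongr
  · rw [hG, hN, hB, hJ', hm'', div_div_eq_mul_div, div_one]
    set J : ℝ := ((R.J * r : ℕ) : ℝ)
    have h5 : (1 : ℝ) ≤ 2 ^ (R.h * r) * 2 ^ (R.g * r) := by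
      rw [← pow_add]; exact one_le_pow₀ h2
    have h6 : (2 ^ (R.h * r) * 2 ^ (R.g * r) : ℝ) ^ 2 ≤ 2 ^ (R.b * r) * 4 ^ (R.m * r) := by
      rw [show (4 : ℝ) = 2 ^ 2 by norm_num, ← pow_add, ← pow_mul, ← pow_mul, ← pow_add]
      exact pow_le_pow_right₀ h2 (by nlinarith)
    have h7 : 1 ≤ J ^ 2 * (2 ^ (R.h * r) * 2 ^ (R.g * r)) := one_le_mul_of_one_le_of_one_le hJ4 h5
    calc 8 * (400 * J ^ 2 * 2 ^ (R.h * r) * 2 ^ (R.g * r) + 1) ^ 2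
        ≤ 8 * (401 * (J ^ 2 * (2 ^ (R.h * r) * 2 ^ (R.g * r)))) ^ 2 := by gcongr; linarith
      -- The constant is `8 * 401 ^ 2`, covered by the lower bound on `c`.
      _ = 1286408 * J ^ 4 * (2 ^ (R.h * r) * 2 ^ (R.g * r)) ^ 2 := by ring
      _ ≤ R.c * J ^ 4 * (2 ^ (R.b * r) * 4 ^ (R.m * r)) := by gcongr; linarith
      _ = _ := by ring

theorem Rates.work_le (R : Rates) (hJ : 0 < R.J) (h3 : 3 ^ R.m ≤ 2 ^ R.b) {r : ℕ} (hr : 0 < r) :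
    (R.params r).work ≤ (R.c + 1) * R.J ^ 5 * (r ^ 5 * 2 ^ (R.b * r)) := by
  have h3' : (3 : ℝ) ^ (R.m * r) ≤ 2 ^ (R.b * r) := by
    rw [pow_mul, pow_mul]
    exact pow_le_pow_left₀ (by positivity) (by exact_mod_cast h3) r
  have hJ1 : (1 : ℝ) ≤ (R.J * r : ℕ) := by exact_mod_cast Nat.mul_pos hJ hr
  have hJ4 : (1 : ℝ) ≤ ((R.J * r : ℕ) : ℝ) ^ 4 := one_le_pow₀ hJ1
  simp only [Params.work, Rates.params, ← pow_mul]
  calc ((R.J * r : ℕ) : ℝ) * (3 ^ (R.m * r) + 2 ^ (R.b * r) * (R.c * ((R.J * r : ℕ) : ℝ) ^ 4))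
      ≤ (R.J * r : ℕ) * (2 ^ (R.b * r) * ((R.J * r : ℕ) : ℝ) ^ 4 +
          2 ^ (R.b * r) * (R.c * ((R.J * r : ℕ) : ℝ) ^ 4)) := by
        gcongr
        exact h3'.trans (le_mul_of_one_le_right (by positivity) hJ4)
    _ = _ := by push_cast; ring

/-- The total running time. -/
theorem Rates.time_le (R : Rates) {α ε : ℝ} (hJ : 0 < R.J) (h3 : 3 ^ R.m ≤ 2 ^ R.b) (hα : 0 ≤ α)
    (hb : (R.b + 6 : ℕ) ≤ α * R.h) {n r : ℕ} (hn : 2 ≤ n) (hr : 0 < r) (hε : 0 < ε)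
    (hN : (R.params r).N * ε ≤ 2 ^ R.h) :
    (100 * r + 100) + (7000 * ((R.h * r + 4 : ℕ) + 1) * (n + 1) * (R.params r).work +
      (100 * ((R.params r).J : ℝ) + 200 * n + 400)) ≤
    ((600 + 100 * R.J + 14000 * (R.h + 5) * ((R.c + 1) * R.J ^ 5)) * (2 ^ R.h) ^ α) *
      (n / ε ^ α) := by
  have hr1 : (1 : ℝ) ≤ r := by exact_mod_cast hr
  have hn1 : (2 : ℝ) ≤ n := by exact_mod_cast hn
  have hJ0 : (0 : ℝ) ≤ R.J := Nat.cast_nonneg _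
  have hh0 : (0 : ℝ) ≤ R.h := Nat.cast_nonneg _
  set W : ℝ := r ^ 6 * 2 ^ (R.b * r) with hW
  have hr5 : (1 : ℝ) ≤ r ^ 5 * 2 ^ (R.b * r) :=
    one_le_mul_of_one_le_of_one_le (one_le_pow₀ hr1) (one_le_pow₀ (by norm_num))
  have hWr : W = r * (r ^ 5 * 2 ^ (R.b * r)) := by rw [hW]; ring
  have hrW : r ≤ W := by rw [hWr]; exact le_mul_of_one_le_right (by positivity) hr5
  have hW1 : 1 ≤ W := hr1.trans hrW
  have key : W ≤ (2 ^ R.h) ^ α / ε ^ α := by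
    rw [← Real.div_rpow (by positivity) hε.le]
    -- Five factors `r` come from the list work and one from the number of rounds. By `r ≤ 2 ^ r`
    -- they cost six units of the rate, which is the `6` in `hb`.
    calc W ≤ (2 ^ r) ^ 6 * 2 ^ (R.b * r) := by
          rw [hW]
          gcongr
          exact_mod_cast Nat.lt_two_pow_self.le
      _ = (2 : ℝ) ^ (((R.b + 6 : ℕ) : ℝ) * r) := by
          rw [← pow_mul, ← pow_add, ← Nat.cast_mul, Real.rpow_natCast]
          ring
      _ ≤ (2 : ℝ) ^ (α * R.h * r) := by
          apply Real.rpow_le_rpow_of_exponent_le (by norm_num)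
          gcongr
      _ = ((R.params r).N) ^ α := by
          rw [show α * R.h * r = ((R.h * r : ℕ) : ℝ) * α by push_cast; ring,
            Real.rpow_mul (by norm_num), Real.rpow_natCast, pow_mul]
          rfl
      _ ≤ _ := Real.rpow_le_rpow (by simp only [Rates.params]; positivity)
          ((le_div_iff₀ hε).2 hN) hα
  have hwork := R.work_le hJ h3 hr
  have hnW : (n : ℝ) ≤ n * W := le_mul_of_one_le_right (by positivity) hW1
  have hrnW : (r : ℝ) ≤ n * W := by nlinarith
  have hmain : 7000 * (((R.h * r + 4 : ℕ) : ℝ) + 1) * (n + 1) * (R.params r).work ≤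
      14000 * (R.h + 5) * ((R.c + 1) * R.J ^ 5) * (n * W) := by
    calc 7000 * (((R.h * r + 4 : ℕ) : ℝ) + 1) * (n + 1) * (R.params r).work
        ≤ 7000 * ((R.h + 5) * r) * (2 * n) *
            ((R.c + 1) * R.J ^ 5 * (r ^ 5 * 2 ^ (R.b * r))) := by
          have : ((R.h * r + 4 : ℕ) : ℝ) + 1 ≤ (R.h + 5) * r := by push_cast; linarith
          have hw : 0 ≤ (R.params r).work := by
            simp only [Params.work, Rates.params]
            positivity
          gcongr
          linarith
      _ = _ := by rw [hWr]; ring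
  have hJr : ((R.params r).J : ℝ) ≤ R.J * (n * W) := by
    simp only [Rates.params, Nat.cast_mul]
    gcongr
  calc _ ≤ (600 + 100 * R.J + 14000 * (R.h + 5) * ((R.c + 1) * R.J ^ 5)) * (n * W) := by
        linarith
    _ ≤ (600 + 100 * R.J + 14000 * (R.h + 5) * ((R.c + 1) * R.J ^ 5)) *
        (n * ((2 ^ R.h) ^ α / ε ^ α)) := by gcongr
    _ = _ := by ring

/-- Rates for the exponent `0.9386`. -/
def rates : Rates where
  -- The rates are in millionths. They satisfy `b = h - g` and `b + 6 = 0.9386 * h` exactly, `J = 34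
  -- * (2 * h)`, and the other balance conditions with little slack; the ideal value of `b / h` is
  -- `4 / (3 + 2 log_3 2) ≈ 0.938557`.
  h := 1000000
  m := 592110
  g := 61406
  b := 938594
  J := 68000000
  c := 2000000

theorem rates_valid {r : ℕ} (hr : 0 < r) :
    (rates.params r).Valid (2 * rates.h * r) 34 :=
  rates.valid hr (by decide) (by decide) (by decide) (by decide) (by decide) (by decide) (by decide)
    (by decide) (by decide) (by decide) (by decide)

/-- The fraction `485 / 306` is a convergent of `log_2 3` from above, so one comparison of moderate
powers replaces that of the huge ones. -/
theorem three_pow_le_two_pow {m b n : ℕ} (hm : m = 306 * n) (hb : 485 * n ≤ b) :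
    3 ^ m ≤ 2 ^ b := by
  have h : 3 ^ 306 ≤ 2 ^ 485 := by
    set_option exponentiation.threshold 500 in norm_num
  calc 3 ^ m = (3 ^ 306) ^ n := by rw [hm, pow_mul]
    _ ≤ (2 ^ 485) ^ n := Nat.pow_le_pow_left h n
    _ = 2 ^ (485 * n) := (pow_mul _ _ _).symm
    _ ≤ 2 ^ b := Nat.pow_le_pow_right two_pos hb

theorem three_pow_rates_le : 3 ^ rates.m ≤ 2 ^ rates.b :=
  three_pow_le_two_pow (n := 1935) (by decide) (by decide)

end SubsetSumRatio

/-! ### Ratios -/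

namespace SubsetSumRatio

open RealRAM

theorem quot_zero_right (x : ℝ) : quot x 0 = ⊤ := if_pos rfl

theorem ofReal_le_quot {x y ρ : ℝ} (hy : 0 ≤ y) (h : ρ * y ≤ x) :
    ENNReal.ofReal ρ ≤ quot x y := by
  unfold quot
  split_ifs with h0
  · exact le_top
  · exact ENNReal.ofReal_le_ofReal ((le_div_iff₀ (lt_of_le_of_ne hy (Ne.symm h0))).2 h)

theorem quot_le_ofReal {x y ρ : ℝ} (hy : 0 < y) (h : x ≤ ρ * y) :
    quot x y ≤ ENNReal.ofReal ρ := by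
  rw [quot, if_neg hy.ne']
  exact ENNReal.ofReal_le_ofReal ((div_le_iff₀ hy).2 h)

section

variable {n : ℕ} {I : Fin n → ℝ}

theorem ratio_le_ofReal {X Y : Finset (Fin n)} {ρ : ℝ} (hX : 0 < ∑ i ∈ X, I i)
    (hY : 0 < ∑ i ∈ Y, I i) (h : ∑ i ∈ X, I i ≤ ρ * ∑ i ∈ Y, I i)
    (h' : ∑ i ∈ Y, I i ≤ ρ * ∑ i ∈ X, I i) : ratio I X Y ≤ ENNReal.ofReal ρ :=
  max_le (quot_le_ofReal hY h) (quot_le_ofReal hX h')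

theorem ofReal_le_ratio (hI : ∀ i, 0 < I i) {X Y : Finset (Fin n)} {ρ : ℝ}
    (h : ¬ (∑ i ∈ X, I i ≤ ρ * ∑ i ∈ Y, I i ∧ ∑ i ∈ Y, I i ≤ ρ * ∑ i ∈ X, I i)) :
    ENNReal.ofReal ρ ≤ ratio I X Y := by
  rcases not_and_or.1 h with h | h
  · exact (ofReal_le_quot (Finset.sum_nonneg fun i _ => (hI i).le) (not_le.1 h).le).trans
      (le_max_left _ _)
  · exact (ofReal_le_quot (Finset.sum_nonneg fun i _ => (hI i).le) (not_le.1 h).le).trans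
      (le_max_right _ _)

theorem one_le_opt (hI : ∀ i, 0 < I i) : 1 ≤ opt I := by
  refine le_iInf fun X => le_iInf fun Y => le_iInf fun _ => ?_
  rw [← ENNReal.ofReal_one]
  have h : ∀ S : Finset (Fin n), 0 ≤ ∑ i ∈ S, I i := fun S => Finset.sum_nonneg fun i _ => (hI i).le
  rcases le_total (∑ i ∈ X, I i) (∑ i ∈ Y, I i) with h' | h'
  · exact (ofReal_le_quot (h X) (by rwa [one_mul])).trans (le_max_right _ _)
  · exact (ofReal_le_quot (h Y) (by rwa [one_mul])).trans (le_max_left _ _)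

theorem ratio_empty : ratio I ∅ ∅ = ⊤ := by
  simp [ratio, quot_zero_right]

/-- The items as a sequence. -/
noncomputable def items (I : Fin n → ℝ) : ℕ → ℝ := (input I 0).arr 0

theorem items_apply (i : Fin n) : items I i = I i := by
  simp [items, input]

theorem items_of_lt {i : ℕ} (h : i < n) : items I i = I ⟨i, h⟩ := items_apply ⟨i, h⟩

theorem sum_range_items {k : ℕ} (hk : k ≤ n) :
    ∑ i ∈ Finset.range k, items I i = ∑ i ∈ ({i : Fin n | (i : ℕ) < k} : Finset (Fin n)), I i := by
  symm
  refine Finset.sum_nbij (fun i : Fin n => (i : ℕ)) (fun i hi => by simpa using hi)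
    (fun i _ j _ h => Fin.ext h) (fun i hi => ?_) fun i _ => (items_apply i).symm
  have : i < k := by simpa using hi
  exact ⟨⟨i, by omega⟩, by simpa using this, rfl⟩

theorem sum_pattern {k e : ℕ} (hk : k < n) (he : e ≤ k + 1) (P : ℕ → Prop) [DecidablePred P] :
    ∑ j ∈ Finset.Ico 0 e, (if P j then items I (k - j) else 0) =
      ∑ i ∈ ({i : Fin n | (i : ℕ) ≤ k ∧ k - i < e ∧ P (k - i)} : Finset (Fin n)), I i := by
  rw [← Finset.sum_filter]
  symm
  refine Finset.sum_nbij (fun i : Fin n => k - (i : ℕ)) (fun i hi => ?_) (fun i hi j hj h => ?_) (fun j hj => ?_)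
    fun i hi => ?_
  · have := (Finset.mem_filter.1 hi).2
    exact Finset.mem_filter.2 ⟨Finset.mem_Ico.2 ⟨Nat.zero_le _, this.2.1⟩, this.2.2⟩
  · have h1 := (Finset.mem_filter.1 hi).2.1
    have h2 := (Finset.mem_filter.1 hj).2.1
    dsimp only at h
    apply Fin.ext
    omega
  · obtain ⟨h1, h2⟩ := Finset.mem_filter.1 (Finset.mem_coe.1 hj)
    have h3 := (Finset.mem_Ico.1 h1).2
    have h4 : k - (k - j) = j := by omega
    refine ⟨⟨k - j, by omega⟩, ?_, h4⟩
    refine Finset.mem_coe.2 (Finset.mem_filter.2 ⟨Finset.mem_univ _, ?_⟩)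
    dsimp only
    rw [h4]
    exact ⟨by omega, h3, h2⟩
  · have h1 := (Finset.mem_filter.1 hi).2.1
    rw [show k - (k - (i : ℕ)) = i by omega, items_apply]

/-- Lower bounds for patterns are lower bounds for pairs of sets. -/
theorem not_good_of_patterns {ρ : ℝ}
    (h : ∀ k < n, ∀ d : ℕ → Fin 3, d 0 ≠ 0 →
      ¬ ((patternEntry (fun i => items I (k - i)) d 0 (k + 1)).sx ≤
          ρ * (patternEntry (fun i => items I (k - i)) d 0 (k + 1)).sy ∧
        (patternEntry (fun i => items I (k - i)) d 0 (k + 1)).sy ≤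
          ρ * (patternEntry (fun i => items I (k - i)) d 0 (k + 1)).sx))
    {X Y : Finset (Fin n)} (hXY : Disjoint X Y) (hne : (X ∪ Y).Nonempty) :
    ¬ (∑ i ∈ X, I i ≤ ρ * ∑ i ∈ Y, I i ∧ ∑ i ∈ Y, I i ≤ ρ * ∑ i ∈ X, I i) := by
  classical
  -- Counting positions downwards from the largest index in use makes digit `0` nonzero.
  set k := (X ∪ Y).max' hne
  have hk : k ∈ X ∪ Y := Finset.max'_mem _ hne
  have hle : ∀ i ∈ X ∪ Y, i ≤ k := fun i hi => Finset.le_max' _ i hi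
  let P (S : Finset (Fin n)) (j : ℕ) : Prop := ∃ i ∈ S, (i : ℕ) + j = k
  let d (j : ℕ) : Fin 3 := if P X j then 1 else if P Y j then 2 else 0
  have hdisj : ∀ j, P X j → ¬ P Y j := by
    rintro j ⟨i, hi, hij⟩ ⟨i', hi', hij'⟩
    obtain rfl : i = i' := Fin.ext (by omega)
    exact Finset.disjoint_left.1 hXY hi hi'
  have hd1 : ∀ j, d j = 1 ↔ P X j := by
    intro j
    by_cases h1 : P X j <;> by_cases h2 : P Y j <;> simp [d, h1, h2]
  have hd2 : ∀ j, d j = 2 ↔ P Y j := by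
    intro j
    by_cases h1 : P X j
    · simp [d, h1, hdisj j h1]
    · by_cases h2 : P Y j <;> simp [d, h1, h2]
  have hset : ∀ S ⊆ X ∪ Y, ({i : Fin n | (i : ℕ) ≤ k ∧ (k : ℕ) - i < k + 1 ∧ P S (k - i)} :
      Finset (Fin n)) = S := by
    intro S hS
    ext i
    simp only [Finset.mem_filter, Finset.mem_univ, true_and]
    constructor
    · rintro ⟨h1, -, i', hi', h2⟩
      obtain rfl : i = i' := Fin.ext (by omega)
      exact hi'
    · intro hi
      have := hle i (hS hi)
      exact ⟨this, by omega, i, hi, by have : (i : ℕ) ≤ k := this; omega⟩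
  have hsum : ∀ S ⊆ X ∪ Y, ∑ j ∈ Finset.Ico 0 ((k : ℕ) + 1),
      (if P S j then items I (k - j) else 0) = ∑ i ∈ S, I i := by
    intro S hS
    rw [sum_pattern k.2 le_rfl, hset S hS]
  have hd0 : d 0 ≠ 0 := by
    rcases Finset.mem_union.1 hk with h' | h'
    · rw [(hd1 0).2 ⟨k, h', rfl⟩]; decide
    · rw [(hd2 0).2 ⟨k, h', rfl⟩]; decide
  have := h k k.2 d hd0
  simp only [patternEntry, hd1, hd2] at this
  rwa [hsum X Finset.subset_union_left, hsum Y Finset.subset_union_right] at this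

theorem ofReal_le_opt (hI : ∀ i, 0 < I i) {ρ : ℝ}
    (h : ∀ X Y : Finset (Fin n), Disjoint X Y → (X ∪ Y).Nonempty →
      ¬ (∑ i ∈ X, I i ≤ ρ * ∑ i ∈ Y, I i ∧ ∑ i ∈ Y, I i ≤ ρ * ∑ i ∈ X, I i)) :
    ENNReal.ofReal ρ ≤ opt I := by
  refine le_iInf fun X => le_iInf fun Y => le_iInf fun hXY => ?_
  rcases (X ∪ Y).eq_empty_or_nonempty with h0 | h0
  · obtain ⟨rfl, rfl⟩ := Finset.union_eq_empty.1 h0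
    rw [ratio_empty]
    exact le_top
  · exact ofReal_le_ratio hI (h X Y hXY h0)

/-- If no two sets have ratio at most `2`, then the items grow quickly. -/
theorem sum_range_lt (hmono : Monotone I)
    (h : ∀ X Y : Finset (Fin n), Disjoint X Y → (X ∪ Y).Nonempty →
      ¬ (∑ i ∈ X, I i ≤ 2 * ∑ i ∈ Y, I i ∧ ∑ i ∈ Y, I i ≤ 2 * ∑ i ∈ X, I i))
    (hI : ∀ i, 0 < I i) {k : ℕ} (hk : k < n) :
    ∑ i ∈ Finset.range k, items I i < items I k := by
  classical
  by_contra! hcon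
  have hex : ∃ j, items I k ≤ ∑ i ∈ Finset.range j, items I i := ⟨k, hcon⟩
  -- The shortest prefix whose sum reaches item `k` ends with an item no larger than item `k`. Its
  -- sum is therefore less than twice item `k`, and the two together have ratio at most `2`.
  obtain ⟨j, hj, hmin⟩ : ∃ j, items I k ≤ ∑ i ∈ Finset.range j, items I i ∧
      ∀ j' < j, ∑ i ∈ Finset.range j', items I i < items I k :=
    ⟨Nat.find hex, Nat.find_spec hex, fun j' h => not_le.1 (Nat.find_min hex h)⟩
  have hjk : j ≤ k := by
    by_contra! hkj
    exact absurd (hmin k hkj) (not_lt.2 hcon)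
  have hk0 : 0 < items I k := by rw [items_of_lt hk]; exact hI _
  have hj0 : j ≠ 0 := by
    rintro rfl
    simp at hj
    linarith
  obtain ⟨j, rfl⟩ := Nat.exists_eq_succ_of_ne_zero hj0
  have h1 := hmin j (Nat.lt_succ_self j)
  have h2 : items I j ≤ items I k := by
    rw [items_of_lt hk, items_of_lt (show j < n by omega)]
    exact hmono (Fin.mk_le_mk.2 (by omega))
  have h3 : ∑ i ∈ Finset.range (j + 1), items I i < 2 * items I k := by
    rw [Finset.sum_range_succ]
    linarith
  refine h {⟨k, hk⟩} {i : Fin n | (i : ℕ) < j + 1} ?_ ?_ ?_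
  · rw [Finset.disjoint_singleton_left, Finset.mem_filter]
    rintro ⟨-, h'⟩
    dsimp only at h'
    omega
  · exact ⟨⟨k, hk⟩, by simp⟩
  · rw [Finset.sum_singleton, ← sum_range_items (show j + 1 ≤ n by omega), ← items_of_lt (I := I) hk]
    have h4 : items I k ≤ ∑ i ∈ Finset.range (j + 1), items I i := hj
    exact ⟨by linarith, h3.le⟩

/-- The set with the overall largest item weighs at least that item, and the other weighs at most
all smaller items together. -/
theorem quot_le_of_max (hI : ∀ i, 0 < I i) {X Y : Finset (Fin n)} (hXY : Disjoint X Y) {k : Fin n}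
    (hk : k ∈ X) (hle : ∀ i ∈ X ∪ Y, i ≤ k) (hY : Y.Nonempty) :
    1 ≤ (k : ℕ) ∧ ENNReal.ofReal (items I k / ∑ i ∈ Finset.range k, items I i) ≤
      quot (∑ i ∈ X, I i) (∑ i ∈ Y, I i) := by
  have hlt : ∀ i ∈ Y, (i : ℕ) < k := fun i hi =>
    lt_of_le_of_ne (hle i (Finset.mem_union_right _ hi)) fun h =>
      Finset.disjoint_left.1 hXY hk (Fin.ext h ▸ hi)
  obtain ⟨i₀, hi₀⟩ := hY
  refine ⟨by have := hlt i₀ hi₀; omega, ?_⟩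
  have h1 : I k ≤ ∑ i ∈ X, I i := Finset.single_le_sum (fun i _ => (hI i).le) hk
  have h2 : ∑ i ∈ Y, I i ≤ ∑ i ∈ Finset.range k, items I i := by
    rw [sum_range_items k.2.le]
    exact Finset.sum_le_sum_of_subset_of_nonneg
      (fun i hi => Finset.mem_filter.2 ⟨Finset.mem_univ _, hlt i hi⟩) fun i _ _ => (hI i).le
  have h3 : 0 < ∑ i ∈ Y, I i := Finset.sum_pos (fun i _ => hI i) ⟨i₀, hi₀⟩
  refine ofReal_le_quot h3.le ?_
  rw [items_apply, div_mul_eq_mul_div, div_le_iff₀ (h3.trans_le h2)]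
  exact mul_le_mul h1 h2 h3.le ((hI k).le.trans h1)

theorem le_opt_of_forall (hI : ∀ i, 0 < I i) {ρ : ℝ}
    (h : ∀ k, 1 ≤ k → k < n → ρ ≤ items I k / ∑ i ∈ Finset.range k, items I i) :
    ENNReal.ofReal ρ ≤ opt I := by
  refine le_iInf fun X => le_iInf fun Y => le_iInf fun hXY => ?_
  rcases X.eq_empty_or_nonempty with rfl | hX
  · simp [ratio, quot_zero_right]
  rcases Y.eq_empty_or_nonempty with rfl | hY
  · simp [ratio, quot_zero_right]
  have hne : (X ∪ Y).Nonempty := hX.mono Finset.subset_union_left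
  have hle : ∀ i ∈ X ∪ Y, i ≤ (X ∪ Y).max' hne := fun i hi => Finset.le_max' _ i hi
  rcases Finset.mem_union.1 (Finset.max'_mem _ hne) with hk | hk
  · obtain ⟨h1, h2⟩ := quot_le_of_max hI hXY hk hle hY
    exact (ENNReal.ofReal_le_ofReal (h _ h1 (Fin.is_lt _))).trans (h2.trans (le_max_left _ _))
  · obtain ⟨h1, h2⟩ := quot_le_of_max hI hXY.symm hk (by rwa [Finset.union_comm]) hX
    exact (ENNReal.ofReal_le_ofReal (h _ h1 (Fin.is_lt _))).trans (h2.trans (le_max_right _ _))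

end

end SubsetSumRatio

/-! ### The algorithm -/

namespace SubsetSumRatio

open RealRAM

theorem input_ready_fields {n : ℕ} (I : Fin n → ℝ) (ε : ℝ) :
    (input I ε).arr 0 = items I ∧ (input I ε).var rCount = n ∧ (input I ε).var rEps = ε ∧
      ∀ a, (input I ε).arr 1 a = 0 := by
  simp [input, items]

/-- The sets described by a witness. -/
theorem exists_sets_of_pattern {n k e : ℕ} {I : Fin n → ℝ} (hk : k < n) (he : e ≤ k + 1)
    (d : ℕ → Fin 3) {s : State}
    (hs : ∀ a, s.arr 1 a = if a ≤ k ∧ k - a < e then mark (d (k - a)) else 0) :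
    ∃ X Y : Finset (Fin n), Outputs s X Y ∧ Disjoint X Y ∧
      (patternEntry (fun i => items I (k - i)) d 0 e).sx = ∑ i ∈ X, I i ∧
      (patternEntry (fun i => items I (k - i)) d 0 e).sy = ∑ i ∈ Y, I i := by
  classical
  refine ⟨({i : Fin n | (i : ℕ) ≤ k ∧ k - i < e ∧ d (k - i) = 1} : Finset (Fin n)),
    ({i : Fin n | (i : ℕ) ≤ k ∧ k - i < e ∧ d (k - i) = 2} : Finset (Fin n)), fun i => ?_, ?_,
    sum_pattern hk he _, sum_pattern hk he _⟩
  · rw [hs]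
    simp only [Finset.mem_filter, Finset.mem_univ, true_and, mark]
    by_cases h : (i : ℕ) ≤ k ∧ k - i < e
    · rw [if_pos h]
      simp only [h.1, h.2, true_and]
    · rw [if_neg h, if_neg fun h' => h ⟨h'.1, h'.2.1⟩, if_neg fun h' => h ⟨h'.1, h'.2.1⟩]
  · rw [Finset.disjoint_left]
    intro i hi hi'
    have h1 := (Finset.mem_filter.1 hi).2.2.2
    have h2 := (Finset.mem_filter.1 hi').2.2.2
    rw [h1] at h2
    exact absurd h2 (by decide)

theorem approx_of_pattern {n k e : ℕ} {I : Fin n → ℝ} {N ε lo hi : ℝ} (hk : k < n)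
    (he : e ≤ k + 1) (hI : ∀ i, 0 < I i) (hN : 0 < N) (hε : 1 / N ≤ ε) (hlo : 1 / (2 * N) ≤ lo)
    (hhi : hi - lo ≤ 1 / (8 * N)) (hlohi : lo ≤ hi)
    (hopt : lo = 1 / (2 * N) ∨ ENNReal.ofReal (1 + lo - 1 / (2 * N)) ≤ opt I)
    {d : ℕ → Fin 3} {s : State}
    (hs : ∀ a, s.arr 1 a = if a ≤ k ∧ k - a < e then mark (d (k - a)) else 0)
    (h : (patternEntry (fun i => items I (k - i)) d 0 e).sx <
      (1 + hi) * (patternEntry (fun i => items I (k - i)) d 0 e).sy)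
    (h' : (patternEntry (fun i => items I (k - i)) d 0 e).sy <
      (1 + hi) * (patternEntry (fun i => items I (k - i)) d 0 e).sx) :
    ∃ X Y : Finset (Fin n), Outputs s X Y ∧ Disjoint X Y ∧
      ratio I X Y ≤ ENNReal.ofReal (1 + ε) * opt I := by
  obtain ⟨X, Y, hout, hdisj, hX, hY⟩ := exists_sets_of_pattern (I := I) hk he d hs
  refine ⟨X, Y, hout, hdisj, ?_⟩
  rw [hX, hY] at h h'
  have h0 : ∀ S : Finset (Fin n), 0 ≤ ∑ i ∈ S, I i := fun S => Finset.sum_nonneg fun i _ => (hI i).le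
  have ha : 0 < 1 / N := by positivity
  have h2 : 1 / (2 * N) = (1 / N) / 2 := by field_simp
  have h8 : 1 / (8 * N) = (1 / N) / 8 := by field_simp
  have hhi0 : 0 < 1 + hi := by linarith
  refine (ratio_le_ofReal (pos_of_mul_pos_right ((h0 Y).trans_lt h') hhi0.le)
    (pos_of_mul_pos_right ((h0 X).trans_lt h) hhi0.le) h.le h'.le).trans ?_
  have hε0 : 0 ≤ 1 + ε := by linarith
  rcases hopt with hopt | hopt
  -- Here `lo` was never raised, so `hi ≤ 5 / (8 * N) ≤ ε`, and the trivial bound on `opt` is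
  -- enough.
  · calc ENNReal.ofReal (1 + hi) ≤ ENNReal.ofReal (1 + ε) * 1 := by
          rw [mul_one]
          exact ENNReal.ofReal_le_ofReal (by linarith)
      _ ≤ _ := by gcongr; exact one_le_opt hI
  -- The additive loss is at most `5 / (8 * N) ≤ ε`, and the lower bound it is compared with is at
  -- least `1`.
  · calc ENNReal.ofReal (1 + hi) ≤ ENNReal.ofReal ((1 + ε) * (1 + lo - 1 / (2 * N))) := by
          apply ENNReal.ofReal_le_ofReal
          nlinarith
      _ = ENNReal.ofReal (1 + ε) * ENNReal.ofReal (1 + lo - 1 / (2 * N)) := ENNReal.ofReal_mul hε0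
      _ ≤ _ := by gcongr

/-- By `hsum` the single item is the heavier side, so its ratio is exactly the quotient that
`le_opt_of_forall` compares with `opt`. No factor `1 + ε` is lost. -/
theorem optimal_of_greedy {n k : ℕ} {I : Fin n → ℝ} (hI : ∀ i, 0 < I i) (hk1 : 1 ≤ k) (hk : k < n)
    (hsum : ∑ i ∈ Finset.range k, items I i < items I k)
    (hmin : ∀ j, 1 ≤ j → j < n → items I k / ∑ i ∈ Finset.range k, items I i ≤
      items I j / ∑ i ∈ Finset.range j, items I i)
    {s : State} (hs : ∀ a, s.arr 1 a = if a = k then 1 else if a < k then -1 else 0) :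
    ∃ X Y : Finset (Fin n), Outputs s X Y ∧ Disjoint X Y ∧ ratio I X Y ≤ opt I := by
  classical
  refine ⟨{⟨k, hk⟩}, ({i : Fin n | (i : ℕ) < k} : Finset (Fin n)), fun i => ?_, ?_, ?_⟩
  · rw [hs]
    simp [Fin.ext_iff]
  · rw [Finset.disjoint_singleton_left, Finset.mem_filter]
    rintro ⟨-, h⟩
    exact lt_irrefl _ h
  · refine le_trans ?_ (le_opt_of_forall hI hmin)
    have hpos : 0 < ∑ i ∈ Finset.range k, items I i := by
      refine Finset.sum_pos (fun i hi => ?_) ⟨0, Finset.mem_range.2 hk1⟩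
      rw [items_of_lt ((Finset.mem_range.1 hi).trans hk)]
      exact hI _
    have hIk : 0 < items I k := hpos.trans hsum
    have hX : ∑ i ∈ {(⟨k, hk⟩ : Fin n)}, I i = items I k := by
      rw [Finset.sum_singleton, items_of_lt hk]
    have hY := sum_range_items (I := I) hk.le
    apply ratio_le_ofReal
    · rwa [hX]
    · rwa [← hY]
    · rw [hX, ← hY, div_mul_cancel₀ _ hpos.ne']
    · rw [hX, ← hY]
      exact hsum.le.trans (le_mul_of_one_le_left hIk.le ((one_le_div hpos).2 hsum.le))

theorem algorithm_spec {n : ℕ} {I : Fin n → ℝ} {ε : ℝ} (hn : 2 ≤ n) (hI : ∀ i, 0 < I i)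
    (hmono : Monotone I) (hε : 0 < ε) (hε' : ε < 1) (R : Rates) {q : ℕ} (hR : 28 ≤ R.h)
    (hvalid : ∀ r, 0 < r → (R.params r).Valid (2 * R.h * r) q) :
    ∃ r, 0 < r ∧ (R.params r).N * ε ≤ 2 ^ R.h ∧
      Runs (algorithm R) (input I ε) ((100 * r + 100) +
        (7000 * ((R.h * r + 4 : ℕ) + 1) * (n + 1) * (R.params r).work +
          (100 * ((R.params r).J : ℝ) + 200 * n + 400)))
      fun s => ∃ X Y : Finset (Fin n), Outputs s X Y ∧ Disjoint X Y ∧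
        ratio I X Y ≤ ENNReal.ofReal (1 + ε) * opt I := by
  obtain ⟨h0, h1, h2, h3⟩ := input_ready_fields I ε
  obtain ⟨r, hr, hN1, hN2, hsetup⟩ := setup_spec R (by omega) h0 h1 h2 hε hε'
  refine ⟨r, hr, hN2, ?_⟩
  have hp := hvalid r hr
  set p := R.params r with hpdef
  have hN0 : 0 < p.N := hp.N_pos
  have hN400 : 400 ≤ p.N := by
    have h := hp.N_ge
    have : (1 : ℝ) ≤ (2 * R.h * r : ℕ) := by exact_mod_cast (by nlinarith : 1 ≤ 2 * R.h * r)
    linarith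
  have hNε : 1 / p.N ≤ ε := (div_le_iff₀' hN0).2 hN1
  -- The four extra rounds shrink an interval of length at most `2` to one eighth of `1 / N`.
  have hT : (2 : ℝ) / 2 ^ (R.h * r + 4) = 1 / (8 * p.N) := by
    have : p.N = 2 ^ (R.h * r) := by rw [pow_mul]; rfl
    rw [this, pow_add]
    field_simp
    norm_num
  have hI' : ∀ i < n, 0 < items I i := fun i hi => by rw [items_of_lt hi]; exact hI _
  have hmono' : ∀ i j, i ≤ j → j < n → items I i ≤ items I j := fun i j hij hj => by
    rw [items_of_lt hj, items_of_lt (hij.trans_lt hj)]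
    exact hmono (Fin.mk_le_mk.2 hij)
  refine Runs.seq hsetup ?_ le_rfl
  rintro s₁ ⟨hs₁, hrounds⟩ f₁
  refine Runs.seq (bisect_spec hp (by linarith) hI' hs₁ hrounds) ?_ le_rfl
  rintro s₂ ⟨lo, hi, hlo, hlohi, hhi, hgap, htested, hres⟩ f₂
  have hs₂ := hs₁.of_frame f₂ (by decide) (by decide)
  have hout : ∀ a, s₂.arr 1 a = 0 := fun a => by
    rw [f₂.2 1 (by decide), f₁.2 1 (by simp [Program.wa, setup]), h3]
  have hlower : (∀ k < n, p.Unsuccessful (items I) lo k) → ∀ X Y : Finset (Fin n), Disjoint X Y →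
      (X ∪ Y).Nonempty → ¬ (∑ i ∈ X, I i ≤ (1 + lo - 1 / (2 * p.N)) * ∑ i ∈ Y, I i ∧
        ∑ i ∈ Y, I i ≤ (1 + lo - 1 / (2 * p.N)) * ∑ i ∈ X, I i) := fun hU X Y =>
    not_good_of_patterns fun k hk d hd =>
      Params.not_good_of_unsuccessful hp hI' hmono' hlo (hlohi.trans hhi) hU hk d hd
  rw [hT] at hgap
  have hJ0 : (0 : ℝ) ≤ p.J := Nat.cast_nonneg _
  have hn0 : (0 : ℝ) ≤ n := Nat.cast_nonneg _
  have hε1 : (1 : ENNReal) ≤ ENNReal.ofReal (1 + ε) := by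
    rw [← ENNReal.ofReal_one]
    exact ENNReal.ofReal_le_ofReal (by linarith)
  refine Runs.ite (T := 100 * p.J + 200 * n + 300) ?_ ?_ ?_
  · intro hb
    have hwit : s₂.var rWit ≠ 0 := by
      have : 0 < s₂.var rWit := by simpa using hb
      exact this.ne'
    obtain ⟨-, k, hk, hwk, d, hco, hx, hy⟩ := hres.resolve_left fun h => hwit h.1
    refine (decode_spec hs₂ hwk hco hout).mono (by linarith) fun s₃ hs₃ => ?_
    exact approx_of_pattern hk (min_le_right _ _) hI hN0 hNε hlo hgap hlohi
      (htested.imp_right fun hU => ofReal_le_opt hI (hlower hU)) hs₃ hx hy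
  · intro hb
    have hwit : s₂.var rWit ≠ 1 := by
      have : ¬ 0 < s₂.var rWit := by simpa using hb
      intro h
      rw [h] at this
      norm_num at this
    obtain ⟨-, rfl⟩ := hres.resolve_right fun h => hwit h.1
    have h8 : 1 / (8 * p.N) ≤ 1 / 8 := by
      apply one_div_le_one_div_of_le <;> linarith
    have h2 : 1 / (2 * p.N) ≤ 1 / 8 := by
      apply one_div_le_one_div_of_le <;> linarith
    -- With `hi = 2` and gap at most `1 / 8`, the endpoint `lo` has left its initial value, so it
    -- was tested.
    have hU := htested.resolve_left fun h => by linarith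
    -- The tested bound `1 + lo - 1 / (2 * N)` is at least `2.75`, more than the `2` needed.
    have hge : ∀ X Y : Finset (Fin n), Disjoint X Y → (X ∪ Y).Nonempty →
        ¬ (∑ i ∈ X, I i ≤ 2 * ∑ i ∈ Y, I i ∧ ∑ i ∈ Y, I i ≤ 2 * ∑ i ∈ X, I i) := by
      intro X Y hXY hne hXY2
      have h0 : ∀ S : Finset (Fin n), 0 ≤ ∑ i ∈ S, I i :=
        fun S => Finset.sum_nonneg fun i _ => (hI i).le
      refine hlower hU X Y hXY hne ⟨hXY2.1.trans ?_, hXY2.2.trans ?_⟩ <;>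
        exact mul_le_mul_of_nonneg_right (by linarith) (h0 _)
    refine (greedy_spec hn hs₂ hout).mono (by linarith) fun s₃ hs₃ => ?_
    obtain ⟨k, hk1, hk, hmin, hs₃⟩ := hs₃
    obtain ⟨X, Y, h4, h5, h6⟩ :=
      optimal_of_greedy hI hk1 hk (sum_range_lt hmono hge hI hk) hmin hs₃
    exact ⟨X, Y, h4, h5, h6.trans (le_mul_of_one_le_left zero_le hε1)⟩
  · norm_num [Test.cost, Expr.cost]
    linarith

end SubsetSumRatio

theorem theorem1 :
    ∃ (p : RealRAM.Program) (C : ℝ),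
      ∀ (n : ℕ) (I : Fin n → ℝ) (ε : ℝ), 2 ≤ n → (∀ i, 0 < I i) → Monotone I → 0 < ε → ε < 1 →
        ∃ (t : ℕ) (s : RealRAM.State) (X Y : Finset (Fin n)),
          RealRAM.Exec p (SubsetSumRatio.input I ε) t s ∧
          (t : ℝ) ≤ C * ((n : ℝ) / ε ^ (0.9386 : ℝ)) ∧
          SubsetSumRatio.Outputs s X Y ∧
          Disjoint X Y ∧
          SubsetSumRatio.ratio I X Y ≤ ENNReal.ofReal (1 + ε) * SubsetSumRatio.opt I := by
  refine ⟨SubsetSumRatio.algorithm SubsetSumRatio.rates,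
    (600 + 100 * SubsetSumRatio.rates.J + 14000 * (SubsetSumRatio.rates.h + 5) *
      ((SubsetSumRatio.rates.c + 1) * SubsetSumRatio.rates.J ^ 5)) *
      (2 ^ SubsetSumRatio.rates.h) ^ (0.9386 : ℝ), fun n I ε hn hI hmono hε hε' => ?_⟩
  obtain ⟨r, hr, hN, t, s, hexec, ht, X, Y, hout, hdisj, hratio⟩ :=
    SubsetSumRatio.algorithm_spec hn hI hmono hε hε' SubsetSumRatio.rates (by decide)
      fun r hr => SubsetSumRatio.rates_valid hr
  exact ⟨t, s, X, Y, hexec, ht.trans (SubsetSumRatio.rates.time_le (by decide)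
    SubsetSumRatio.three_pow_rates_le (by norm_num)
    (by norm_num [SubsetSumRatio.rates]) hn hr hε hN), hout, hdisj, hratio⟩
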